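/- **Notation.** Let $0<q<1$, $M\ge 1$, $\vec N=(N_1,\dots,N_M)$ with integers $N_k\ge 1$, $X=\prod_{k=1}^M\{0,\dots,N_k\}$, and write $|x|=\sum_k x_k$. For $b>0$ let $(a;b)_n=\prod_{i=0}^{n-1}(1-ab^i)$, $$[a]_b=\frac{b^a-b^{-a}}{b-b^{-1}}\ (b\ne1),\qquad {}_{r+1}\varphi_r\!\left(\begin{matrix}a_1,\dots,a_{r+1}\\ b_1,\dots,b_r\end{matrix};b,z\right)=\sum_{n\ge0}\frac{\prod_i(a_i;b)_n}{\prod_i(b_i;b)_n}\frac{z^n}{(b;b)_n},$$ (all series below terminate; terms with vanishing numerator are zero), $\binom Nn_b=\frac{(b;b)_N}{(b;b)_n(b;b)_{N-n}}$. For $\rho,\lambda\in\mathbb R$ and $\xi,\zeta\in X$ put $$h^+_{k,\rho}(\xi)=\rho+\sum_{j=k}^M(2\xi_j-N_j),\qquad h^-_{k,\lambda}(\zeta)=\lambda+\sum_{j=1}^k(2\zeta_j-N_j).$$ **Processes.** For $b>0$, $\mathrm{ASEP}(b,\vec N)$ is the Markov jump process on $X$ in which a particle jumps from $k$ to $k+1$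 at rate $c_k^+(\eta)=b^{-(\eta_{k+1}+N_k-\eta_k+1)}[\eta_k]_b[N_{k+1}-\eta_{k+1}]_b$ and from $k$ to $k-1$ at rate $c_k^-(\eta)=b^{\eta_{k-1}+N_k-\eta_k+1}[\eta_k]_b[N_{k-1}-\eta_{k-1}]_b$; its generator is $L_{b,\vec N}$. $\mathrm{ASEP}_{\mathsf R}(q,\vec N,\rho)$ has instead the rates (with $h_k^+=h_{k,\rho}^+(\xi)$, and $c^\pm_k$ taken with $b=q$) $$c_k^+(\xi)\frac{(1+q^{2\xi_k-2h_k^+})(1+q^{2\xi_{k+1}-2h_{k+1}^+})}{(1+q^{-2h_{k+1}^+})(1+q^{-2h_{k+1}^+-2})},\qquad c_k^-(\xi)\frac{(1+q^{-2\xi_{k-1}-2h_k^+})(1+q^{-2\xi_k-2h_{k+1}^+})}{(1+q^{-2h_k^+})(1+q^{-2h_k^++2})},$$ and generator $L^{\mathsf R}_{q,\vec N,\rho}$. A function $D:X\times X\to\mathbb R$ is a duality function between the processes with generators $L$ and $\widehat L$ if $[LD(\cdot,\xi)](\eta)=[\widehat LD(\eta,\cdot)](\xi)$ for all $\eta,\xi\in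 X$; it is a self-duality function if $\widehat L=L$. **The $q$-Racah duality function.** For $b\in\{q,q^{-1}\}$ let $$k(n,x;\rho,N;b)=(-1)^nb^{-n\rho+\frac12n(N-1)}\,{}_3\varphi_2\!\left(\begin{matrix}b^{-2n},b^{-2x},-b^{2\rho+2x-2N}\\ b^{-2N},0\end{matrix};b^2,b^2\right),$$ $u(\eta)=\sum_k\big(\eta_kN_k-2\eta_k\sum_{j\le k}N_j\big)$, $w(\eta)=q^{u(\eta)}\prod_kq^{\eta_k(\eta_k-N_k)}\binom{N_k}{\eta_k}_{q^2}$, and $$K_{\mathsf R}(\eta,\xi)=q^{-\frac12u(\eta)}\prod_kk(\eta_k,\xi_k;h^+_{k+1,\rho}(\xi),N_k;q),\qquad K_{\mathsf L}(\eta,\zeta)=q^{-\frac12u(\eta)}\prod_kk(\eta_k,\zeta_k;h^-_{k-1,\lambda}(\zeta),N_k;q^{-1}).$$ For $v\in\mathbb R\setminus\{0\}$ the $q$-Racah duality function is $R^v_{\lambda,\rho}(\zeta,\xi)=\sum_{\eta\in X}K_{\mathsf L}(\eta,\zeta)K_{\mathsf R}(\eta,\xi)w(\eta)(-v)^{|\eta|}$.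 **One-site functions.** Put $$p(n,x;\lambda,\rho,v,N)=v^n\frac{(-vq^{\rho+\lambda-N+1};q^2)_x\,(vq^{2n-\rho+\lambda-N+1};q^2)_N}{q^{n(n+\rho+\lambda-N)}(vq^{-2x-\rho+\lambda+N+1};q^2)_{x+n}}\;{}_3\varphi_2\!\left(\begin{matrix}q^{-2x},-q^{2\rho-2N+2x},q^{-2n}\\-vq^{\rho+\lambda-N+1},q^{-2N}\end{matrix};q^2,q^2\right)$$ ($q$-Hahn), $$k^{\mathrm{qtm}}(n,x;\lambda,\rho,v,N)={}_2\varphi_1\!\left(\begin{matrix}q^{-2x},q^{-2n}\\q^{-2N}\end{matrix};q^2,v^{-1}q^{\rho-\lambda-N+2x+1}\right)$$ (quantum $q$-Krawtchouk), and $$k^{\mathrm{aff}}(n,x;\lambda,\rho,v,N)=(-v)^n\frac{(vq^{\rho+\lambda-N+1};q^2)_x}{q^{n(n+\rho+\lambda-N)}}\;{}_3\varphi_2\!\left(\begin{matrix}q^{-2x},0,q^{-2n}\\vq^{\rho+\lambda-N+1},q^{-2N}\end{matrix};q^2,q^2\right)$$ (affine $q$-Krawtchouk). Finally let $$c^v(a,b;\lambda,\rho)=\frac{(vq^{\lambda-\rho+2a-|\vec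 N|+1};q^2)_{|\vec N|-a}}{(vq^{\lambda-\rho-2b+|\vec N|+1};q^2)_b},\qquad C^v(a,b;\lambda,\rho)=\frac{(-vq^{\lambda+\rho-|\vec N|+1};q^2)_b}{(-vq^{\lambda+\rho-|\vec N|+1};q^2)_a}.$$ **Proposition.** Let $v\in\mathbb R\setminus\{0\}$. (i) For every $\rho\in\mathbb R$ the limit $P^v_{\mathsf R}(\eta,\xi)=P^v_{\mathsf R}(\eta,\xi;\rho)=\lim_{\lambda\to\infty}q^{2\lambda|\eta|}R^{vq^{-\lambda}}_{\lambda,\rho}(\eta,\xi)$ exists for all $\eta,\xi\in X$, and $P^v_{\mathsf R}$ is a duality function between $\mathrm{ASEP}(q,\vec N)$ and $\mathrm{ASEP}_{\mathsf R}(q,\vec N,\rho)$. For all $\eta,\xi$ for which no denominator on the right-hand side vanishes, $$P^v_{\mathsf R}(\eta,\xi)=\prod_{k=1}^Mp(\eta_k,\xi_k;h^-_{k-1,0}(\eta),h^+_{k+1,\rho}(\xi),v,N_k).$$ (ii) The function $(\eta,\xi)\mapsto\prod_{k=1}^Mk^{\mathrm{qtm}}(\eta_k,\xi_k;h^-_{k-1,0}(\eta),h^+_{k+1,0}(\xi),v,N_k)$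 is a self-duality function for $\mathrm{ASEP}(q,\vec N)$. If $(vq^{1-|\vec N|};q^2)_{|\vec N|}\neq0$, then the limit $$K^v_{\mathrm{qtm}}(\eta,\xi)=\lim_{\rho\to-\infty}\frac{(v^{-2}q^{-2\rho})^{|\eta|}}{c^v(|\eta|,|\xi|;0,0)\,C^v(|\eta|,|\xi|;0,2\rho)}\,P^{vq^\rho}_{\mathsf R}(\eta,\xi;\rho)$$ exists for all $\eta,\xi\in X$, $K^v_{\mathrm{qtm}}$ is a self-duality function for $\mathrm{ASEP}(q,\vec N)$, and it equals the above product. (iii) The limit $$K^v_{\mathrm{aff}}(\eta,\xi)=\lim_{\rho\to\infty}\frac{q^{2\rho|\eta|}}{c^{-v}(|\eta|,|\xi|;0,2\rho)}\,P^{-vq^{-\rho}}_{\mathsf R}(\eta,\xi;\rho)$$ exists for all $\eta,\xi\in X$, and $K^v_{\mathrm{aff}}$ is a duality function between $\mathrm{ASEP}(q,\vec N)$ and $\mathrm{ASEP}(q^{-1},\vec N)$. For all $\eta,\xi$ for which no denominator on the right-hand side vanishes, $$K^v_{\mathrm{aff}}(\eta,\xi)=\prod_{k=1}^Mk^{\mathrm{aff}}(\eta_k,\xi_k;h^-_{k-1,0}(\eta),h^+_{k+1,0}(\xi),v,N_k).$$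 -/

import Mathlib

namespace QASEP

noncomputable section

open Filter Topology

/-! ### Basic `q`-notation -/

/-- The `q`-number `[a]_q`. -/
def qNumber (q a : ℝ) : ℝ :=
  if q = 1 then a else (q ^ a - q ^ (-a)) / (q - q⁻¹)

/-- The `q`-shifted factorial `(a;q)_n = (1 - a)(1 - aq) ⋯ (1 - aq^(n-1))`. -/
def qPoch (a q : ℝ) (n : ℕ) : ℝ :=
  ∏ i ∈ Finset.range n, (1 - a * q ^ i)

/-- The `q`-binomial coefficient. -/
def qBinom (q : ℝ) (n k : ℕ) : ℝ :=
  qPoch q q n / (qPoch q q k * qPoch q q (n - k))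

/-- The `q`-hypergeometric series with upper parameters `as` and lower parameters `bs`, where
`as` has exactly one more entry than `bs`. In all uses below an upper parameter is `q^(-n)` with
`n : ℕ`, so that all but finitely many terms are zero. -/
def qHyp (as bs : List ℝ) (q z : ℝ) : ℝ :=
  ∑' n : ℕ, (as.map fun a => qPoch a q n).prod / (bs.map fun b => qPoch b q n).prod
    * (z ^ n / qPoch q q n)

/-! ### The orthogonal polynomials -/

/-- (Dual) `q`-Krawtchouk polynomial `K_n(x;c,N;q)`, a `₃φ₂`. -/
def krawtchouk (n x : ℕ) (c : ℝ) (N : ℕ) (q : ℝ) : ℝ :=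
  qHyp [q ^ (-(n : ℝ)), q ^ (-(x : ℝ)), -c * q ^ ((x : ℝ) - N)] [q ^ (-(N : ℝ)), 0] q q

/-- `q`-Hahn polynomial `P_n(x;α,β,N;q)`, a `₃φ₂`. -/
def qHahn (n x : ℕ) (α β : ℝ) (N : ℕ) (q : ℝ) : ℝ :=
  qHyp [q ^ (-(n : ℝ)), α * β * q ^ ((n : ℝ) + 1), q ^ (-(x : ℝ))] [α * q, q ^ (-(N : ℝ))] q q

/-- Quantum `q`-Krawtchouk polynomial `K^qtm_n(x;p,N;q)`, a `₂φ₁`. -/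
def quantumKrawtchouk (n x : ℕ) (p : ℝ) (N : ℕ) (q : ℝ) : ℝ :=
  qHyp [q ^ (-(n : ℝ)), q ^ (-(x : ℝ))] [q ^ (-(N : ℝ))] q (p * q ^ ((n : ℝ) + 1))

/-- Affine `q`-Krawtchouk polynomial `K^aff_n(x;p,N;q)`, a `₃φ₂`. -/
def affineKrawtchouk (n x : ℕ) (p : ℝ) (N : ℕ) (q : ℝ) : ℝ :=
  qHyp [q ^ (-(n : ℝ)), 0, q ^ (-(x : ℝ))] [p * q, q ^ (-(N : ℝ))] q q

/-! ### One-site duality functions -/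

/-- `k(n,x;ρ,N;q) = (-1)^n q^(-nρ) q^(n(N-1)/2) K_n(x;q^(2ρ),N;q²)`. -/
def siteKrawtchouk (n x : ℕ) (ρ : ℝ) (N : ℕ) (q : ℝ) : ℝ :=
  (-1) ^ n * q ^ (-(n * ρ)) * q ^ ((n : ℝ) * ((N : ℝ) - 1) / 2)
    * krawtchouk n x (q ^ (2 * ρ)) N (q ^ 2)

/-- `p(n,x;λ,ρ,v,N;q)`: a normalized `q`-Hahn polynomial. -/
def siteHahn (n x : ℕ) (lam ρ v : ℝ) (N : ℕ) (q : ℝ) : ℝ :=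
  v ^ n
    * (qPoch (-v * q ^ (ρ + lam - N + 1)) (q ^ 2) x
        * qPoch (v * q ^ (2 * n - ρ + lam - N + 1)) (q ^ 2) N)
    / (q ^ (n * (n + ρ + lam - N))
        * qPoch (v * q ^ (-2 * x - ρ + lam + N + 1)) (q ^ 2) (x + n))
    * qHahn x n (-v * q ^ (ρ + lam - N - 1)) (v⁻¹ * q ^ (ρ - lam - N - 1)) N (q ^ 2)

/-- `k^qtm(n,x;λ,ρ,v,N;q)`. -/
def siteQtm (n x : ℕ) (lam ρ v : ℝ) (N : ℕ) (q : ℝ) : ℝ :=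
  quantumKrawtchouk x n (v⁻¹ * q ^ (ρ - lam - N - 1)) N (q ^ 2)

/-- `k^aff(n,x;λ,ρ,v,N;q)`: a normalized affine `q`-Krawtchouk polynomial. -/
def siteAff (n x : ℕ) (lam ρ v : ℝ) (N : ℕ) (q : ℝ) : ℝ :=
  (-v) ^ n * qPoch (v * q ^ (ρ + lam - N + 1)) (q ^ 2) x / q ^ (n * (n + ρ + lam - N))
    * affineKrawtchouk x n (v * q ^ (ρ + lam - N - 1)) N (q ^ 2)

/-! ### Particle configurations

There are `m + 1` sites, labelled `0, …, m` from left to right; site `k` holds at most `N k`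
particles. -/

/-- The state space `X`. -/
abbrev Config {m : ℕ} (N : Fin (m + 1) → ℕ) : Type :=
  (k : Fin (m + 1)) → Fin (N k + 1)

section Config

variable {m : ℕ} {N : Fin (m + 1) → ℕ}

/-- The number of particles at site `k`, as a real number. -/
def occ (η : Config N) (k : Fin (m + 1)) : ℝ := ((η k : ℕ) : ℝ)

/-- The total number of particles `|η|`. -/
def total (η : Config N) : ℕ := ∑ k, (η k : ℕ)

/-- The configuration after one particle has moved from site `i` to site `j ≠ i`. (If site `i` is
empty or site `j` is full then the move is impossible, the corresponding jump rates below are zero,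
and the value of `jump` is irrelevant; truncating keeps it inside the state space.) -/
def jump (η : Config N) (i j : Fin (m + 1)) : Config N := fun k =>
  ⟨min (if k = i then (η k : ℕ) - 1 else if k = j then (η k : ℕ) + 1 else (η k : ℕ)) (N k),
    Nat.lt_succ_of_le (min_le_right _ _)⟩

/-- The height function with boundary value `ρ` on the right: `ρ + ∑_{j ≥ k} (2 ξ_j - N_j)`. -/
def heightR (ρ : ℝ) (ξ : Config N) (k : ℕ) : ℝ :=
  ρ + ∑ j : Fin (m + 1), if k ≤ (j : ℕ) then 2 * occ ξ j - N j else 0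

/-- The sum over the sites strictly to the left of `k`, with boundary value `lam` on the left:
`lam + ∑_{j < k} (2 ζ_j - N_j)`. -/
def heightL (lam : ℝ) (ζ : Config N) (k : ℕ) : ℝ :=
  lam + ∑ j : Fin (m + 1), if (j : ℕ) < k then 2 * occ ζ j - N j else 0

/-! ### Generators

A bond `k : Fin m` joins the sites `k.castSucc` and `k.succ`. -/

/-- ASEP: rate of a jump to the right over the bond `k`. -/
def rateRight (q : ℝ) (η : Config N) (k : Fin m) : ℝ :=
  q ^ (-(occ η k.succ + N k.castSucc - occ η k.castSucc + 1))
    * qNumber q (occ η k.castSucc) * qNumber q (N k.succ - occ η k.succ)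

/-- ASEP: rate of a jump to the left over the bond `k`. -/
def rateLeft (q : ℝ) (η : Config N) (k : Fin m) : ℝ :=
  q ^ (occ η k.castSucc + N k.succ - occ η k.succ + 1)
    * qNumber q (occ η k.succ) * qNumber q (N k.castSucc - occ η k.castSucc)

/-- Dynamic ASEP: rate of a jump to the right over the bond `k`. -/
def dynRateRight (q ρ : ℝ) (ξ : Config N) (k : Fin m) : ℝ :=
  rateRight q ξ k
    * ((1 + q ^ (2 * occ ξ k.castSucc - 2 * heightR ρ ξ (k : ℕ)))
        * (1 + q ^ (2 * occ ξ k.succ - 2 * heightR ρ ξ ((k : ℕ) + 1))))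
    / ((1 + q ^ (-2 * heightR ρ ξ ((k : ℕ) + 1))) * (1 + q ^ (-2 * heightR ρ ξ ((k : ℕ) + 1) - 2)))

/-- Dynamic ASEP: rate of a jump to the left over the bond `k`. -/
def dynRateLeft (q ρ : ℝ) (ξ : Config N) (k : Fin m) : ℝ :=
  rateLeft q ξ k
    * ((1 + q ^ (-2 * occ ξ k.castSucc - 2 * heightR ρ ξ ((k : ℕ) + 1)))
        * (1 + q ^ (-2 * occ ξ k.succ - 2 * heightR ρ ξ ((k : ℕ) + 2))))
    / ((1 + q ^ (-2 * heightR ρ ξ ((k : ℕ) + 1))) * (1 + q ^ (-2 * heightR ρ ξ ((k : ℕ) + 1) + 2)))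

variable (N)

/-- The Markov generator of `ASEP(q,N)`. -/
def genASEP (q : ℝ) (f : Config N → ℝ) (η : Config N) : ℝ :=
  ∑ k : Fin m, (rateRight q η k * (f (jump η k.castSucc k.succ) - f η)
    + rateLeft q η k * (f (jump η k.succ k.castSucc) - f η))

/-- The Markov generator of dynamic ASEP with right boundary value, `ASEP_R(q,N,ρ)`. -/
def genASEPR (q ρ : ℝ) (f : Config N → ℝ) (ξ : Config N) : ℝ :=
  ∑ k : Fin m, (dynRateRight q ρ ξ k * (f (jump ξ k.castSucc k.succ) - f ξ)
    + dynRateLeft q ρ ξ k * (f (jump ξ k.succ k.castSucc) - f ξ))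

end Config

/-- Markov duality of the processes with generators `L` and `L'` with respect to `D`. -/
def IsDuality {Ω Ω' : Type*} (L : (Ω → ℝ) → Ω → ℝ) (L' : (Ω' → ℝ) → Ω' → ℝ)
    (D : Ω → Ω' → ℝ) : Prop :=
  ∀ η ξ, L (fun η' => D η' ξ) η = L' (fun ξ' => D η ξ') ξ

section Duality

variable {m : ℕ} (N : Fin (m + 1) → ℕ)

/-! ### The `q`-Racah duality function between the two dynamic processes -/

/-- `u(η;N) = ∑_k (η_k N_k - 2 η_k ∑_{j ≤ k} N_j)`. -/
def uExp (η : Config N) : ℝ :=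
  ∑ k, (occ η k * N k - 2 * occ η k * ∑ j ∈ Finset.Iic k, (N j : ℝ))

/-- The reversible measure `w(η;N;q)` of `ASEP(q,N)`. -/
def weight (q : ℝ) (η : Config N) : ℝ :=
  q ^ uExp N η * ∏ k, (q ^ (occ η k * (occ η k - N k)) * qBinom (q ^ 2) (N k) (η k))

/-- The duality function `K_R` between `ASEP(q,N)` and `ASEP_R(q,N,ρ)`. -/
def dualKR (q ρ : ℝ) (η ξ : Config N) : ℝ :=
  q ^ (-(uExp N η) / 2) * ∏ k, siteKrawtchouk (η k) (ξ k) (heightR ρ ξ ((k : ℕ) + 1)) (N k) q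

/-- The duality function `K_L` between `ASEP(q,N)` and the left version of dynamic ASEP. -/
def dualKL (q lam : ℝ) (η ζ : Config N) : ℝ :=
  q ^ (-(uExp N η) / 2) * ∏ k, siteKrawtchouk (η k) (ζ k) (heightL lam ζ (k : ℕ)) (N k) q⁻¹

/-- The `q`-Racah duality function `R^v(ζ,ξ)` between the left and the right version of dynamic
ASEP, as the scalar product of `K_L` and `K_R` with respect to the reversible measure `w`, with the
free parameter `v` entering through `(-v)^|η|`. -/
def dualRacah (q lam ρ v : ℝ) (ζ ξ : Config N) : ℝ :=
  ∑ η : Config N, dualKL N q lam η ζ * dualKR N q ρ η ξ * weight N q η * (-v) ^ total η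

/-! ### The three degenerate duality functions -/

/-- `|N|`, the total capacity. -/
def cap : ℕ := ∑ k, N k

/-- The conserved factor `c^v(a,b;λ,ρ)`. -/
def cFactor (q lam ρ v : ℝ) (a b : ℕ) : ℝ :=
  qPoch (v * q ^ (lam - ρ + 2 * a - cap N + 1)) (q ^ 2) (cap N - a)
    / qPoch (v * q ^ (lam - ρ - 2 * b + cap N + 1)) (q ^ 2) b

/-- The conserved factor `C^v(a,b;λ,ρ)`. -/
def CFactor (q lam ρ v : ℝ) (a b : ℕ) : ℝ :=
  qPoch (-v * q ^ (lam + ρ - cap N + 1)) (q ^ 2) b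
    / qPoch (-v * q ^ (lam + ρ - cap N + 1)) (q ^ 2) a

/-- `P^v_R`, defined as a limit (whose existence is part of the theorem). -/
def dualHahn (q ρ v : ℝ) (η ξ : Config N) : ℝ :=
  limUnder atTop fun lam : ℝ =>
    q ^ (2 * lam * total η) * dualRacah N q lam ρ (v * q ^ (-lam)) η ξ

/-- `K^v_qtm`, defined as a limit (whose existence is part of the theorem). -/
def dualQtm (q v : ℝ) (η ξ : Config N) : ℝ :=
  limUnder atBot fun ρ : ℝ =>
    (v ^ (-2 : ℤ) * q ^ (-2 * ρ)) ^ total η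
      / (cFactor N q 0 0 v (total η) (total ξ) * CFactor N q 0 (2 * ρ) v (total η) (total ξ))
      * dualHahn N q ρ (v * q ^ ρ) η ξ

/-- `K^v_aff`, defined as a limit (whose existence is part of the theorem). -/
def dualAff (q v : ℝ) (η ξ : Config N) : ℝ :=
  limUnder atTop fun ρ : ℝ =>
    q ^ (2 * ρ * total η) / cFactor N q 0 (2 * ρ) (-v) (total η) (total ξ)
      * dualHahn N q ρ (-v * q ^ (-ρ)) η ξ

/-! ### The nested products -/

/-- The doubly nested product of `q`-Hahn polynomials. -/
def nestedHahn (q ρ v : ℝ) (η ξ : Config N) : ℝ :=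
  ∏ k, siteHahn (η k) (ξ k) (heightL 0 η (k : ℕ)) (heightR ρ ξ ((k : ℕ) + 1)) v (N k) q

/-- No denominator in `nestedHahn` vanishes: neither in a prefactor nor in one of the nonzero
terms of a `₃φ₂`. -/
def HahnRegular (q ρ v : ℝ) (η ξ : Config N) : Prop :=
  ∀ k : Fin (m + 1),
    qPoch (v * q ^ (-2 * occ ξ k - heightR ρ ξ ((k : ℕ) + 1) + heightL 0 η (k : ℕ) + N k + 1))
        (q ^ 2) ((ξ k : ℕ) + (η k : ℕ)) ≠ 0
    ∧ qPoch (-v * q ^ (heightR ρ ξ ((k : ℕ) + 1) + heightL 0 η (k : ℕ) - N k + 1)) (q ^ 2)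
        (min (ξ k : ℕ) (η k : ℕ)) ≠ 0

/-- The doubly nested product of quantum `q`-Krawtchouk polynomials. -/
def nestedQtm (q v : ℝ) (η ξ : Config N) : ℝ :=
  ∏ k, siteQtm (η k) (ξ k) (heightL 0 η (k : ℕ)) (heightR 0 ξ ((k : ℕ) + 1)) v (N k) q

/-- The doubly nested product of affine `q`-Krawtchouk polynomials. -/
def nestedAff (q v : ℝ) (η ξ : Config N) : ℝ :=
  ∏ k, siteAff (η k) (ξ k) (heightL 0 η (k : ℕ)) (heightR 0 ξ ((k : ℕ) + 1)) v (N k) q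

/-- No denominator in the nonzero terms of the `₃φ₂`s in `nestedAff` vanishes. -/
def AffRegular (q v : ℝ) (η ξ : Config N) : Prop :=
  ∀ k : Fin (m + 1),
    qPoch (v * q ^ (heightR 0 ξ ((k : ℕ) + 1) + heightL 0 η (k : ℕ) - N k + 1)) (q ^ 2)
        (min (ξ k : ℕ) (η k : ℕ)) ≠ 0

end Duality

end

end QASEP

open QASEP Filter Topology

namespace QASEP

noncomputable section

open Filter Topology

theorem qPoch_zero (a q : ℝ) : qPoch a q 0 = 1 := by simp [qPoch]

theorem qPoch_succ (a q : ℝ) (n : ℕ) : qPoch a q (n + 1) = qPoch a q n * (1 - a * q ^ n) :=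
  Finset.prod_range_succ _ _

theorem qPoch_succ' (a q : ℝ) (n : ℕ) :
    qPoch a q (n + 1) = (1 - a) * qPoch (a * q) q n := by
  rw [qPoch, Finset.prod_range_succ', mul_comm]
  simp [qPoch, pow_succ', mul_assoc]

theorem qPoch_add (a q : ℝ) (m n : ℕ) :
    qPoch a q (m + n) = qPoch a q m * qPoch (a * q ^ m) q n := by
  rw [qPoch, Finset.prod_range_add]
  simp [qPoch, pow_add, mul_assoc]

theorem qPoch_zero_left (q : ℝ) (n : ℕ) : qPoch 0 q n = 1 := by simp [qPoch]

theorem qPoch_ne_zero_iff {a q : ℝ} {n : ℕ} :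
    qPoch a q n ≠ 0 ↔ ∀ i < n, a * q ^ i ≠ 1 := by
  simp [qPoch, Finset.prod_ne_zero_iff, sub_ne_zero, eq_comm (a := (1 : ℝ))]

theorem qPoch_inv_pow_eq_zero {Q : ℝ} (hQ : Q ≠ 0) {n j : ℕ} (h : n < j) :
    qPoch (Q ^ n)⁻¹ Q j = 0 := by
  rw [qPoch, Finset.prod_eq_zero_iff]
  exact ⟨n, Finset.mem_range.2 h, by field_simp; ring⟩

theorem continuous_qPoch (q : ℝ) (n : ℕ) : Continuous fun a => qPoch a q n := by
  unfold qPoch; fun_prop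

section Unit

variable {Q : ℝ} (hQ0 : 0 < Q) (hQ1 : Q < 1)
include hQ0 hQ1

theorem one_sub_pow_pos {n : ℕ} (hn : n ≠ 0) : 0 < 1 - Q ^ n :=
  sub_pos.2 (pow_lt_one₀ hQ0.le hQ1 hn)

theorem qPoch_self_pos (n : ℕ) : 0 < qPoch Q Q n := by
  refine Finset.prod_pos fun i _ => ?_
  have := one_sub_pow_pos hQ0 hQ1 (Nat.succ_ne_zero i)
  rwa [pow_succ'] at this

theorem pow_sub_pow_ne_zero {i j : ℕ} (h : i ≠ j) : Q ^ i - Q ^ j ≠ 0 :=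
  sub_ne_zero.2 fun e => h (pow_right_injective₀ hQ0 hQ1.ne e)

theorem qPoch_inv_pow_ne_zero {N j : ℕ} (h : j ≤ N) : qPoch (Q ^ N)⁻¹ Q j ≠ 0 := by
  rw [qPoch_ne_zero_iff]
  intro i hi e
  have : Q ^ i = Q ^ N := by field_simp at e; linarith
  exact pow_sub_pow_ne_zero hQ0 hQ1 (by omega : i ≠ N) (by linarith)

/-! ### The Gaussian binomial coefficient, extended by zero -/

omit hQ0 hQ1 in
/-- The Gaussian binomial coefficient, with value `0` for `n < k`. -/
def gauss (Q : ℝ) (n k : ℕ) : ℝ := if k ≤ n then qBinom Q n k else 0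

theorem gauss_zero_right (n : ℕ) : gauss Q n 0 = 1 := by
  have := (qPoch_self_pos hQ0 hQ1 n).ne'
  simp [gauss, qBinom, qPoch_zero, this]

omit hQ0 hQ1 in
theorem gauss_of_lt {n k : ℕ} (h : n < k) : gauss Q n k = 0 := by simp [gauss, h]

theorem gauss_pos {n k : ℕ} (h : k ≤ n) : 0 < gauss Q n k := by
  rw [gauss, if_pos h, qBinom]
  have := qPoch_self_pos hQ0 hQ1
  exact div_pos (this _) (mul_pos (this _) (this _))

theorem gauss_succ_right {n k : ℕ} (h : k ≤ n) :
    gauss Q n (k + 1) * (1 - Q ^ (k + 1)) = gauss Q n k * (1 - Q ^ (n - k)) := by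
  rcases h.eq_or_lt with rfl | h
  · simp [gauss_of_lt]
  obtain ⟨d, rfl⟩ := Nat.exists_eq_add_of_lt h
  have p := fun n => (qPoch_self_pos hQ0 hQ1 n).ne'
  rw [gauss, if_pos (by omega), gauss, if_pos (by omega), qBinom, qBinom,
    show k + d + 1 - (k + 1) = d by omega, show k + d + 1 - k = d + 1 by omega,
    qPoch_succ _ _ k, qPoch_succ _ _ d]
  have h1 := (one_sub_pow_pos hQ0 hQ1 (Nat.succ_ne_zero k)).ne'
  have h2 := (one_sub_pow_pos hQ0 hQ1 (Nat.succ_ne_zero d)).ne'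
  have p1 := p k
  have p2 := p d
  rw [Nat.succ_eq_add_one, pow_succ'] at h1 h2
  rw [pow_succ', pow_succ']
  field_simp

theorem gauss_pascal {n k : ℕ} (h : k ≤ n) :
    gauss Q (n + 1) (k + 1) = gauss Q n (k + 1) + Q ^ (n - k) * gauss Q n k := by
  have h1 := (one_sub_pow_pos hQ0 hQ1 (Nat.succ_ne_zero k)).ne'
  have e := gauss_succ_right hQ0 hQ1 h
  have key : gauss Q (n + 1) (k + 1) * (1 - Q ^ (k + 1)) = gauss Q n k * (1 - Q ^ (n + 1)) := by
    have p := fun n => (qPoch_self_pos hQ0 hQ1 n).ne'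
    rw [gauss, if_pos (by omega), gauss, if_pos h, qBinom, qBinom,
      show n + 1 - (k + 1) = n - k by omega, qPoch_succ _ _ k, qPoch_succ _ _ n]
    have p1 := p k
    have p2 := p (n - k)
    rw [Nat.succ_eq_add_one, pow_succ'] at h1
    rw [pow_succ', pow_succ']
    field_simp
  have hp : Q ^ (n - k) * Q ^ (k + 1) = Q ^ (n + 1) := by rw [← pow_add]; congr 1; omega
  apply mul_right_cancel₀ h1
  rw [key, add_mul, e]
  simp only [Nat.succ_eq_add_one]
  linear_combination gauss Q n k * hp

theorem sum_gauss_succ (n : ℕ) (f : ℕ → ℝ) :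
    ∑ k ∈ Finset.range (n + 2), gauss Q (n + 1) k * f k
      = ∑ k ∈ Finset.range (n + 1), gauss Q n k * (f k + Q ^ (n - k) * f (k + 1)) := by
  rw [Finset.sum_range_succ', Finset.sum_congr rfl (fun k hk => by
    rw [gauss_pascal hQ0 hQ1 (Nat.lt_succ_iff.1 (Finset.mem_range.1 hk)), add_mul])]
  rw [Finset.sum_add_distrib]
  have : ∑ k ∈ Finset.range (n + 1), gauss Q n (k + 1) * f (k + 1)
      + gauss Q (n + 1) 0 * f 0 = ∑ k ∈ Finset.range (n + 1), gauss Q n k * f k := by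
    rw [gauss_zero_right hQ0 hQ1, ← gauss_zero_right hQ0 hQ1 n,
      ← Finset.sum_range_succ' (fun k => gauss Q n k * f k),
      Finset.sum_range_succ, gauss_of_lt (Nat.lt_succ_self n)]
    simp
  simp only [mul_add, Finset.sum_add_distrib]
  rw [← this]
  have : ∀ k, Q ^ (n - k) * gauss Q n k * f (k + 1) = gauss Q n k * (Q ^ (n - k) * f (k + 1)) :=
    fun k => by ring
  simp only [this]
  ring

/-- The `q`-binomial theorem. -/
theorem sum_gauss_mul_pow (N : ℕ) (s : ℝ) :
    ∑ n ∈ Finset.range (N + 1), gauss Q N n * (Q ^ (n.choose 2) * (-s) ^ n) = qPoch s Q N := by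
  induction N with
  | zero => simp [gauss_zero_right hQ0 hQ1, qPoch_zero]
  | succ N ih =>
    rw [sum_gauss_succ hQ0 hQ1, qPoch_succ, ← ih, Finset.sum_mul]
    refine Finset.sum_congr rfl fun n hn => ?_
    have hn : n ≤ N := Nat.lt_succ_iff.1 (Finset.mem_range.1 hn)
    have hp : Q ^ (N - n) * Q ^ n = Q ^ N := by rw [← pow_add]; congr 1; omega
    rw [Nat.choose_succ_succ' n 1, Nat.choose_one_right, pow_add Q n, ← hp]
    ring

/-- The `q`-Chu--Vandermonde sum in polynomial form. -/
theorem sum_gauss_mul_qPoch (x : ℕ) (B s : ℝ) :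
    ∑ j ∈ Finset.range (x + 1), gauss Q x j * (s ^ j * qPoch B Q j * qPoch s Q (x - j))
      = qPoch (B * s) Q x := by
  induction x with
  | zero => simp [gauss_zero_right hQ0 hQ1, qPoch_zero]
  | succ x ih =>
    rw [sum_gauss_succ hQ0 hQ1, qPoch_succ (B * s), ← ih, Finset.sum_mul]
    refine Finset.sum_congr rfl fun j hj => ?_
    have hj : j ≤ x := Nat.lt_succ_iff.1 (Finset.mem_range.1 hj)
    have hp : Q ^ (x - j) * Q ^ j = Q ^ x := by rw [← pow_add]; congr 1; omega
    rw [show x + 1 - j = (x - j) + 1 by omega, qPoch_succ s, qPoch_succ B,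
      show x + 1 - (j + 1) = x - j by omega, ← hp]
    ring

/-- The `j`-th `q`-derivative of the `q`-binomial theorem. -/
theorem sum_gauss_mul_qPoch_inv {N j : ℕ} (hj : j ≤ N) (s : ℝ) :
    ∑ n ∈ Finset.range (N + 1),
        gauss Q N n * (Q ^ (n.choose 2) * (-s) ^ n) * qPoch (Q ^ n)⁻¹ Q j
      = (∏ i ∈ Finset.range j, ((1 - Q ^ (N - i)) / Q)) * s ^ j * qPoch s Q (N - j) := by
  induction j generalizing s with
  | zero => simp [qPoch_zero, sum_gauss_mul_pow hQ0 hQ1]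
  | succ j ih =>
    have h1 := ih (by omega) s
    have h2 := ih (by omega) (s / Q)
    have e : ∀ n, gauss Q N n * (Q ^ (n.choose 2) * (-s) ^ n) * qPoch (Q ^ n)⁻¹ Q (j + 1)
        = gauss Q N n * (Q ^ (n.choose 2) * (-s) ^ n) * qPoch (Q ^ n)⁻¹ Q j
          - Q ^ j * (gauss Q N n * (Q ^ (n.choose 2) * (-(s / Q)) ^ n)
            * qPoch (Q ^ n)⁻¹ Q j) := by
      intro n
      rw [qPoch_succ, ← neg_div, div_pow]
      ring
    simp only [e, Finset.sum_sub_distrib, ← Finset.mul_sum]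
    rw [h1, h2, Finset.prod_range_succ]
    obtain ⟨d, rfl⟩ := Nat.exists_eq_add_of_lt (Nat.lt_of_succ_le hj)
    rw [show j + d + 1 - j = d + 1 by omega, show j + d + 1 - (j + 1) = d by omega,
      qPoch_succ s, qPoch_succ' (s / Q), div_mul_cancel₀ _ hQ0.ne', div_pow, pow_succ Q d]
    field_simp
    ring

end Unit

end

end QASEP

namespace QASEP

noncomputable section

open Filter Topology

/-- The coefficient of the `j`-th term of the `q`-Hahn series that does not involve the degree. -/
def hahnTerm (Q : ℝ) (N x : ℕ) (B : ℝ) (j : ℕ) : ℝ :=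
  qPoch (Q ^ x)⁻¹ Q j * qPoch B Q j * Q ^ j / (qPoch (Q ^ N)⁻¹ Q j * qPoch Q Q j)

/-- The `q`-Hahn sum with its denominators cleared. -/
def hahnSum (Q : ℝ) (N x : ℕ) (B : ℝ) (n : ℕ) (w : ℝ) : ℝ :=
  ∑ j ∈ Finset.range (x + 1),
    hahnTerm Q N x B j * qPoch (Q ^ n)⁻¹ Q j * qPoch (w * Q ^ j) Q (x - j)

/-- The dual `q`-Krawtchouk sum. -/
def krawtSum (Q : ℝ) (N x : ℕ) (B : ℝ) (n : ℕ) : ℝ :=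
  ∑ j ∈ Finset.range (x + 1), hahnTerm Q N x B j * qPoch (Q ^ n)⁻¹ Q j

theorem hahnTerm_zero (Q : ℝ) (N x : ℕ) (B : ℝ) : hahnTerm Q N x B 0 = 1 := by
  simp [hahnTerm, qPoch_zero]

section Unit

variable {Q : ℝ} (hQ0 : 0 < Q) (hQ1 : Q < 1)
include hQ0 hQ1

theorem hahnTerm_succ {N : ℕ} (x : ℕ) (B : ℝ) {j : ℕ} (hj : j < N) :
    hahnTerm Q N x B (j + 1) * ((1 - Q ^ j / Q ^ N) * (1 - Q ^ (j + 1)))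
      = hahnTerm Q N x B j * ((1 - Q ^ j / Q ^ x) * (1 - B * Q ^ j) * Q) := by
  have h1 := qPoch_inv_pow_ne_zero hQ0 hQ1 (j := j + 1) hj
  have h2 := (qPoch_self_pos hQ0 hQ1 (j + 1)).ne'
  rw [hahnTerm, hahnTerm]
  rw [qPoch_succ, inv_mul_eq_div] at h1
  rw [qPoch_succ, ← pow_succ'] at h2
  simp only [qPoch_succ, inv_mul_eq_div, ← pow_succ']
  rw [pow_succ' Q j] at h2 ⊢
  generalize qPoch (Q ^ N)⁻¹ Q j = u at *
  generalize qPoch Q Q j = v at *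
  generalize Q ^ j / Q ^ N = r at *
  generalize Q ^ j / Q ^ x = r' at *
  generalize Q ^ j = t at *
  have h3 := left_ne_zero_of_mul h1
  have h4 := left_ne_zero_of_mul h2
  have h5 := right_ne_zero_of_mul h1
  have h6 := right_ne_zero_of_mul h2
  generalize 1 - Q * t = k at *
  field_simp

theorem hahnTerm_mul_prod {N x : ℕ} (hx : x ≤ N) (B : ℝ) {j : ℕ} (hj : j ≤ x) :
    hahnTerm Q N x B j * ∏ i ∈ Finset.range j, ((1 - Q ^ (N - i)) / Q)
      = gauss Q x j * (Q ^ (N - x)) ^ j * qPoch B Q j := by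
  induction j with
  | zero => simp [hahnTerm_zero, gauss_zero_right hQ0 hQ1, qPoch_zero]
  | succ j ih =>
    have ih := ih (by omega)
    have hN : 1 - Q ^ j / Q ^ N ≠ 0 := by
      have := pow_sub_pow_ne_zero hQ0 hQ1 (by omega : N ≠ j)
      rw [one_sub_div (pow_ne_zero _ hQ0.ne')]
      exact div_ne_zero this (pow_ne_zero _ hQ0.ne')
    have h1 := (one_sub_pow_pos hQ0 hQ1 (Nat.succ_ne_zero j)).ne'
    have e1 := hahnTerm_succ hQ0 hQ1 x B (by omega : j < N)
    have e2 := gauss_succ_right hQ0 hQ1 (by omega : j ≤ x)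
    apply mul_right_cancel₀ (mul_ne_zero hN h1)
    have p1 : Q ^ (N - j) * Q ^ j = Q ^ N := by rw [← pow_add]; congr 1; omega
    have p2 : Q ^ (N - x) * Q ^ x = Q ^ N := by rw [← pow_add]; congr 1; omega
    have p3 : Q ^ (x - j) * Q ^ j = Q ^ x := by rw [← pow_add]; congr 1; omega
    have c : (1 - Q ^ j / Q ^ x) * (1 - Q ^ (N - j))
        = Q ^ (N - x) * (1 - Q ^ (x - j)) * (1 - Q ^ j / Q ^ N) := by
      rw [← p2, ← p3, show Q ^ (N - j) = Q ^ (N - x) * Q ^ (x - j) by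
        rw [← pow_add]; congr 1; omega]
      field_simp
      ring
    rw [Finset.prod_range_succ, qPoch_succ B]
    simp only [Nat.succ_eq_add_one]
    calc _ = (hahnTerm Q N x B (j + 1) * ((1 - Q ^ j / Q ^ N) * (1 - Q ^ (j + 1))))
          * (∏ i ∈ Finset.range j, ((1 - Q ^ (N - i)) / Q)) * ((1 - Q ^ (N - j)) / Q) := by ring
      _ = (hahnTerm Q N x B j * ∏ i ∈ Finset.range j, ((1 - Q ^ (N - i)) / Q))
          * ((1 - Q ^ j / Q ^ x) * (1 - Q ^ (N - j))) * (1 - B * Q ^ j) := by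
        rw [e1]; field_simp
      _ = (gauss Q x (j + 1) * (1 - Q ^ (j + 1))) * (Q ^ (N - x)) ^ (j + 1)
          * (1 - Q ^ j / Q ^ N) * (qPoch B Q j * (1 - B * Q ^ j)) := by
        rw [ih, c, e2]; ring
      _ = _ := by ring

/-- The generating function of the dual `q`-Krawtchouk sums. -/
theorem sum_krawtSum {N x : ℕ} (hx : x ≤ N) (B s : ℝ) :
    ∑ n ∈ Finset.range (N + 1),
        gauss Q N n * (Q ^ (n.choose 2) * (-s) ^ n) * krawtSum Q N x B n
      = qPoch (B * (s * Q ^ (N - x))) Q x * qPoch s Q (N - x) := by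
  simp only [krawtSum, Finset.mul_sum]
  rw [Finset.sum_comm, ← sum_gauss_mul_qPoch hQ0 hQ1, Finset.sum_mul]
  refine Finset.sum_congr rfl fun j hj => ?_
  have hj : j ≤ x := Nat.lt_succ_iff.1 (Finset.mem_range.1 hj)
  have e := sum_gauss_mul_qPoch_inv hQ0 hQ1 (hj.trans hx) s
  calc _ = hahnTerm Q N x B j * ∑ n ∈ Finset.range (N + 1),
        gauss Q N n * (Q ^ (n.choose 2) * (-s) ^ n) * qPoch (Q ^ n)⁻¹ Q j := by
        rw [Finset.mul_sum]; exact Finset.sum_congr rfl fun n _ => by ring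
    _ = (hahnTerm Q N x B j * ∏ i ∈ Finset.range j, ((1 - Q ^ (N - i)) / Q))
        * s ^ j * qPoch s Q (N - j) := by rw [e]; ring
    _ = _ := by
      rw [hahnTerm_mul_prod hQ0 hQ1 hx B hj, show N - j = (N - x) + (x - j) by omega,
        qPoch_add]
      ring

/-- A contiguous relation between `q`-Hahn sums. -/
theorem hahnSum_contiguous {N x : ℕ} (hx : x ≤ N) (B : ℝ) (n : ℕ) (w : ℝ) :
    w * (Q ^ x / Q ^ N) * (Q ^ n - Q ^ N) * hahnSum Q N x B (n + 1) w
      = (B - w) * hahnSum Q N x B n (Q * w)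
        - (B - w * (Q ^ x / Q ^ N) * Q ^ n) * hahnSum Q N x B n w := by
  set c := Q ^ n * Q ^ x / Q ^ N with hc
  have hq : Q ≠ 0 := hQ0.ne'
  let e : ℕ → ℝ := fun j => qPoch (w * Q ^ j) Q (x - j)
  let a : ℕ → ℝ := fun j => w * hahnTerm Q N x B j * e j
    * ((c - Q ^ x) * qPoch (Q ^ (n + 1))⁻¹ Q j + qPoch (Q ^ n)⁻¹ Q j * (Q ^ x / Q ^ j - c))
  let E : ℕ → ℝ := fun j => w * hahnTerm Q N x B j * qPoch (Q ^ n)⁻¹ Q j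
    * ((1 - Q ^ x / Q ^ j) * (1 - B * Q ^ j)) * e (j + 1)
  have hterm : ∀ j ∈ Finset.range (x + 1),
      w * (Q ^ x / Q ^ N) * (Q ^ n - Q ^ N)
          * (hahnTerm Q N x B j * qPoch (Q ^ (n + 1))⁻¹ Q j * qPoch (w * Q ^ j) Q (x - j))
        - ((B - w) * (hahnTerm Q N x B j * qPoch (Q ^ n)⁻¹ Q j
              * qPoch (Q * w * Q ^ j) Q (x - j))
          - (B - w * (Q ^ x / Q ^ N) * Q ^ n)
            * (hahnTerm Q N x B j * qPoch (Q ^ n)⁻¹ Q j * qPoch (w * Q ^ j) Q (x - j)))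
        = a j + E j := by
    intro j hj
    have hj : j ≤ x := Nat.lt_succ_iff.1 (Finset.mem_range.1 hj)
    have key : (B - w) * qPoch (Q * w * Q ^ j) Q (x - j) - (B - w * c) * e j
        = - w * ((1 - Q ^ x / Q ^ j) * (1 - B * Q ^ j) * e (j + 1)
          + (Q ^ x / Q ^ j - c) * e j) := by
      rcases hj.eq_or_lt with rfl | hj
      · simp only [e, Nat.sub_self, qPoch_zero]
        rw [div_self (pow_ne_zero _ hq)]
        ring
      · obtain ⟨d, rfl⟩ := Nat.exists_eq_add_of_lt hj
        simp only [e, show j + d + 1 - j = d + 1 by omega,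
          show j + d + 1 - (j + 1) = d by omega]
        rw [qPoch_succ' (w * Q ^ j), qPoch_succ,
          show Q * w * Q ^ j = w * Q ^ (j + 1) by ring,
          show w * Q ^ j * Q = w * Q ^ (j + 1) by ring,
          show Q ^ (j + d + 1) / Q ^ j = Q ^ (d + 1) by
            rw [add_assoc, pow_add]; field_simp]
        ring
    have hcn : w * (Q ^ x / Q ^ N) * (Q ^ n - Q ^ N) = w * (c - Q ^ x) := by
      rw [hc]; field_simp
    have hcn' : w * (Q ^ x / Q ^ N) * Q ^ n = w * c := by rw [hc]; ring
    rw [hcn, hcn']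
    simp only [a, E]
    simp only [e] at key ⊢
    linear_combination (-hahnTerm Q N x B j * qPoch (Q ^ n)⁻¹ Q j) * key
  have hstep : ∀ j ∈ Finset.range x, a (j + 1) = - E j := by
    intro j hj
    have hj : j < x := Finset.mem_range.1 hj
    have e1 := hahnTerm_succ hQ0 hQ1 x B (hj.trans_le hx)
    simp only [a, E]
    have hE : hahnTerm Q N x B j * ((1 - Q ^ x / Q ^ j) * (1 - B * Q ^ j))
        = - (Q ^ x / Q ^ (j + 1)) * (hahnTerm Q N x B (j + 1)
          * ((1 - Q ^ j / Q ^ N) * (1 - Q ^ (j + 1)))) := by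
      rw [e1]; field_simp; ring
    have hn : qPoch (Q ^ (n + 1))⁻¹ Q (j + 1)
        = (1 - (Q ^ (n + 1))⁻¹) * qPoch (Q ^ n)⁻¹ Q j := by
      rw [qPoch_succ', show (Q ^ (n + 1))⁻¹ * Q = (Q ^ n)⁻¹ by rw [pow_succ]; field_simp]
    have hn' : qPoch (Q ^ n)⁻¹ Q (j + 1) = qPoch (Q ^ n)⁻¹ Q j * (1 - Q ^ j / Q ^ n) := by
      rw [qPoch_succ]; ring
    have lin : (c - Q ^ x) * (1 - (Q ^ (n + 1))⁻¹)
        + (1 - Q ^ j / Q ^ n) * (Q ^ x / Q ^ (j + 1) - c)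
        - Q ^ x / Q ^ (j + 1) * ((1 - Q ^ j / Q ^ N) * (1 - Q ^ (j + 1))) = 0 := by
      rw [hc, pow_succ, pow_succ]; field_simp; ring
    rw [hn, hn']
    linear_combination (w * e (j + 1) * qPoch (Q ^ n)⁻¹ Q j) * hE
      + (w * hahnTerm Q N x B (j + 1) * e (j + 1) * qPoch (Q ^ n)⁻¹ Q j) * lin
  have h0 : a 0 = 0 := by simp [a, qPoch_zero]
  have hE : E x = 0 := by simp [E, div_self (pow_ne_zero x hq)]
  rw [← sub_eq_zero]
  simp only [hahnSum, Finset.mul_sum, ← Finset.sum_sub_distrib]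
  rw [Finset.sum_congr rfl hterm, Finset.sum_add_distrib, Finset.sum_range_succ', h0,
    Finset.sum_range_succ E, hE, Finset.sum_congr rfl hstep]
  simp

/-- The `z`-th `q`-derivative of the generating function of the dual `q`-Krawtchouk sums is a
`q`-Hahn sum. -/
theorem sum_krawtSum_mul_prod {N x : ℕ} (hx : x ≤ N) {B : ℝ} (hB : B ≠ 0) {z : ℕ} (hz : z ≤ N)
    (s : ℝ) :
    (∑ n ∈ Finset.range (N + 1), gauss Q N n * (Q ^ (n.choose 2) * (-s) ^ n)
        * krawtSum Q N x B n * ∏ i ∈ Finset.range z, (Q ^ n - Q ^ i))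
        * qPoch (s * Q ^ (N - x)) Q (x + z)
      = (∏ i ∈ Finset.range z, (Q ^ (2 * i) * (1 - Q ^ (N - i)))) * s ^ z
        * qPoch (s * Q ^ z) Q N * hahnSum Q N x B z (B * (s * Q ^ (N - x))) := by
  induction z generalizing s with
  | zero =>
    have h0 : hahnSum Q N x B 0 (B * (s * Q ^ (N - x))) = qPoch (B * (s * Q ^ (N - x))) Q x := by
      rw [hahnSum, Finset.sum_range_succ', Finset.sum_eq_zero]
      · simp [hahnTerm_zero, qPoch_zero]
      · intro j _
        rw [qPoch_inv_pow_eq_zero hQ0.ne' (Nat.succ_pos j)]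
        simp
    simp only [Finset.range_zero, Finset.prod_empty, mul_one, pow_zero, one_mul, add_zero]
    rw [sum_krawtSum hQ0 hQ1 hx, h0]
    conv_rhs => rw [show N = (N - x) + x by omega, qPoch_add]
    rw [Nat.add_sub_cancel]
    ring
  | succ z ih =>
    have h1 := ih (by omega) (Q * s)
    have h2 := ih (by omega) s
    have e : ∀ n, gauss Q N n * (Q ^ (n.choose 2) * (-s) ^ n) * krawtSum Q N x B n
          * ∏ i ∈ Finset.range (z + 1), (Q ^ n - Q ^ i)
        = gauss Q N n * (Q ^ (n.choose 2) * (-(Q * s)) ^ n) * krawtSum Q N x B n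
            * ∏ i ∈ Finset.range z, (Q ^ n - Q ^ i)
          - Q ^ z * (gauss Q N n * (Q ^ (n.choose 2) * (-s) ^ n) * krawtSum Q N x B n
            * ∏ i ∈ Finset.range z, (Q ^ n - Q ^ i)) := by
      intro n
      rw [Finset.prod_range_succ, ← mul_neg, mul_pow Q]
      ring
    simp only [e, Finset.sum_sub_distrib, ← Finset.mul_sum]
    set D1 := ∑ n ∈ Finset.range (N + 1), gauss Q N n * (Q ^ (n.choose 2) * (-(Q * s)) ^ n)
      * krawtSum Q N x B n * ∏ i ∈ Finset.range z, (Q ^ n - Q ^ i)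
    set D2 := ∑ n ∈ Finset.range (N + 1), gauss Q N n * (Q ^ (n.choose 2) * (-s) ^ n)
      * krawtSum Q N x B n * ∏ i ∈ Finset.range z, (Q ^ n - Q ^ i)
    set w := B * (s * Q ^ (N - x)) with hw
    have hw1 : B * (Q * s * Q ^ (N - x)) = Q * w := by rw [hw]; ring
    rw [hw1] at h1
    have hp : Q ^ (N - x) * Q ^ x = Q ^ N := by rw [← pow_add]; congr 1; omega
    have hp' : Q ^ (N - z) * Q ^ z = Q ^ N := by rw [← pow_add]; congr 1; omega
    have ct := hahnSum_contiguous hQ0 hQ1 hx B z w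
    have hws : w * (Q ^ x / Q ^ N) = B * s := by rw [hw, ← hp]; field_simp
    rw [hws] at ct
    have q1 : qPoch (s * Q ^ (N - x)) Q (x + (z + 1))
        = (1 - s * Q ^ (N - x)) * qPoch (Q * s * Q ^ (N - x)) Q (x + z) := by
      rw [← add_assoc, qPoch_succ']; congr 2; ring
    have q2 : qPoch (s * Q ^ (N - x)) Q (x + (z + 1))
        = qPoch (s * Q ^ (N - x)) Q (x + z) * (1 - s * Q ^ (N + z)) := by
      have : Q ^ (N - x) * Q ^ (x + z) = Q ^ (N + z) := by rw [← pow_add]; congr 1; omega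
      rw [← add_assoc, qPoch_succ, mul_assoc s, this]
    have q3 : (1 - s * Q ^ (N + z)) * qPoch (s * Q ^ z) Q N
        = (1 - s * Q ^ z) * qPoch (s * Q ^ (z + 1)) Q N := by
      have := qPoch_succ (s * Q ^ z) Q N
      rw [qPoch_succ'] at this
      rw [show s * Q ^ (z + 1) = s * Q ^ z * Q by ring, this]
      ring
    rw [show Q * s * Q ^ z = s * Q ^ (z + 1) by ring] at h1
    set P := ∏ i ∈ Finset.range z, (Q ^ (2 * i) * (1 - Q ^ (N - i)))
    rw [Finset.prod_range_succ, sub_mul]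
    have hP : Q ^ (2 * z) * (1 - Q ^ (N - z)) = Q ^ z * (Q ^ z - Q ^ N) := by
      rw [← hp']; ring
    rw [hP, mul_assoc (Q ^ z) D2, q2, ← mul_assoc D2, h2, ← q2, q1,
      mul_left_comm D1, h1]
    apply mul_left_cancel₀ hB
    rw [mul_pow Q s z]
    linear_combination (-P * Q ^ z * s ^ z * qPoch (s * Q ^ (z + 1)) Q N) * ct
      - (B * P * Q ^ z * s ^ z * hahnSum Q N x B z w) * q3

end Unit

end

end QASEP

namespace QASEP

noncomputable section

open Filter Topology

section Jump

variable {m : ℕ} {N : Fin (m + 1) → ℕ}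

theorem val_le (η : Config N) (x : Fin (m + 1)) : (η x : ℕ) ≤ N x := Nat.lt_succ_iff.1 (η x).2

/-- A particle can move from site `i` to site `j`. -/
def CanJump (η : Config N) (i j : Fin (m + 1)) : Prop := 0 < (η i : ℕ) ∧ (η j : ℕ) < N j

theorem jump_source {η : Config N} {i j : Fin (m + 1)} :
    (jump η i j i : ℕ) = η i - 1 := by
  have := val_le η i
  simp only [jump, if_true]
  omega

theorem jump_target {η : Config N} {i j : Fin (m + 1)} (hij : i ≠ j) (h : CanJump η i j) :
    (jump η i j j : ℕ) = η j + 1 := by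
  have := h.2
  simp [jump, hij.symm]; omega

theorem jump_of_ne {η : Config N} {i j x : Fin (m + 1)} (hi : x ≠ i) (hj : x ≠ j) :
    jump η i j x = η x := by
  have := val_le η x
  ext
  simp [jump, hi, hj]; omega

theorem canJump_jump {η : Config N} {i j : Fin (m + 1)} (hij : i ≠ j) (h : CanJump η i j) :
    CanJump (jump η i j) j i := by
  have := val_le η i
  have := h.1
  refine ⟨?_, ?_⟩
  · rw [jump_target hij h]; omega
  · rw [jump_source]; omega

theorem jump_jump {η : Config N} {i j : Fin (m + 1)} (hij : i ≠ j) (h : CanJump η i j) :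
    jump (jump η i j) j i = η := by
  have := h.1
  funext x
  by_cases hi : x = i
  · subst hi
    ext
    rw [jump_target hij.symm (canJump_jump hij h), jump_source]; omega
  by_cases hj : x = j
  · subst hj
    ext
    rw [jump_source, jump_target hij h]; omega
  rw [jump_of_ne hj hi, jump_of_ne hi hj]

theorem occ_jump {η : Config N} {i j : Fin (m + 1)} (hij : i ≠ j) (h : CanJump η i j)
    (x : Fin (m + 1)) :
    occ (jump η i j) x = occ η x + ((if x = j then 1 else 0) - if x = i then 1 else 0) := by
  by_cases hi : x = i
  · subst hi
    rw [occ, jump_source, occ, Nat.cast_sub h.1]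
    simp [hij]; ring
  by_cases hj : x = j
  · subst hj
    rw [occ, jump_target hij h, occ]
    simp [hi]
  rw [occ, jump_of_ne hi hj, occ]
  simp [hi, hj]

theorem heightL_jump (lam : ℝ) {η : Config N} {i j : Fin (m + 1)} (hij : i ≠ j)
    (h : CanJump η i j) (l : ℕ) :
    heightL lam (jump η i j) l
      = heightL lam η l + 2 * ((if (j : ℕ) < l then 1 else 0) - if (i : ℕ) < l then 1 else 0) := by
  have : ∀ x : Fin (m + 1), (if (x : ℕ) < l then 2 * occ (jump η i j) x - N x else 0)
      = (if (x : ℕ) < l then 2 * occ η x - N x else 0)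
        + 2 * ((if x = j then (if (x : ℕ) < l then 1 else 0) else 0)
          - if x = i then (if (x : ℕ) < l then 1 else 0) else 0) := by
    intro x
    rw [occ_jump hij h]
    split_ifs <;> ring
  simp only [heightL, this, Finset.sum_add_distrib, ← Finset.mul_sum, Finset.sum_sub_distrib]
  simp [add_assoc]

theorem heightR_jump (ρ : ℝ) {η : Config N} {i j : Fin (m + 1)} (hij : i ≠ j)
    (h : CanJump η i j) (l : ℕ) :
    heightR ρ (jump η i j) l
      = heightR ρ η l + 2 * ((if l ≤ (j : ℕ) then 1 else 0) - if l ≤ (i : ℕ) then 1 else 0) := by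
  have : ∀ x : Fin (m + 1), (if l ≤ (x : ℕ) then 2 * occ (jump η i j) x - N x else 0)
      = (if l ≤ (x : ℕ) then 2 * occ η x - N x else 0)
        + 2 * ((if x = j then (if l ≤ (x : ℕ) then 1 else 0) else 0)
          - if x = i then (if l ≤ (x : ℕ) then 1 else 0) else 0) := by
    intro x
    rw [occ_jump hij h]
    split_ifs <;> ring
  simp only [heightR, this, Finset.sum_add_distrib, ← Finset.mul_sum, Finset.sum_sub_distrib]
  simp [add_assoc]

theorem total_jump {η : Config N} {i j : Fin (m + 1)} (hij : i ≠ j) (h : CanJump η i j) :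
    total (jump η i j) = total η := by
  have : ((total (jump η i j) : ℕ) : ℝ) = total η := by
    have : ∀ ζ : Config N, ((total ζ : ℕ) : ℝ) = ∑ x, occ ζ x := by
      intro ζ; simp [total, occ]
    rw [this, this]
    simp only [occ_jump hij h, Finset.sum_add_distrib, Finset.sum_sub_distrib]
    simp
  exact_mod_cast this

theorem heightL_succ (lam : ℝ) (η : Config N) (i : Fin (m + 1)) :
    heightL lam η ((i : ℕ) + 1) = heightL lam η i + (2 * occ η i - N i) := by
  have : ∀ x : Fin (m + 1), (if (x : ℕ) < (i : ℕ) + 1 then 2 * occ η x - N x else 0)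
      = (if (x : ℕ) < i then 2 * occ η x - N x else 0)
        + if x = i then 2 * occ η x - N x else 0 := by
    intro x
    rcases lt_trichotomy x i with h | h | h
    · simp [h.ne, Fin.lt_def.1 h, (Fin.lt_def.1 h).trans (Nat.lt_succ_self _)]
    · simp [h]
    · have : (i : ℕ) < x := h
      simp [h.ne', show ¬ (x : ℕ) < i + 1 by omega, show ¬ (x : ℕ) < i by omega]
  simp only [heightL, this, Finset.sum_add_distrib]
  simp [add_assoc]

theorem heightR_succ (ρ : ℝ) (η : Config N) (i : Fin (m + 1)) :
    heightR ρ η i = heightR ρ η ((i : ℕ) + 1) + (2 * occ η i - N i) := by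
  have : ∀ x : Fin (m + 1), (if (i : ℕ) ≤ x then 2 * occ η x - N x else 0)
      = (if (i : ℕ) + 1 ≤ x then 2 * occ η x - N x else 0)
        + if x = i then 2 * occ η x - N x else 0 := by
    intro x
    rcases lt_trichotomy x i with h | h | h
    · have : (x : ℕ) < i := h
      simp [h.ne, show ¬ (i : ℕ) + 1 ≤ x by omega, show ¬ (i : ℕ) ≤ x by omega]
    · simp [h]
    · have : (i : ℕ) < x := h
      simp [h.ne', show (i : ℕ) + 1 ≤ x by omega, show (i : ℕ) ≤ x by omega]
  simp only [heightR, this, Finset.sum_add_distrib]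
  simp [add_assoc]

theorem heightL_eq_add (lam : ℝ) (η : Config N) (l : ℕ) :
    heightL lam η l = lam + heightL 0 η l := by simp [heightL]

theorem heightR_eq_add (ρ : ℝ) (η : Config N) (l : ℕ) :
    heightR ρ η l = ρ + heightR 0 η l := by simp [heightR]

end Jump

section Generator

variable {m : ℕ} {N : Fin (m + 1) → ℕ}

/-- The generator of a nearest-neighbour jump process with rates `c` to the right and `d` to the
left. -/
def bondGen (c d : Fin m → Config N → ℝ) (f : Config N → ℝ) (η : Config N) : ℝ :=
  ∑ k : Fin m, (c k η * (f (jump η k.castSucc k.succ) - f η)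
    + d k η * (f (jump η k.succ k.castSucc) - f η))

/-- Impossible jumps have rate zero. -/
def Admissible (c d : Fin m → Config N → ℝ) : Prop :=
  ∀ k η, (¬ CanJump η k.castSucc k.succ → c k η = 0) ∧ (¬ CanJump η k.succ k.castSucc → d k η = 0)

theorem bondGen_sum {ι : Type*} (s : Finset ι) (c d : Fin m → Config N → ℝ)
    (f : ι → Config N → ℝ) (η : Config N) :
    bondGen c d (fun η' => ∑ i ∈ s, f i η') η = ∑ i ∈ s, bondGen c d (f i) η := by
  simp only [bondGen]
  rw [Finset.sum_comm]
  refine Finset.sum_congr rfl fun k _ => ?_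
  simp only [← Finset.sum_sub_distrib, Finset.mul_sum, ← Finset.sum_add_distrib]

theorem bondGen_mul_const (c d : Fin m → Config N → ℝ)
    (f : Config N → ℝ) (a : ℝ) (η : Config N) :
    bondGen c d (fun η' => f η' * a) η = bondGen c d f η * a := by
  simp only [bondGen, Finset.sum_mul]
  exact Finset.sum_congr rfl fun k _ => by ring

theorem castSucc_ne_succ (k : Fin m) : k.castSucc ≠ k.succ := (Fin.castSucc_lt_succ (i := k)).ne

theorem bondGen_conserved {c d : Fin m → Config N → ℝ} (h : Admissible c d)
    (φ : ℕ → ℝ) (f : Config N → ℝ) (η : Config N) :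
    bondGen c d (fun η' => φ (total η') * f η') η = φ (total η) * bondGen c d f η := by
  simp only [bondGen, Finset.mul_sum]
  refine Finset.sum_congr rfl fun k _ => ?_
  have h1 : c k η * (φ (total (jump η k.castSucc k.succ)) * f (jump η k.castSucc k.succ))
      = c k η * (φ (total η) * f (jump η k.castSucc k.succ)) := by
    by_cases hc : CanJump η k.castSucc k.succ
    · rw [total_jump (castSucc_ne_succ k) hc]
    · rw [(h k η).1 hc]; simp
  have h2 : d k η * (φ (total (jump η k.succ k.castSucc)) * f (jump η k.succ k.castSucc))
      = d k η * (φ (total η) * f (jump η k.succ k.castSucc)) := by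
    by_cases hc : CanJump η k.succ k.castSucc
    · rw [total_jump (castSucc_ne_succ k).symm hc]
    · rw [(h k η).2 hc]; simp
  rw [mul_sub, mul_sub, h1, h2]
  ring

theorem IsDuality.conserved {c d c' d' : Fin m → Config N → ℝ} {D : Config N → Config N → ℝ}
    (h : Admissible c d) (h' : Admissible c' d') (hD : IsDuality (bondGen c d) (bondGen c' d') D)
    (φ : ℕ → ℕ → ℝ) :
    IsDuality (bondGen c d) (bondGen c' d') fun η ξ => φ (total η) (total ξ) * D η ξ := by
  intro η ξ
  rw [bondGen_conserved h (fun a => φ a (total ξ)), bondGen_conserved h' (φ (total η)), hD η ξ]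

/-- Detailed balance. -/
def Reversible (c d : Fin m → Config N → ℝ) (w : Config N → ℝ) : Prop :=
  ∀ k η, CanJump η k.castSucc k.succ →
    w η * c k η = w (jump η k.castSucc k.succ) * d k (jump η k.castSucc k.succ)

theorem sum_reversible {c d : Fin m → Config N → ℝ} (h : Admissible c d) {w : Config N → ℝ}
    (hw : Reversible c d w) (F : Config N → Config N → ℝ) (k : Fin m) :
    ∑ η, w η * c k η * F η (jump η k.castSucc k.succ)
      = ∑ η, w η * d k η * F (jump η k.succ k.castSucc) η := by
  classical
  have hk := castSucc_ne_succ k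
  have e1 : ∑ η ∈ Finset.univ.filter (fun η => CanJump η k.castSucc k.succ),
        w η * c k η * F η (jump η k.castSucc k.succ)
      = ∑ η, w η * c k η * F η (jump η k.castSucc k.succ) :=
    Finset.sum_filter_of_ne fun η _ hη => by_contra fun hc => hη (by rw [(h k η).1 hc]; simp)
  have e2 : ∑ η ∈ Finset.univ.filter (fun η => CanJump η k.succ k.castSucc),
        w η * d k η * F (jump η k.succ k.castSucc) η
      = ∑ η, w η * d k η * F (jump η k.succ k.castSucc) η :=
    Finset.sum_filter_of_ne fun η _ hη => by_contra fun hc => hη (by rw [(h k η).2 hc]; simp)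
  rw [← e1, ← e2]
  refine Finset.sum_bij' (fun η _ => jump η k.castSucc k.succ)
    (fun η _ => jump η k.succ k.castSucc) ?_ ?_ ?_ ?_ ?_
  · intro η hη
    exact Finset.mem_filter.2 ⟨Finset.mem_univ _, canJump_jump hk (Finset.mem_filter.1 hη).2⟩
  · intro η hη
    exact Finset.mem_filter.2 ⟨Finset.mem_univ _, canJump_jump hk.symm (Finset.mem_filter.1 hη).2⟩
  · intro η hη
    exact jump_jump hk (Finset.mem_filter.1 hη).2
  · intro η hη
    exact jump_jump hk.symm (Finset.mem_filter.1 hη).2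
  · intro η hη
    have := (Finset.mem_filter.1 hη).2
    rw [hw k η this, jump_jump hk this]

theorem bondGen_selfAdjoint {c d : Fin m → Config N → ℝ} (h : Admissible c d) {w : Config N → ℝ}
    (hw : Reversible c d w) (f g : Config N → ℝ) :
    ∑ η, w η * g η * bondGen c d f η = ∑ η, w η * f η * bondGen c d g η := by
  simp only [bondGen, Finset.mul_sum]
  rw [Finset.sum_comm]
  conv_rhs => rw [Finset.sum_comm]
  refine Finset.sum_congr rfl fun k _ => ?_
  have e1 := sum_reversible h hw (fun a b => g a * f b) k
  have e2 := sum_reversible h hw (fun a b => f a * g b) k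
  have : ∀ f g : Config N → ℝ, ∑ η, w η * g η
      * (c k η * (f (jump η k.castSucc k.succ) - f η)
        + d k η * (f (jump η k.succ k.castSucc) - f η))
      = (∑ η, w η * c k η * (g η * f (jump η k.castSucc k.succ)))
        + (∑ η, w η * d k η * (f (jump η k.succ k.castSucc) * g η))
        - ∑ η, w η * (c k η + d k η) * (f η * g η) := by
    intro f g
    rw [← Finset.sum_add_distrib, ← Finset.sum_sub_distrib]
    exact Finset.sum_congr rfl fun η _ => by ring
  rw [this, this, e1, e2]
  have : ∀ η, w η * (c k η + d k η) * (f η * g η) = w η * (c k η + d k η) * (g η * f η) :=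
    fun η => by ring
  simp only [this, mul_comm (g _)]
  ring

/-- Duality functions can be composed along a reversible process. -/
theorem IsDuality.comp {c d c₁ d₁ c₂ d₂ : Fin m → Config N → ℝ} (h : Admissible c d)
    {w : Config N → ℝ} (hw : Reversible c d w) {D₁ D₂ : Config N → Config N → ℝ}
    (h₁ : IsDuality (bondGen c₁ d₁) (bondGen c d) D₁)
    (h₂ : IsDuality (bondGen c d) (bondGen c₂ d₂) D₂) (φ : ℕ → ℝ) :
    IsDuality (bondGen c₁ d₁) (bondGen c₂ d₂)
      fun ζ ξ => ∑ η, D₁ ζ η * (w η * (φ (total η) * D₂ η ξ)) := by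
  intro ζ ξ
  have e : ∀ ξ' η, D₁ ζ η * (w η * (φ (total η) * D₂ η ξ'))
      = D₂ η ξ' * (D₁ ζ η * w η * φ (total η)) := fun _ _ => by ring
  simp only [bondGen_sum, bondGen_mul_const, e]
  calc _ = ∑ η, w η * (φ (total η) * D₂ η ξ) * bondGen c d (D₁ ζ) η :=
        Finset.sum_congr rfl fun η _ => by rw [← h₁ ζ η]; ring
    _ = ∑ η, w η * D₁ ζ η * bondGen c d (fun η' => φ (total η') * D₂ η' ξ) η :=
        bondGen_selfAdjoint h hw _ _
    _ = _ := Finset.sum_congr rfl fun η _ => by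
        rw [bondGen_conserved h, h₂ η ξ]; ring

/-- A product of one-site functions that are coupled through the heights. -/
def heightProd (F : Fin (m + 1) → ℕ → ℕ → ℝ → ℝ → ℝ) (ρ : ℝ) (η ξ : Config N) : ℝ :=
  ∏ x, F x (η x) (ξ x) (heightL 0 η x) (heightR ρ ξ ((x : ℕ) + 1))

/-- The part of a `heightProd` that involves the bond `k`. -/
def twoSite (N : Fin (m + 1) → ℕ) (F : Fin (m + 1) → ℕ → ℕ → ℝ → ℝ → ℝ) (k : Fin m) (l r : ℝ)
    (n₁ n₂ x₁ x₂ : ℕ) : ℝ :=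
  F k.castSucc n₁ x₁ l (r + (2 * x₂ - N k.succ))
    * F k.succ n₂ x₂ (l + (2 * n₁ - N k.castSucc)) r

/-- The part of a `heightProd` that does not involve the bond `k`. -/
def offBond (F : Fin (m + 1) → ℕ → ℕ → ℝ → ℝ → ℝ) (ρ : ℝ) (k : Fin m) (η ξ : Config N) : ℝ :=
  ∏ x ∈ (Finset.univ.erase k.castSucc).erase k.succ,
    F x (η x) (ξ x) (heightL 0 η x) (heightR ρ ξ ((x : ℕ) + 1))

theorem heightProd_eq (F : Fin (m + 1) → ℕ → ℕ → ℝ → ℝ → ℝ) (ρ : ℝ) (k : Fin m)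
    (η ξ : Config N) :
    heightProd F ρ η ξ = offBond F ρ k η ξ * twoSite N F k (heightL 0 η k.castSucc)
      (heightR ρ ξ ((k.succ : ℕ) + 1)) (η k.castSucc) (η k.succ) (ξ k.castSucc) (ξ k.succ) := by
  have hk := castSucc_ne_succ k
  rw [heightProd, ← Finset.mul_prod_erase _ _ (Finset.mem_univ k.castSucc),
    ← Finset.mul_prod_erase _ _ (Finset.mem_erase.2 ⟨hk.symm, Finset.mem_univ k.succ⟩),
    offBond, twoSite]
  have e1 := heightL_succ 0 η k.castSucc
  have e2 := heightR_succ ρ ξ k.succ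
  simp only [occ] at e1 e2
  rw [← e1, ← e2]
  simp only [Fin.val_succ, Fin.val_castSucc]
  ring

theorem offBond_jump (F : Fin (m + 1) → ℕ → ℕ → ℝ → ℝ → ℝ) (ρ : ℝ) (k : Fin m)
    {η : Config N} {i j : Fin (m + 1)}
    (hij : (i = k.castSucc ∧ j = k.succ) ∨ (i = k.succ ∧ j = k.castSucc)) (h : CanJump η i j)
    (ξ : Config N) :
    offBond F ρ k (jump η i j) ξ = offBond F ρ k η ξ := by
  have hk := castSucc_ne_succ k
  refine Finset.prod_congr rfl fun x hx => ?_
  have hx2 : x ≠ k.succ := Finset.ne_of_mem_erase hx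
  have hx1 : x ≠ k.castSucc := Finset.ne_of_mem_erase (Finset.mem_of_mem_erase hx)
  have v1 : (x : ℕ) ≠ k + 1 := fun e => hx2 (Fin.ext (by simpa using e))
  have v2 : (x : ℕ) ≠ k := fun e => hx1 (Fin.ext (by simpa using e))
  rcases hij with ⟨rfl, rfl⟩ | ⟨rfl, rfl⟩
  · rw [jump_of_ne hx1 hx2, heightL_jump 0 hk h]
    by_cases hlt : (x : ℕ) < k
    · simp [show ¬ (k : ℕ) < x by omega, show ¬ (k : ℕ) + 1 < x by omega]
    · simp [show (k : ℕ) < x by omega, show (k : ℕ) + 1 < x by omega]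
  · rw [jump_of_ne hx2 hx1, heightL_jump 0 hk.symm h]
    by_cases hlt : (x : ℕ) < k
    · simp [show ¬ (k : ℕ) < x by omega, show ¬ (k : ℕ) + 1 < x by omega]
    · simp [show (k : ℕ) < x by omega, show (k : ℕ) + 1 < x by omega]

theorem offBond_jump' (F : Fin (m + 1) → ℕ → ℕ → ℝ → ℝ → ℝ) (ρ : ℝ) (k : Fin m)
    {ξ : Config N} {i j : Fin (m + 1)}
    (hij : (i = k.castSucc ∧ j = k.succ) ∨ (i = k.succ ∧ j = k.castSucc)) (h : CanJump ξ i j)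
    (η : Config N) :
    offBond F ρ k η (jump ξ i j) = offBond F ρ k η ξ := by
  have hk := castSucc_ne_succ k
  refine Finset.prod_congr rfl fun x hx => ?_
  have hx2 : x ≠ k.succ := Finset.ne_of_mem_erase hx
  have hx1 : x ≠ k.castSucc := Finset.ne_of_mem_erase (Finset.mem_of_mem_erase hx)
  have v1 : (x : ℕ) ≠ k + 1 := fun e => hx2 (Fin.ext (by simpa using e))
  have v2 : (x : ℕ) ≠ k := fun e => hx1 (Fin.ext (by simpa using e))
  rcases hij with ⟨rfl, rfl⟩ | ⟨rfl, rfl⟩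
  · rw [jump_of_ne hx1 hx2, heightR_jump ρ hk h]
    by_cases hlt : (x : ℕ) < k
    · simp [show (x : ℕ) + 1 ≤ k by omega, show (x : ℕ) + 1 ≤ k + 1 by omega]
    · simp [show ¬ (x : ℕ) + 1 ≤ k by omega, show ¬ (x : ℕ) + 1 ≤ k + 1 by omega]
  · rw [jump_of_ne hx2 hx1, heightR_jump ρ hk.symm h]
    by_cases hlt : (x : ℕ) < k
    · simp [show (x : ℕ) + 1 ≤ k by omega, show (x : ℕ) + 1 ≤ k + 1 by omega]
    · simp [show ¬ (x : ℕ) + 1 ≤ k by omega, show ¬ (x : ℕ) + 1 ≤ k + 1 by omega]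

/-- The duality relation on two sites. -/
def TwoSiteDual (N₁ N₂ : ℕ) (c d c' d' : ℕ → ℕ → ℝ) (T : ℕ → ℕ → ℕ → ℕ → ℝ) : Prop :=
  ∀ n₁ n₂ x₁ x₂, n₁ ≤ N₁ → n₂ ≤ N₂ → x₁ ≤ N₁ → x₂ ≤ N₂ →
    c n₁ n₂ * (T (n₁ - 1) (n₂ + 1) x₁ x₂ - T n₁ n₂ x₁ x₂)
        + d n₁ n₂ * (T (n₁ + 1) (n₂ - 1) x₁ x₂ - T n₁ n₂ x₁ x₂)
      = c' x₁ x₂ * (T n₁ n₂ (x₁ - 1) (x₂ + 1) - T n₁ n₂ x₁ x₂)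
        + d' x₁ x₂ * (T n₁ n₂ (x₁ + 1) (x₂ - 1) - T n₁ n₂ x₁ x₂)

/-- Impossible jumps between two sites have rate zero. -/
def TwoSiteAdmissible (N₁ N₂ : ℕ) (c d : ℕ → ℕ → ℝ) : Prop :=
  (∀ n, c 0 n = 0) ∧ (∀ n, c n N₂ = 0) ∧ (∀ n, d n 0 = 0) ∧ ∀ n, d N₁ n = 0

theorem TwoSiteDual.conserved {N₁ N₂ : ℕ} {c d c' d' : ℕ → ℕ → ℝ} {T : ℕ → ℕ → ℕ → ℕ → ℝ}
    (h : TwoSiteAdmissible N₁ N₂ c d) (h' : TwoSiteAdmissible N₁ N₂ c' d')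
    (hT : TwoSiteDual N₁ N₂ c d c' d' T) (φ : ℕ → ℕ → ℝ) :
    TwoSiteDual N₁ N₂ c d c' d' fun n₁ n₂ x₁ x₂ => φ (n₁ + n₂) (x₁ + x₂) * T n₁ n₂ x₁ x₂ := by
  have aux : ∀ {c : ℕ → ℕ → ℝ}, (∀ n, c 0 n = 0) → ∀ (φ : ℕ → ℝ) (n₁ n₂ : ℕ) (t s : ℝ),
      c n₁ n₂ * (φ (n₁ - 1 + (n₂ + 1)) * t - s) = c n₁ n₂ * (φ (n₁ + n₂) * t - s) := by
    intro c hc φ n₁ n₂ t s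
    rcases n₁ with _ | n₁
    · simp [hc]
    · rw [show n₁ + 1 - 1 + (n₂ + 1) = n₁ + 1 + n₂ by omega]
  have aux' : ∀ {d : ℕ → ℕ → ℝ}, (∀ n, d n 0 = 0) → ∀ (φ : ℕ → ℝ) (n₁ n₂ : ℕ) (t s : ℝ),
      d n₁ n₂ * (φ (n₁ + 1 + (n₂ - 1)) * t - s) = d n₁ n₂ * (φ (n₁ + n₂) * t - s) := by
    intro d hd φ n₁ n₂ t s
    rcases n₂ with _ | n₂
    · simp [hd]
    · rw [show n₁ + 1 + (n₂ + 1 - 1) = n₁ + (n₂ + 1) by omega]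
  intro n₁ n₂ x₁ x₂ hn₁ hn₂ hx₁ hx₂
  rw [aux h.1 (fun a => φ a (x₁ + x₂)), aux' h.2.2.1 (fun a => φ a (x₁ + x₂)),
    aux h'.1 (φ (n₁ + n₂)), aux' h'.2.2.1 (φ (n₁ + n₂))]
  linear_combination φ (n₁ + n₂) (x₁ + x₂) * hT n₁ n₂ x₁ x₂ hn₁ hn₂ hx₁ hx₂

/-- The rates on `Config N` given by a family of two-site rates that may depend on the height to
the right of the bond. -/
def liftRate (c : Fin m → ℝ → ℕ → ℕ → ℝ) (ρ : ℝ) (k : Fin m) (ξ : Config N) : ℝ :=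
  c k (heightR ρ ξ ((k.succ : ℕ) + 1)) (ξ k.castSucc) (ξ k.succ)

theorem admissible_liftRate {c d : Fin m → ℝ → ℕ → ℕ → ℝ}
    (h : ∀ k r, TwoSiteAdmissible (N k.castSucc) (N k.succ) (c k r) (d k r)) (ρ : ℝ) :
    Admissible (N := N) (liftRate c ρ) (liftRate d ρ) := by
  intro k η
  have h1 := val_le η k.castSucc
  have h2 := val_le η k.succ
  refine ⟨fun hc => ?_, fun hc => ?_⟩
  · rw [CanJump, not_and_or] at hc
    rw [liftRate]
    rcases hc with hc | hc
    · rw [Nat.eq_zero_of_not_pos hc]; exact (h k _).1 _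
    · rw [show (η k.succ : ℕ) = N k.succ by omega]; exact (h k _).2.1 _
  · rw [CanJump, not_and_or] at hc
    rw [liftRate]
    rcases hc with hc | hc
    · rw [Nat.eq_zero_of_not_pos hc]; exact (h k _).2.2.1 _
    · rw [show (η k.castSucc : ℕ) = N k.castSucc by omega]; exact (h k _).2.2.2 _

/-- Duality for products of one-site functions reduces to two sites. -/
theorem isDuality_heightProd {c d c' d' : Fin m → ℝ → ℕ → ℕ → ℝ}
    (h : ∀ k r, TwoSiteAdmissible (N k.castSucc) (N k.succ) (c k r) (d k r))
    (h' : ∀ k r, TwoSiteAdmissible (N k.castSucc) (N k.succ) (c' k r) (d' k r))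
    (F : Fin (m + 1) → ℕ → ℕ → ℝ → ℝ → ℝ) (ρ ρ' : ℝ)
    (hF : ∀ k l r r', TwoSiteDual (N k.castSucc) (N k.succ) (c k r') (d k r') (c' k r) (d' k r)
      (twoSite N F k l r)) :
    IsDuality (bondGen (liftRate c ρ') (liftRate d ρ')) (bondGen (liftRate c' ρ) (liftRate d' ρ))
      (heightProd (N := N) F ρ) := by
  intro η ξ
  refine Finset.sum_congr rfl fun k _ => ?_
  have hk := castSucc_ne_succ k
  have adm := admissible_liftRate h ρ' k η
  have adm' := admissible_liftRate h' ρ k ξ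
  set l := heightL 0 η k.castSucc with hl
  set r := heightR ρ ξ ((k.succ : ℕ) + 1) with hr
  have e := hF k l r (heightR ρ' η ((k.succ : ℕ) + 1)) (η k.castSucc) (η k.succ) (ξ k.castSucc)
    (ξ k.succ) (val_le _ _) (val_le _ _) (val_le _ _) (val_le _ _)
  have e1 : liftRate c ρ' k η * heightProd F ρ (jump η k.castSucc k.succ) ξ
      = liftRate c ρ' k η * (offBond F ρ k η ξ * twoSite N F k l r (η k.castSucc - 1)
        (η k.succ + 1) (ξ k.castSucc) (ξ k.succ)) := by
    by_cases hc : CanJump η k.castSucc k.succ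
    · rw [heightProd_eq F ρ k, offBond_jump F ρ k (Or.inl ⟨rfl, rfl⟩) hc, jump_source,
        jump_target hk hc, heightL_jump 0 hk hc]
      simp [hl, hr]
    · rw [adm.1 hc]; simp
  have e2 : liftRate d ρ' k η * heightProd F ρ (jump η k.succ k.castSucc) ξ
      = liftRate d ρ' k η * (offBond F ρ k η ξ * twoSite N F k l r (η k.castSucc + 1)
        (η k.succ - 1) (ξ k.castSucc) (ξ k.succ)) := by
    by_cases hc : CanJump η k.succ k.castSucc
    · rw [heightProd_eq F ρ k, offBond_jump F ρ k (Or.inr ⟨rfl, rfl⟩) hc, jump_source,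
        jump_target hk.symm hc, heightL_jump 0 hk.symm hc]
      simp [hl, hr]
    · rw [adm.2 hc]; simp
  have e3 : liftRate c' ρ k ξ * heightProd F ρ η (jump ξ k.castSucc k.succ)
      = liftRate c' ρ k ξ * (offBond F ρ k η ξ * twoSite N F k l r (η k.castSucc)
        (η k.succ) (ξ k.castSucc - 1) (ξ k.succ + 1)) := by
    by_cases hc : CanJump ξ k.castSucc k.succ
    · rw [heightProd_eq F ρ k, offBond_jump' F ρ k (Or.inl ⟨rfl, rfl⟩) hc, jump_source,
        jump_target hk hc, heightR_jump ρ hk hc]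
      simp [hl, hr]
    · rw [adm'.1 hc]; simp
  have e4 : liftRate d' ρ k ξ * heightProd F ρ η (jump ξ k.succ k.castSucc)
      = liftRate d' ρ k ξ * (offBond F ρ k η ξ * twoSite N F k l r (η k.castSucc)
        (η k.succ) (ξ k.castSucc + 1) (ξ k.succ - 1)) := by
    by_cases hc : CanJump ξ k.succ k.castSucc
    · rw [heightProd_eq F ρ k, offBond_jump' F ρ k (Or.inr ⟨rfl, rfl⟩) hc, jump_source,
        jump_target hk.symm hc, heightR_jump ρ hk.symm hc]
      simp [hl, hr]
    · rw [adm'.2 hc]; simp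
  beta_reduce
  rw [mul_sub, mul_sub, mul_sub, mul_sub, e1, e2, e3, e4, heightProd_eq F ρ k η ξ, ← hl, ← hr]
  simp only [liftRate, ← hr] at e ⊢
  linear_combination offBond F ρ k η ξ * e

end Generator

end

end QASEP

namespace QASEP

noncomputable section

open Filter Topology

/-- Two-site ASEP: rate of a jump to the right. -/
def asepRight (q : ℝ) (N₁ N₂ n₁ n₂ : ℕ) : ℝ :=
  q ^ (-((n₂ : ℝ) + N₁ - n₁ + 1)) * qNumber q n₁ * qNumber q (N₂ - n₂)

/-- Two-site ASEP: rate of a jump to the left. -/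
def asepLeft (q : ℝ) (N₁ N₂ n₁ n₂ : ℕ) : ℝ :=
  q ^ ((n₁ : ℝ) + N₂ - n₂ + 1) * qNumber q n₂ * qNumber q (N₁ - n₁)

/-- Two-site dynamic ASEP with height `r` on the right: rate of a jump to the right. -/
def dynRight (q : ℝ) (N₁ N₂ : ℕ) (r : ℝ) (x₁ x₂ : ℕ) : ℝ :=
  asepRight q N₁ N₂ x₁ x₂
    * ((1 + q ^ (2 * (x₁ : ℝ) - 2 * (r + (2 * x₂ - N₂) + (2 * x₁ - N₁))))
        * (1 + q ^ (2 * (x₂ : ℝ) - 2 * (r + (2 * x₂ - N₂)))))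
    / ((1 + q ^ (-2 * (r + (2 * x₂ - N₂)))) * (1 + q ^ (-2 * (r + (2 * x₂ - N₂)) - 2)))

/-- Two-site dynamic ASEP with height `r` on the right: rate of a jump to the left. -/
def dynLeft (q : ℝ) (N₁ N₂ : ℕ) (r : ℝ) (x₁ x₂ : ℕ) : ℝ :=
  asepLeft q N₁ N₂ x₁ x₂
    * ((1 + q ^ (-2 * (x₁ : ℝ) - 2 * (r + (2 * x₂ - N₂))))
        * (1 + q ^ (-2 * (x₂ : ℝ) - 2 * r)))
    / ((1 + q ^ (-2 * (r + (2 * x₂ - N₂)))) * (1 + q ^ (-2 * (r + (2 * x₂ - N₂)) + 2)))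

theorem genASEP_eq {m : ℕ} (N : Fin (m + 1) → ℕ) (q ρ : ℝ) :
    genASEP N q = bondGen
      (liftRate (fun k _ => asepRight q (N k.castSucc) (N k.succ)) ρ)
      (liftRate (fun k _ => asepLeft q (N k.castSucc) (N k.succ)) ρ) := rfl

theorem genASEPR_eq {m : ℕ} (N : Fin (m + 1) → ℕ) (q ρ : ℝ) :
    genASEPR N q ρ = bondGen
      (liftRate (fun k => dynRight q (N k.castSucc) (N k.succ)) ρ)
      (liftRate (fun k => dynLeft q (N k.castSucc) (N k.succ)) ρ) := by
  funext f ξ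
  refine Finset.sum_congr rfl fun k _ => ?_
  have e1 := heightR_succ ρ ξ k.castSucc
  have e2 := heightR_succ ρ ξ k.succ
  simp only [Fin.val_succ, Fin.val_castSucc] at e1 e2
  rw [dynRateRight, dynRateLeft, e1, e2]
  rfl

/-- Turns real powers with integral exponents into natural powers. -/
theorem rpow_two_mul_natCast {q : ℝ} (hq : 0 < q) (n : ℕ) : q ^ (2 * (n : ℝ)) = (q ^ 2) ^ n := by
  rw [Real.rpow_mul hq.le, Real.rpow_natCast, Real.rpow_two]

theorem qNumber_natCast {q : ℝ} (hq : 0 < q) (hq1 : q ≠ 1) (n : ℕ) :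
    qNumber q n = (q ^ n - (q ^ n)⁻¹) / (q - q⁻¹) := by
  rw [qNumber, if_neg hq1, Real.rpow_neg hq.le, Real.rpow_natCast]

theorem qNumber_sub_natCast {q : ℝ} (hq : 0 < q) (hq1 : q ≠ 1) (n k : ℕ) :
    qNumber q ((n : ℝ) - k) = (q ^ n / q ^ k - q ^ k / q ^ n) / (q - q⁻¹) := by
  rw [qNumber, if_neg hq1, neg_sub, Real.rpow_sub hq, Real.rpow_sub hq, Real.rpow_natCast,
    Real.rpow_natCast]

theorem asepRight_eq {q : ℝ} (hq : 0 < q) (hq1 : q ≠ 1) (N₁ N₂ n₁ n₂ : ℕ) :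
    asepRight q N₁ N₂ n₁ n₂ = ((q - q⁻¹) ^ 2)⁻¹ * (q * q ^ N₁ * q ^ N₂)⁻¹
      * (1 - (q ^ 2) ^ n₁) * (1 - (q ^ 2) ^ N₂ / (q ^ 2) ^ n₂) := by
  rw [asepRight, qNumber_natCast hq hq1, qNumber_sub_natCast hq hq1, Real.rpow_neg hq.le,
    Real.rpow_add hq, Real.rpow_sub hq, Real.rpow_add hq, Real.rpow_natCast, Real.rpow_natCast,
    Real.rpow_natCast, Real.rpow_one, ← pow_mul, ← pow_mul, ← pow_mul, mul_comm 2, mul_comm 2,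
    mul_comm 2, pow_mul, pow_mul, pow_mul]
  generalize (q - q⁻¹) = u
  have := hq.ne'
  rcases eq_or_ne u 0 with rfl | hu
  · simp
  field_simp
  ring

theorem asepLeft_eq {q : ℝ} (hq : 0 < q) (hq1 : q ≠ 1) (N₁ N₂ n₁ n₂ : ℕ) :
    asepLeft q N₁ N₂ n₁ n₂ = ((q - q⁻¹) ^ 2)⁻¹ * (q * q ^ N₁ * q ^ N₂)
      * (1 - 1 / (q ^ 2) ^ n₂) * (1 - (q ^ 2) ^ n₁ / (q ^ 2) ^ N₁) := by
  rw [asepLeft, qNumber_natCast hq hq1, qNumber_sub_natCast hq hq1,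
    Real.rpow_add hq, Real.rpow_sub hq, Real.rpow_add hq, Real.rpow_natCast, Real.rpow_natCast,
    Real.rpow_natCast, Real.rpow_one, ← pow_mul, ← pow_mul, ← pow_mul, mul_comm 2, mul_comm 2,
    mul_comm 2, pow_mul, pow_mul, pow_mul]
  generalize (q - q⁻¹) = u
  have := hq.ne'
  rcases eq_or_ne u 0 with rfl | hu
  · simp
  field_simp

theorem asep_admissible {q : ℝ} (hq : 0 < q) (hq1 : q ≠ 1) (N₁ N₂ : ℕ) :
    TwoSiteAdmissible N₁ N₂ (asepRight q N₁ N₂) (asepLeft q N₁ N₂) := by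
  have : ∀ n, (q ^ 2) ^ n ≠ 0 := fun n => by positivity
  refine ⟨fun n => ?_, fun n => ?_, fun n => ?_, fun n => ?_⟩
  · rw [asepRight_eq hq hq1]; simp
  · rw [asepRight_eq hq hq1, div_self (this _)]; simp
  · rw [asepLeft_eq hq hq1]; simp
  · rw [asepLeft_eq hq hq1, div_self (this _)]; simp

theorem dyn_admissible {q : ℝ} (hq : 0 < q) (hq1 : q ≠ 1) (N₁ N₂ : ℕ) (r : ℝ) :
    TwoSiteAdmissible N₁ N₂ (dynRight q N₁ N₂ r) (dynLeft q N₁ N₂ r) := by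
  obtain ⟨h1, h2, h3, h4⟩ := asep_admissible hq hq1 N₁ N₂
  refine ⟨fun n => ?_, fun n => ?_, fun n => ?_, fun n => ?_⟩
  · rw [dynRight, h1]; simp
  · rw [dynRight, h2]; simp
  · rw [dynLeft, h3]; simp
  · rw [dynLeft, h4]; simp

/-- The normalized `q`-falling factorial `[n]_z / [N]_z`. -/
def falling (Q : ℝ) (N n z : ℕ) : ℝ := ∏ i ∈ Finset.range z, (Q ^ i - Q ^ n) / (Q ^ i - Q ^ N)

theorem falling_zero_right (Q : ℝ) (N n : ℕ) : falling Q N n 0 = 1 := rfl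

theorem falling_succ (Q : ℝ) (N n z : ℕ) :
    falling Q N n (z + 1) = falling Q N n z * ((Q ^ z - Q ^ n) / (Q ^ z - Q ^ N)) :=
  Finset.prod_range_succ _ _

theorem falling_eq_zero {Q : ℝ} {N n z : ℕ} (h : n < z) : falling Q N n z = 0 := by
  rw [falling, Finset.prod_eq_zero_iff]
  exact ⟨n, Finset.mem_range.2 h, by simp⟩

theorem prod_pow_sub_succ (Q : ℝ) (n z : ℕ) :
    ∏ i ∈ Finset.range (z + 1), (Q ^ i - Q ^ (n + 1))
      = (1 - Q ^ (n + 1)) * Q ^ z * ∏ i ∈ Finset.range z, (Q ^ i - Q ^ n) := by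
  rw [Finset.prod_range_succ', mul_comm, pow_zero, mul_assoc]
  have : ∀ i, Q ^ (i + 1) - Q ^ (n + 1) = Q * (Q ^ i - Q ^ n) := fun i => by ring
  simp only [this, Finset.prod_mul_distrib, Finset.prod_const, Finset.card_range]

theorem falling_succ_succ (Q : ℝ) (N n z : ℕ) :
    falling Q N (n + 1) (z + 1)
      = falling Q N n z * ((1 - Q ^ (n + 1)) * Q ^ z / (Q ^ z - Q ^ N)) := by
  simp only [falling, Finset.prod_div_distrib]
  rw [prod_pow_sub_succ, Finset.prod_range_succ, div_mul_div_comm]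
  ring

theorem falling_succ_left {Q : ℝ} (hQ0 : 0 < Q) (N n z : ℕ) :
    (1 - Q ^ (n + 1)) * falling Q N n z
      = falling Q N (n + 1) z * (1 - Q ^ (n + 1) / Q ^ z) := by
  have e := prod_pow_sub_succ Q n z
  rw [Finset.prod_range_succ] at e
  simp only [falling, Finset.prod_div_distrib]
  have hq : Q ^ z ≠ 0 := by positivity
  rw [one_sub_div hq, ← mul_div_assoc, div_mul_div_comm, e]
  field_simp

theorem falling_pred {Q : ℝ} (hQ0 : 0 < Q) (N n z : ℕ) :
    (1 - Q ^ n) * falling Q N (n - 1) z = falling Q N n z * (1 - Q ^ n / Q ^ z) := by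
  rcases n with _ | n
  · rcases z with _ | z
    · simp
    · simp [falling_eq_zero (Nat.succ_pos z)]
  · exact falling_succ_left hQ0 N n z

/-- The triangular self-duality of two-site ASEP. -/
theorem falling_twoSiteDual {q : ℝ} (hq0 : 0 < q) (hq1 : q < 1) (N₁ N₂ : ℕ) :
    TwoSiteDual N₁ N₂ (asepRight q N₁ N₂) (asepLeft q N₁ N₂) (asepRight q N₁ N₂)
      (asepLeft q N₁ N₂) fun n₁ n₂ z₁ z₂ =>
        falling (q ^ 2) N₁ n₁ z₁ * falling (q ^ 2) N₂ n₂ z₂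
          * (((q ^ 2) ^ n₂) ^ z₁ * ((q ^ 2) ^ N₂) ^ z₂) := by
  intro n₁ n₂ z₁ z₂ hn₁ hn₂ hz₁ hz₂
  have hQ0 : 0 < q ^ 2 := by positivity
  have hQ1 : q ^ 2 < 1 := pow_lt_one₀ hq0.le hq1 two_ne_zero
  simp only [asepRight_eq hq0 hq1.ne, asepLeft_eq hq0 hq1.ne]
  generalize ((q - q⁻¹) ^ 2)⁻¹ = α
  have hqN : ∀ N : ℕ, (q ^ 2) ^ N = (q ^ N) ^ 2 := fun N => by rw [← pow_mul, mul_comm, pow_mul]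
  have hM₁ := hqN N₁
  have hM₂ := hqN N₂
  have hm₁ : q ^ N₁ ≠ 0 := by positivity
  have hm₂ : q ^ N₂ ≠ 0 := by positivity
  have hq : q ≠ 0 := hq0.ne'
  generalize q ^ N₁ = m₁ at *
  generalize q ^ N₂ = m₂ at *
  clear hqN
  set Q := q ^ 2 with hQ
  have hQn : ∀ n : ℕ, Q ^ n ≠ 0 := fun n => by positivity
  set T : ℕ → ℕ → ℕ → ℕ → ℝ := fun n₁ n₂ z₁ z₂ =>
    falling Q N₁ n₁ z₁ * falling Q N₂ n₂ z₂ * ((Q ^ n₂) ^ z₁ * (Q ^ N₂) ^ z₂) with hT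
  have f1 : (1 - Q ^ n₁) * falling Q N₁ (n₁ - 1) z₁
      = falling Q N₁ n₁ z₁ * (1 - Q ^ n₁ / Q ^ z₁) := falling_pred hQ0 N₁ n₁ z₁
  have f2 : (1 - 1 / Q ^ n₂) * (falling Q N₂ (n₂ - 1) z₂ * (Q ^ (n₂ - 1)) ^ z₁)
      = -(1 / Q ^ n₂) * falling Q N₂ n₂ z₂ * (1 - Q ^ n₂ / Q ^ z₂)
        * ((Q ^ n₂) ^ z₁ / Q ^ z₁) := by
    have e := falling_pred hQ0 N₂ n₂ z₂
    rcases n₂ with _ | n₂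
    · simp only [pow_zero, sub_self, zero_mul] at e
      simp only [pow_zero, div_one, sub_self, zero_mul]
      linear_combination (-(1 ^ z₁ / Q ^ z₁)) * e
    · have h := hQn (n₂ + 1)
      have h' := hQn z₁
      have hp : (Q ^ (n₂ + 1)) ^ z₁ / Q ^ z₁ = (Q ^ n₂) ^ z₁ := by
        rw [pow_succ, mul_pow, mul_div_assoc, div_self h', mul_one]
      rw [hp, Nat.add_sub_cancel]
      have : 1 - 1 / Q ^ (n₂ + 1) = -(1 / Q ^ (n₂ + 1)) * (1 - Q ^ (n₂ + 1)) := by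
        field_simp; ring
      rw [this]
      rw [Nat.add_sub_cancel] at e
      linear_combination (-(1 / Q ^ (n₂ + 1)) * (Q ^ n₂) ^ z₁) * e
  have g1 : (1 - Q ^ z₁ / Q ^ N₁) * falling Q N₁ n₁ (z₁ + 1)
      = -(1 / Q ^ N₁) * falling Q N₁ n₁ z₁ * (Q ^ z₁ - Q ^ n₁) := by
    rcases hz₁.eq_or_lt with rfl | h
    · rw [div_self (hQn _), sub_self, zero_mul]
      rcases hn₁.eq_or_lt with rfl | h
      · simp
      · rw [falling_eq_zero h]; simp
    · have := pow_sub_pow_ne_zero hQ0 hQ1 h.ne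
      have h' := hQn N₁
      rw [falling_succ, one_sub_div h', ← neg_sub (Q ^ z₁)]
      field_simp
  have g2 : (1 - Q ^ N₂ / Q ^ z₂) * falling Q N₂ n₂ (z₂ + 1)
      = falling Q N₂ n₂ z₂ * (1 - Q ^ n₂ / Q ^ z₂) := by
    rcases hz₂.eq_or_lt with rfl | h
    · rw [div_self (hQn _), sub_self, zero_mul]
      rcases hn₂.eq_or_lt with rfl | h
      · simp [div_self (hQn _)]
      · rw [falling_eq_zero h]; simp
    · have := pow_sub_pow_ne_zero hQ0 hQ1 h.ne
      have h' := hQn z₂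
      rw [falling_succ, one_sub_div h', one_sub_div h']
      field_simp
  have e1 : α * (q * m₁ * m₂)⁻¹ * (1 - Q ^ n₁) * (1 - Q ^ N₂ / Q ^ n₂) * T (n₁ - 1) (n₂ + 1) z₁ z₂
      = α * (q * m₁ * m₂)⁻¹ * (1 - Q ^ N₂ / Q ^ n₂)
        * (falling Q N₁ n₁ z₁ * (1 - Q ^ n₁ / Q ^ z₁)) * falling Q N₂ (n₂ + 1) z₂
        * ((Q ^ n₂) ^ z₁ * Q ^ z₁ * (Q ^ N₂) ^ z₂) := by
    rw [← f1, hT]; simp only [pow_succ, mul_pow]; ring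
  have e2 : α * (q * m₁ * m₂) * (1 - 1 / Q ^ n₂) * (1 - Q ^ n₁ / Q ^ N₁)
        * T (n₁ + 1) (n₂ - 1) z₁ z₂
      = α * (q * m₁ * m₂) * (1 - Q ^ n₁ / Q ^ N₁) * falling Q N₁ (n₁ + 1) z₁
        * (-(1 / Q ^ n₂) * falling Q N₂ n₂ z₂ * (1 - Q ^ n₂ / Q ^ z₂)
        * ((Q ^ n₂) ^ z₁ / Q ^ z₁)) * (Q ^ N₂) ^ z₂ := by
    rw [← f2, hT]; ring
  have e3 : α * (q * m₁ * m₂)⁻¹ * (1 - Q ^ z₁) * (1 - Q ^ N₂ / Q ^ z₂) * T n₁ n₂ (z₁ - 1) (z₂ + 1)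
      = α * (q * m₁ * m₂)⁻¹ * ((1 - Q ^ z₁) * falling Q N₁ n₁ (z₁ - 1) * (Q ^ n₂) ^ (z₁ - 1))
        * (falling Q N₂ n₂ z₂ * (1 - Q ^ n₂ / Q ^ z₂)) * ((Q ^ N₂) ^ z₂ * Q ^ N₂) := by
    rw [← g2, hT]; simp only [pow_succ]; ring
  have e4 : α * (q * m₁ * m₂) * (1 - 1 / Q ^ z₂) * (1 - Q ^ z₁ / Q ^ N₁)
        * T n₁ n₂ (z₁ + 1) (z₂ - 1)
      = α * (q * m₁ * m₂) * ((1 - 1 / Q ^ z₂) * falling Q N₂ n₂ (z₂ - 1) * (Q ^ N₂) ^ (z₂ - 1))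
        * (-(1 / Q ^ N₁) * falling Q N₁ n₁ z₁ * (Q ^ z₁ - Q ^ n₁))
        * ((Q ^ n₂) ^ z₁ * Q ^ n₂) := by
    rw [← g1, hT]; simp only [pow_succ]; ring
  have core : α * (q * m₁ * m₂)⁻¹ * (1 - Q ^ N₂ / Q ^ n₂)
        * (falling Q N₁ n₁ z₁ * (1 - Q ^ n₁ / Q ^ z₁)) * falling Q N₂ (n₂ + 1) z₂
        * ((Q ^ n₂) ^ z₁ * Q ^ z₁ * (Q ^ N₂) ^ z₂)
      - α * (q * m₁ * m₂)⁻¹ * (1 - Q ^ n₁) * (1 - Q ^ N₂ / Q ^ n₂) * T n₁ n₂ z₁ z₂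
      + (α * (q * m₁ * m₂) * (1 - Q ^ n₁ / Q ^ N₁) * falling Q N₁ (n₁ + 1) z₁
        * (-(1 / Q ^ n₂) * falling Q N₂ n₂ z₂ * (1 - Q ^ n₂ / Q ^ z₂)
        * ((Q ^ n₂) ^ z₁ / Q ^ z₁)) * (Q ^ N₂) ^ z₂
      - α * (q * m₁ * m₂) * (1 - 1 / Q ^ n₂) * (1 - Q ^ n₁ / Q ^ N₁) * T n₁ n₂ z₁ z₂)
      = α * (q * m₁ * m₂)⁻¹ * ((1 - Q ^ z₁) * falling Q N₁ n₁ (z₁ - 1) * (Q ^ n₂) ^ (z₁ - 1))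
        * (falling Q N₂ n₂ z₂ * (1 - Q ^ n₂ / Q ^ z₂)) * ((Q ^ N₂) ^ z₂ * Q ^ N₂)
      - α * (q * m₁ * m₂)⁻¹ * (1 - Q ^ z₁) * (1 - Q ^ N₂ / Q ^ z₂) * T n₁ n₂ z₁ z₂
      + (α * (q * m₁ * m₂) * ((1 - 1 / Q ^ z₂) * falling Q N₂ n₂ (z₂ - 1) * (Q ^ N₂) ^ (z₂ - 1))
        * (-(1 / Q ^ N₁) * falling Q N₁ n₁ z₁ * (Q ^ z₁ - Q ^ n₁))
        * ((Q ^ n₂) ^ z₁ * Q ^ n₂)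
      - α * (q * m₁ * m₂) * (1 - 1 / Q ^ z₂) * (1 - Q ^ z₁ / Q ^ N₁) * T n₁ n₂ z₁ z₂) := by
    clear e1 e2 e3 e4 f1 f2 g1 g2
    simp only [hT]
    have hn1 := hQn n₁
    have hn2 := hQn n₂
    rcases z₁ with _ | z₁ <;> rcases z₂ with _ | z₂
    · simp only [falling_zero_right, pow_zero, hM₁, hM₂]
      generalize Q ^ n₁ = a at *
      generalize Q ^ n₂ = b at *
      field_simp
      ring
    · have d2 := pow_sub_pow_ne_zero hQ0 hQ1 (show z₂ ≠ N₂ by omega)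
      have p2 := hQn z₂
      rw [falling_succ_succ, falling_succ]
      simp only [falling_zero_right, pow_zero, Nat.add_sub_cancel, pow_succ Q, hM₁]
      rw [hM₂] at d2 ⊢
      generalize falling Q N₂ n₂ z₂ = y₂
      simp only [pow_succ (m₂ ^ 2)]
      generalize (m₂ ^ 2) ^ z₂ = M
      generalize Q ^ n₁ = a at *
      generalize Q ^ n₂ = b at *
      generalize Q ^ z₂ = t₂ at *
      rw [hQ]
      field_simp
      ring
    · have d1 := pow_sub_pow_ne_zero hQ0 hQ1 (show z₁ ≠ N₁ by omega)
      have p1 := hQn z₁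
      have p2 := pow_ne_zero z₁ hn2
      rw [falling_succ_succ, falling_succ]
      simp only [falling_zero_right, pow_zero, Nat.add_sub_cancel, pow_succ Q, hM₂]
      rw [hM₁] at d1 ⊢
      generalize falling Q N₁ n₁ z₁ = y₁
      simp only [pow_succ (Q ^ n₂)]
      generalize (Q ^ n₂) ^ z₁ = M at *
      generalize Q ^ n₁ = a at *
      generalize Q ^ n₂ = b at *
      generalize Q ^ z₁ = t₁ at *
      rw [hQ]
      field_simp
      ring
    · have d1 := pow_sub_pow_ne_zero hQ0 hQ1 (show z₁ ≠ N₁ by omega)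
      have d2 := pow_sub_pow_ne_zero hQ0 hQ1 (show z₂ ≠ N₂ by omega)
      have p1 := hQn z₁
      have p2 := hQn z₂
      have p3 := pow_ne_zero z₁ hn2
      rw [falling_succ_succ, falling_succ_succ, falling_succ, falling_succ]
      simp only [Nat.add_sub_cancel, pow_succ Q]
      rw [hM₁] at d1 ⊢
      rw [hM₂] at d2 ⊢
      generalize falling Q N₁ n₁ z₁ = y₁
      generalize falling Q N₂ n₂ z₂ = y₂
      simp only [pow_succ (Q ^ n₂), pow_succ (m₂ ^ 2)]
      generalize (Q ^ n₂) ^ z₁ = M at *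
      generalize (m₂ ^ 2) ^ z₂ = M'
      generalize Q ^ n₁ = a at *
      generalize Q ^ n₂ = b at *
      generalize Q ^ z₁ = t₁ at *
      generalize Q ^ z₂ = t₂ at *
      rw [hQ]
      field_simp
      ring
  simp only [hT] at e1 e2 e3 e4 core
  linear_combination core + e1 + e2 - e3 - e4

end

end QASEP

namespace QASEP

noncomputable section

open Filter Topology

/-! ### Vanishing of polynomials -/

theorem coeff_eq_zero_of_sum_eq_zero {ε : ℝ} (hε : 0 < ε) {I : ℕ} {a : ℕ → ℝ}
    (h : ∀ t, 0 < t → t < ε → ∑ i ∈ Finset.range I, a i * t ^ i = 0) {i : ℕ} (hi : i < I) :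
    a i = 0 := by
  have hp : (∑ i ∈ Finset.range I, Polynomial.C (a i) * Polynomial.X ^ i) = 0 := by
    refine Polynomial.eq_zero_of_infinite_isRoot _ ((Set.Ioo_infinite hε).mono fun t ht => ?_)
    simpa [Polynomial.IsRoot, Polynomial.eval_finsetSum] using h t ht.1 ht.2
  have := congrArg (fun p => Polynomial.coeff p i) hp
  simpa [Polynomial.finsetSum_coeff, Polynomial.coeff_X_pow, hi] using this

theorem coeff_eq_zero_of_sum_sum_eq_zero {ε : ℝ} (hε : 0 < ε) {I J : ℕ} {a : ℕ → ℕ → ℝ}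
    (h : ∀ t s, 0 < t → t < ε → 0 < s → s < ε →
      ∑ i ∈ Finset.range I, ∑ j ∈ Finset.range J, a i j * (t ^ i * s ^ j) = 0) {i j : ℕ}
    (hi : i < I) (hj : j < J) : a i j = 0 := by
  refine coeff_eq_zero_of_sum_eq_zero hε (a := fun j => a i j) (fun s hs hs' => ?_) hj
  refine coeff_eq_zero_of_sum_eq_zero hε
    (a := fun i => ∑ j ∈ Finset.range J, a i j * s ^ j) (fun t ht ht' => ?_) hi
  rw [← h t s ht ht' hs hs']
  refine Finset.sum_congr rfl fun i _ => ?_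
  rw [Finset.sum_mul]
  exact Finset.sum_congr rfl fun j _ => by ring

/-! ### Generating functions -/

/-- The weight of the dual `q`-Krawtchouk generating function. -/
def krawtWeight (Q : ℝ) (N n : ℕ) : ℝ := gauss Q N n * (Q ^ (n.choose 2) * (-1) ^ n)

/-- The weighted generating function of the sequence `Y`. -/
def genSum (Q : ℝ) (N : ℕ) (Y : ℕ → ℝ) (t : ℝ) : ℝ :=
  ∑ n ∈ Finset.range (N + 1), krawtWeight Q N n * Y n * t ^ n

section Unit

variable {Q : ℝ} (hQ0 : 0 < Q) (hQ1 : Q < 1)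
include hQ0 hQ1

theorem krawtWeight_ne_zero {N n : ℕ} (h : n ≤ N) : krawtWeight Q N n ≠ 0 := by
  have := (gauss_pos hQ0 hQ1 h).ne'
  rw [krawtWeight]
  positivity

theorem krawtWeight_succ {N n : ℕ} (h : n ≤ N) :
    krawtWeight Q N (n + 1) * (1 - Q ^ (n + 1)) = -(krawtWeight Q N n * (Q ^ n - Q ^ N)) := by
  have e := gauss_succ_right hQ0 hQ1 h
  have p : Q ^ (N - n) * Q ^ n = Q ^ N := by rw [← pow_add]; congr 1; omega
  rw [krawtWeight, krawtWeight, Nat.choose_succ_succ' n 1, Nat.choose_one_right, pow_add Q n, ← p]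
  linear_combination (-(Q ^ n * Q ^ (n.choose 2) * (-1) ^ n)) * e

theorem genSum_lower (N : ℕ) (Y : ℕ → ℝ) (t : ℝ) :
    ∑ n ∈ Finset.range (N + 1), krawtWeight Q N n * (1 - Q ^ n) * Y (n - 1) * t ^ n
      = -t * (genSum Q N Y (Q * t) - Q ^ N * genSum Q N Y t) := by
  rw [Finset.sum_range_succ']
  have : ∀ n ∈ Finset.range N, krawtWeight Q N (n + 1) * (1 - Q ^ (n + 1)) * Y (n + 1 - 1)
      * t ^ (n + 1) = -t * (krawtWeight Q N n * Y n * (Q * t) ^ n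
        - Q ^ N * (krawtWeight Q N n * Y n * t ^ n)) := by
    intro n hn
    rw [krawtWeight_succ hQ0 hQ1 (Finset.mem_range.1 hn).le, Nat.add_sub_cancel, mul_pow]
    ring
  rw [Finset.sum_congr rfl this, ← Finset.mul_sum, Finset.sum_sub_distrib, ← Finset.mul_sum,
    genSum, genSum, Finset.sum_range_succ, Finset.sum_range_succ (n := N), mul_pow Q t N]
  simp only [pow_zero, sub_self, mul_zero, zero_mul, add_zero]
  ring

theorem genSum_upper (N : ℕ) (Y : ℕ → ℝ) {t : ℝ} (ht : t ≠ 0) :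
    ∑ n ∈ Finset.range (N + 1), krawtWeight Q N n * (1 - Q ^ N / Q ^ n) * Y (n + 1) * t ^ n
      = -(Q / t) * (genSum Q N Y (t / Q) - genSum Q N Y t) := by
  rw [genSum, genSum, Finset.sum_range_succ, Finset.sum_range_succ', Finset.sum_range_succ']
  have hq : Q ≠ 0 := hQ0.ne'
  have : ∀ n ∈ Finset.range N, krawtWeight Q N n * (1 - Q ^ N / Q ^ n) * Y (n + 1) * t ^ n
      = -(Q / t) * (krawtWeight Q N (n + 1) * Y (n + 1) * (t / Q) ^ (n + 1)
        - krawtWeight Q N (n + 1) * Y (n + 1) * t ^ (n + 1)) := by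
    intro n hn
    have e := krawtWeight_succ hQ0 hQ1 (Finset.mem_range.1 hn).le
    have hQn : Q ^ n ≠ 0 := pow_ne_zero _ hq
    have h1 : krawtWeight Q N n * (1 - Q ^ N / Q ^ n)
        = -(krawtWeight Q N (n + 1) * (1 - Q ^ (n + 1)) / Q ^ n) := by
      rw [e]; field_simp
    rw [h1, div_pow]
    simp only [pow_succ]
    field_simp
  rw [Finset.sum_congr rfl this, ← Finset.mul_sum, Finset.sum_sub_distrib,
    div_self (pow_ne_zero _ hq)]
  simp

theorem genSum_lower' (N : ℕ) (Y : ℕ → ℝ) (t : ℝ) :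
    ∑ n ∈ Finset.range (N + 1), krawtWeight Q N n * (1 - 1 / Q ^ n) * Y (n - 1) * t ^ n
      = t / Q * (genSum Q N Y t - Q ^ N * genSum Q N Y (t / Q)) := by
  have hq : Q ≠ 0 := hQ0.ne'
  have e := genSum_lower hQ0 hQ1 N Y (t / Q)
  rw [mul_div_cancel₀ _ hq] at e
  rw [show t / Q * (genSum Q N Y t - Q ^ N * genSum Q N Y (t / Q))
      = -(-(t / Q) * (genSum Q N Y t - Q ^ N * genSum Q N Y (t / Q))) by ring, ← e,
    ← Finset.sum_neg_distrib]
  refine Finset.sum_congr rfl fun n _ => ?_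
  have hQn : Q ^ n ≠ 0 := pow_ne_zero _ hq
  rw [div_pow]
  field_simp
  ring

theorem genSum_upper' (N : ℕ) (Y : ℕ → ℝ) {t : ℝ} (ht : t ≠ 0) :
    ∑ n ∈ Finset.range (N + 1), krawtWeight Q N n * (1 - Q ^ n / Q ^ N) * Y (n + 1) * t ^ n
      = 1 / (t * Q ^ N) * (genSum Q N Y t - genSum Q N Y (Q * t)) := by
  have hq : Q ≠ 0 := hQ0.ne'
  have e := genSum_upper hQ0 hQ1 N Y (mul_ne_zero hq ht)
  rw [mul_div_cancel_left₀ _ hq] at e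
  have hQN : Q ^ N ≠ 0 := pow_ne_zero _ hq
  rw [show 1 / (t * Q ^ N) * (genSum Q N Y t - genSum Q N Y (Q * t))
      = -(1 / Q ^ N) * (-(Q / (Q * t)) * (genSum Q N Y t - genSum Q N Y (Q * t))) by field_simp,
    ← e, Finset.mul_sum]
  refine Finset.sum_congr rfl fun n _ => ?_
  have hQn : Q ^ n ≠ 0 := pow_ne_zero _ hq
  rw [mul_pow]
  field_simp
  ring

omit hQ0 hQ1 in
theorem genSum_diag (N : ℕ) (Y : ℕ → ℝ) (t : ℝ) :
    ∑ n ∈ Finset.range (N + 1), krawtWeight Q N n * (1 - Q ^ n) * Y n * t ^ n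
      = genSum Q N Y t - genSum Q N Y (Q * t) := by
  rw [genSum, genSum, ← Finset.sum_sub_distrib]
  exact Finset.sum_congr rfl fun n _ => by rw [mul_pow]; ring

omit hQ0 hQ1 in
theorem genSum_diag' (N : ℕ) (Y : ℕ → ℝ) (t c : ℝ) :
    ∑ n ∈ Finset.range (N + 1), krawtWeight Q N n * (1 - c / Q ^ n) * Y n * t ^ n
      = genSum Q N Y t - c * genSum Q N Y (t / Q) := by
  rw [genSum, genSum, Finset.mul_sum, ← Finset.sum_sub_distrib]
  exact Finset.sum_congr rfl fun n _ => by rw [div_pow]; ring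

omit hQ0 hQ1 in
theorem genSum_diag'' (N : ℕ) (Y : ℕ → ℝ) (t c : ℝ) :
    ∑ n ∈ Finset.range (N + 1), krawtWeight Q N n * (1 - Q ^ n / c) * Y n * t ^ n
      = genSum Q N Y t - 1 / c * genSum Q N Y (Q * t) := by
  rw [genSum, genSum, Finset.mul_sum, ← Finset.sum_sub_distrib]
  exact Finset.sum_congr rfl fun n _ => by rw [mul_pow]; ring

theorem genSum_krawtSum {N x : ℕ} (hx : x ≤ N) (B c t : ℝ) :
    genSum Q N (fun n => c ^ n * krawtSum Q N x B n) t
      = qPoch (B * (t * c * Q ^ (N - x))) Q x * qPoch (t * c) Q (N - x) := by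
  rw [← sum_krawtSum hQ0 hQ1 hx, genSum]
  refine Finset.sum_congr rfl fun n _ => ?_
  rw [krawtWeight, neg_eq_neg_one_mul (t * c), mul_pow, mul_pow]
  ring

omit hQ0 hQ1 in
theorem qPoch_mul_left (a : ℝ) (n : ℕ) :
    qPoch (a * Q) Q n * (1 - a) = qPoch a Q n * (1 - a * Q ^ n) := by
  rw [← qPoch_succ, qPoch_succ']; ring

end Unit

set_option maxHeartbeats 1000000 in
theorem krawtSum_core_identity {Q θ X₁ X₂ M₁ M₂ t₁ t₂ : ℝ} (hX₁ : X₁ ≠ 0)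
    (hX₂ : X₂ ≠ 0) (hM₁ : M₁ ≠ 0) (hM₂ : M₂ ≠ 0) (ht₁ : t₁ ≠ 0) (ht₂ : t₂ ≠ 0)
    (h : 1 + θ ≠ 0) (h1 : θ + t₁ ≠ 0) (h2 : 1 - t₁ ≠ 0) (h3 : Q * θ + t₂ ≠ 0) (h4 : Q - t₂ ≠ 0)
    {P₁ P₂ : ℝ}
    (hP₁ : P₁ * ((θ + t₁) * (1 - t₁)) = (θ + t₁ * X₁) * (1 - t₁ * M₁ / X₁))
    (hP₂ : P₂ * ((Q * θ + t₂) * (Q - t₂)) = (Q * θ + t₂ / X₂) * (Q - t₂ * X₂ / M₂)) :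
    Q * M₂ * (P₁ - M₁) * (P₂ - 1) / t₂ - (1 - M₂ * P₂) * (1 - P₁) / t₁
      = M₁ * M₂ * (1 - 1 / X₂) * (1 - X₁ / M₁) * (1 + θ / X₁) * (1 + θ * X₂ / M₂) * Q
          / ((1 + θ) * (1 - t₁) * (Q * θ + t₂))
        - (1 - X₁) * (1 - M₂ / X₂) * (1 + θ * M₁ / X₁) * (1 + θ * X₂) * Q
          / ((1 + θ) * (θ + t₁) * (Q - t₂)) := by
  have e1 : P₁ = (θ + t₁ * X₁) * (1 - t₁ * M₁ / X₁) / ((θ + t₁) * (1 - t₁)) := by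
    rw [← hP₁]; field_simp
  have e2 : P₂ = (Q * θ + t₂ / X₂) * (Q - t₂ * X₂ / M₂) / ((Q * θ + t₂) * (Q - t₂)) := by
    rw [← hP₂]; field_simp
  rw [e1, e2]
  field_simp
  ring

end

end QASEP

namespace QASEP

noncomputable section

open Filter Topology

theorem dynRight_eq {q : ℝ} (hq : 0 < q) (N₁ N₂ : ℕ) (r : ℝ) (x₁ x₂ : ℕ) {θ : ℝ}
    (hθ : θ = (q ^ 2) ^ N₂ / (q ^ (2 * r) * ((q ^ 2) ^ x₂) ^ 2)) :
    dynRight q N₁ N₂ r x₁ x₂ = asepRight q N₁ N₂ x₁ x₂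
      * ((1 + θ * (q ^ 2) ^ N₁ / (q ^ 2) ^ x₁) * (1 + θ * (q ^ 2) ^ x₂))
      / ((1 + θ) * (1 + θ / q ^ 2)) := by
  have n := rpow_two_mul_natCast hq
  have e1 : q ^ (-2 * (r + (2 * (x₂ : ℝ) - N₂))) = θ := by
    rw [hθ, show -2 * (r + (2 * (x₂ : ℝ) - N₂)) = 2 * N₂ - (2 * r + (2 * x₂ + 2 * x₂)) by ring,
      Real.rpow_sub hq, Real.rpow_add hq, Real.rpow_add hq, n, n, sq ((q ^ 2) ^ x₂)]
  have e2 : q ^ (2 * (x₂ : ℝ) - 2 * (r + (2 * x₂ - N₂))) = θ * (q ^ 2) ^ x₂ := by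
    rw [← e1, ← n x₂, ← Real.rpow_add hq]; ring_nf
  have e3 : q ^ (2 * (x₁ : ℝ) - 2 * (r + (2 * x₂ - N₂) + (2 * x₁ - N₁)))
      = θ * (q ^ 2) ^ N₁ / (q ^ 2) ^ x₁ := by
    rw [← e1, ← n x₁, ← n N₁, ← Real.rpow_add hq, ← Real.rpow_sub hq]; ring_nf
  have e4 : q ^ (-2 * (r + (2 * (x₂ : ℝ) - N₂)) - 2) = θ / q ^ 2 := by
    rw [← e1, Real.rpow_sub hq, Real.rpow_two]
  rw [dynRight, e1, e2, e3, e4]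

theorem dynLeft_eq {q : ℝ} (hq : 0 < q) (N₁ N₂ : ℕ) (r : ℝ) (x₁ x₂ : ℕ) {θ : ℝ}
    (hθ : θ = (q ^ 2) ^ N₂ / (q ^ (2 * r) * ((q ^ 2) ^ x₂) ^ 2)) :
    dynLeft q N₁ N₂ r x₁ x₂ = asepLeft q N₁ N₂ x₁ x₂
      * ((1 + θ / (q ^ 2) ^ x₁) * (1 + θ * (q ^ 2) ^ x₂ / (q ^ 2) ^ N₂))
      / ((1 + θ) * (1 + θ * q ^ 2)) := by
  have n := rpow_two_mul_natCast hq
  have e1 : q ^ (-2 * (r + (2 * (x₂ : ℝ) - N₂))) = θ := by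
    rw [hθ, show -2 * (r + (2 * (x₂ : ℝ) - N₂)) = 2 * N₂ - (2 * r + (2 * x₂ + 2 * x₂)) by ring,
      Real.rpow_sub hq, Real.rpow_add hq, Real.rpow_add hq, n, n, sq ((q ^ 2) ^ x₂)]
  have e2 : q ^ (-2 * (x₁ : ℝ) - 2 * (r + (2 * x₂ - N₂))) = θ / (q ^ 2) ^ x₁ := by
    rw [← e1, ← n x₁, ← Real.rpow_sub hq]; ring_nf
  have e3 : q ^ (-2 * (x₂ : ℝ) - 2 * r) = θ * (q ^ 2) ^ x₂ / (q ^ 2) ^ N₂ := by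
    rw [← e1, ← n x₂, ← n N₂, ← Real.rpow_add hq, ← Real.rpow_sub hq]; ring_nf
  have e4 : q ^ (-2 * (r + (2 * (x₂ : ℝ) - N₂)) + 2) = θ * q ^ 2 := by
    rw [← e1, Real.rpow_add hq, Real.rpow_two]
  rw [dynLeft, e1, e2, e3, e4]

/-- The coupled product of two dual `q`-Krawtchouk sums, without its conserved factors. -/
def krawtPair (Q ζ : ℝ) (N₁ N₂ n₁ n₂ x₁ x₂ : ℕ) : ℝ :=
  ((Q ^ x₂)⁻¹ ^ n₁ * krawtSum Q N₁ x₁ (-ζ * (Q ^ x₂) ^ 2 * Q ^ x₁ / (Q ^ N₂ * Q ^ N₁)) n₁)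
    * (1 ^ n₂ * krawtSum Q N₂ x₂ (-ζ * Q ^ x₂ / Q ^ N₂) n₂)

section Unit

variable {Q : ℝ} (hQ0 : 0 < Q) (hQ1 : Q < 1)
include hQ0 hQ1

theorem genSum_krawtPair_left (ζ : ℝ) {N₁ N₂ x₁ x₂ : ℕ} (h₁ : x₁ ≤ N₁) (t : ℝ) :
    genSum Q N₁ (fun n => (Q ^ x₂)⁻¹ ^ n
        * krawtSum Q N₁ x₁ (-ζ * (Q ^ x₂) ^ 2 * Q ^ x₁ / (Q ^ N₂ * Q ^ N₁)) n) t
      = qPoch (-ζ * (Q ^ x₂ / Q ^ N₂) * t) Q x₁ * qPoch (t / Q ^ x₂) Q (N₁ - x₁) := by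
  have p1 : Q ^ (N₁ - x₁) * Q ^ x₁ = Q ^ N₁ := by rw [← pow_add]; congr 1; omega
  have e1 := genSum_krawtSum hQ0 hQ1 h₁ (-ζ * (Q ^ x₂) ^ 2 * Q ^ x₁ / (Q ^ N₂ * Q ^ N₁))
    (Q ^ x₂)⁻¹ t
  have c1 : -ζ * (Q ^ x₂) ^ 2 * Q ^ x₁ / (Q ^ N₂ * Q ^ N₁) * (t * (Q ^ x₂)⁻¹ * Q ^ (N₁ - x₁))
      = -ζ * (Q ^ x₂ / Q ^ N₂) * t := by
    rw [← p1]; field_simp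
  rw [c1] at e1
  rw [div_eq_mul_inv t, ← e1]

theorem genSum_krawtPair_right (ζ : ℝ) {N₂ x₂ : ℕ} (h₂ : x₂ ≤ N₂) (s : ℝ) :
    genSum Q N₂ (fun n => 1 ^ n * krawtSum Q N₂ x₂ (-ζ * Q ^ x₂ / Q ^ N₂) n) s
      = qPoch (-ζ * s) Q x₂ * qPoch s Q (N₂ - x₂) := by
  have p2 : Q ^ (N₂ - x₂) * Q ^ x₂ = Q ^ N₂ := by rw [← pow_add]; congr 1; omega
  have e2 := genSum_krawtSum hQ0 hQ1 h₂ (-ζ * Q ^ x₂ / Q ^ N₂) 1 s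
  have c2 : -ζ * Q ^ x₂ / Q ^ N₂ * (s * 1 * Q ^ (N₂ - x₂)) = -ζ * s := by
    rw [← p2]; field_simp
  rw [c2, mul_one] at e2
  rw [← e2]

theorem sum_krawtPair (ζ : ℝ) {N₁ N₂ x₁ x₂ : ℕ} (h₁ : x₁ ≤ N₁) (h₂ : x₂ ≤ N₂) (t s : ℝ) :
    ∑ i ∈ Finset.range (N₁ + 1), ∑ j ∈ Finset.range (N₂ + 1),
        krawtWeight Q N₁ i * krawtWeight Q N₂ j * krawtPair Q ζ N₁ N₂ i j x₁ x₂ * (t ^ i * s ^ j)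
      = (qPoch (-ζ * (Q ^ x₂ / Q ^ N₂) * t) Q x₁ * qPoch (t / Q ^ x₂) Q (N₁ - x₁))
        * (qPoch (-ζ * s) Q x₂ * qPoch s Q (N₂ - x₂)) := by
  rw [← genSum_krawtPair_left hQ0 hQ1 ζ h₁, ← genSum_krawtPair_right hQ0 hQ1 ζ h₂, genSum, genSum,
    Finset.sum_mul_sum]
  refine Finset.sum_congr rfl fun i _ => Finset.sum_congr rfl fun j _ => ?_
  rw [krawtPair]
  ring

end Unit

/-- The generating function of the defect in the two-site duality relation. -/
def krawtBalance (Q κ c d : ℝ) (N₁ N₂ x₁ x₂ : ℕ) (ζ t s : ℝ) : ℝ :=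
  let Y₁ : ℕ → ℝ := fun n => (Q ^ x₂)⁻¹ ^ n
    * krawtSum Q N₁ x₁ (-ζ * (Q ^ x₂) ^ 2 * Q ^ x₁ / (Q ^ N₂ * Q ^ N₁)) n
  let Y₂ : ℕ → ℝ := fun n => 1 ^ n * krawtSum Q N₂ x₂ (-ζ * Q ^ x₂ / Q ^ N₂) n
  κ * ((-t * (genSum Q N₁ Y₁ (Q * t) - Q ^ N₁ * genSum Q N₁ Y₁ t))
        * (-(Q / s) * (genSum Q N₂ Y₂ (s / Q) - genSum Q N₂ Y₂ s))
      - (genSum Q N₁ Y₁ t - genSum Q N₁ Y₁ (Q * t))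
        * (genSum Q N₂ Y₂ s - Q ^ N₂ * genSum Q N₂ Y₂ (s / Q)))
    + κ * (Q * Q ^ N₁ * Q ^ N₂)
      * ((1 / (t * Q ^ N₁) * (genSum Q N₁ Y₁ t - genSum Q N₁ Y₁ (Q * t)))
          * (s / Q * (genSum Q N₂ Y₂ s - Q ^ N₂ * genSum Q N₂ Y₂ (s / Q)))
        - (genSum Q N₁ Y₁ t - 1 / Q ^ N₁ * genSum Q N₁ Y₁ (Q * t))
          * (genSum Q N₂ Y₂ s - 1 * genSum Q N₂ Y₂ (s / Q)))
    - c * ((∑ i ∈ Finset.range (N₁ + 1), ∑ j ∈ Finset.range (N₂ + 1), krawtWeight Q N₁ i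
        * krawtWeight Q N₂ j * krawtPair Q ζ N₁ N₂ i j (x₁ - 1) (x₂ + 1) * (t ^ i * s ^ j))
      - genSum Q N₁ Y₁ t * genSum Q N₂ Y₂ s)
    - d * ((∑ i ∈ Finset.range (N₁ + 1), ∑ j ∈ Finset.range (N₂ + 1), krawtWeight Q N₁ i
        * krawtWeight Q N₂ j * krawtPair Q ζ N₁ N₂ i j (x₁ + 1) (x₂ - 1) * (t ^ i * s ^ j))
      - genSum Q N₁ Y₁ t * genSum Q N₂ Y₂ s)

theorem krawtBalance_diag {Q X₂ M₁ M₂ P₁ P₂ τ₁ τ₂ : ℝ} (hX₂ : X₂ ≠ 0) (hM₁ : M₁ ≠ 0) (hM₂ : M₂ ≠ 0) (h₁ : τ₁ ≠ 0) (h₂ : τ₂ ≠ 0) (hQ : Q ≠ 0) :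
    (-(τ₁ * X₂) * (P₁ - M₁)) * (-(Q / (τ₂ * X₂ / M₂)) * (P₂ - 1)) - (1 - P₁) * (1 - M₂ * P₂)
      + Q * M₁ * M₂ * (1 / (τ₁ * X₂ * M₁) * (1 - P₁) * ((τ₂ * X₂ / M₂) / Q * (1 - M₂ * P₂))
        - (1 - 1 / M₁ * P₁) * (1 - 1 * P₂))
      = (τ₁ - τ₂) * (Q * M₂ * (P₁ - M₁) * (P₂ - 1) / τ₂ - (1 - M₂ * P₂) * (1 - P₁) / τ₁) := by
  field_simp
  ring

theorem krawtBalance_right {Q X₁ X₂ M₁ M₂ θ τ₁ τ₂ : ℝ} (hX₁ : X₁ ≠ 0) (hX₂ : X₂ ≠ 0) (hQ : Q ≠ 0) (n1 : θ + τ₁ ≠ 0) (n4 : Q - τ₂ ≠ 0) (n5 : 1 + θ ≠ 0) (n6 : Q + θ ≠ 0) :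
    (1 - X₁) * (1 - M₂ / X₂) * ((1 + θ * M₁ / X₁) * (1 + θ * X₂)) / ((1 + θ) * (1 + θ / Q))
      * ((Q - τ₁) * (θ + τ₂) / ((θ + τ₁) * (Q - τ₂)) - 1)
      = -(τ₁ - τ₂) * ((1 - X₁) * (1 - M₂ / X₂) * (1 + θ * M₁ / X₁) * (1 + θ * X₂) * Q
          / ((1 + θ) * (θ + τ₁) * (Q - τ₂))) := by
  field_simp
  ring

theorem krawtBalance_left {Q X₁ X₂ M₁ M₂ θ τ₁ τ₂ : ℝ} (hX₁ : X₁ ≠ 0) (hX₂ : X₂ ≠ 0) (hM₁ : M₁ ≠ 0) (hM₂ : M₂ ≠ 0) (n2 : 1 - τ₁ ≠ 0) (n3 : Q * θ + τ₂ ≠ 0)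
    (n5 : 1 + θ ≠ 0) (n7 : 1 + θ * Q ≠ 0) :
    (Q * M₁ * M₂) * (1 - 1 / X₂) * (1 - X₁ / M₁)
      * ((1 + θ / X₁) * (1 + θ * X₂ / M₂)) / ((1 + θ) * (1 + θ * Q))
      * ((θ * Q + τ₁) * (1 - τ₂) / ((1 - τ₁) * (Q * θ + τ₂)) - 1)
      = (τ₁ - τ₂) * (M₁ * M₂ * (1 - 1 / X₂) * (1 - X₁ / M₁) * (1 + θ / X₁) * (1 + θ * X₂ / M₂) * Q
          / ((1 + θ) * (1 - τ₁) * (Q * θ + τ₂))) := by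
  rw [mul_comm θ Q] at n7 ⊢
  field_simp
  ring

set_option maxHeartbeats 1000000 in
theorem krawtBalance_eq_zero {Q : ℝ} (hQ0 : 0 < Q) (hQ1 : Q < 1) (κ : ℝ) {c d ζ θ : ℝ}
    {N₁ N₂ x₁ x₂ : ℕ} (h₁ : x₁ ≤ N₁) (h₂ : x₂ ≤ N₂) (hζ : 0 < ζ)
    (hθ : θ = Q ^ N₂ / (ζ * (Q ^ x₂) ^ 2))
    (hc : c = κ * (1 - Q ^ x₁) * (1 - Q ^ N₂ / Q ^ x₂)
      * ((1 + θ * Q ^ N₁ / Q ^ x₁) * (1 + θ * Q ^ x₂)) / ((1 + θ) * (1 + θ / Q)))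
    (hd : d = κ * (Q * Q ^ N₁ * Q ^ N₂) * (1 - 1 / Q ^ x₂) * (1 - Q ^ x₁ / Q ^ N₁)
      * ((1 + θ / Q ^ x₁) * (1 + θ * Q ^ x₂ / Q ^ N₂)) / ((1 + θ) * (1 + θ * Q)))
    {t s : ℝ} (ht : 0 < t) (ht' : t < Q ^ (N₂ + 1)) (hs : 0 < s) (hs' : s < Q ^ (N₂ + 1)) :
    krawtBalance Q κ c d N₁ N₂ x₁ x₂ ζ t s = 0 := by
  have hθ0 : 0 < θ := by rw [hθ]; positivity
  have hq : Q ≠ 0 := hQ0.ne'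
  obtain ⟨τ₁, hτ₁⟩ : ∃ τ, τ = t / Q ^ x₂ := ⟨_, rfl⟩
  obtain ⟨τ₂, hτ₂⟩ : ∃ τ, τ = s * Q ^ N₂ / Q ^ x₂ := ⟨_, rfl⟩
  have hτ₁0 : 0 < τ₁ := by rw [hτ₁]; positivity
  have hτ₂0 : 0 < τ₂ := by rw [hτ₂]; positivity
  have hX₂ : Q ^ N₂ ≤ Q ^ x₂ := pow_le_pow_of_le_one hQ0.le hQ1.le h₂
  have hτ₁1 : τ₁ < 1 := by
    rw [hτ₁, div_lt_one (by positivity)]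
    refine ht'.trans_le (le_trans ?_ hX₂)
    exact pow_le_pow_of_le_one hQ0.le hQ1.le (Nat.le_succ _)
  have hτ₂1 : τ₂ < Q := by
    have h1 : s < Q := hs'.trans_le (pow_le_of_le_one hQ0.le hQ1.le (Nat.succ_ne_zero _))
    rw [hτ₂, div_lt_iff₀ (by positivity)]
    exact mul_lt_mul h1 hX₂ (by positivity) hQ0.le
  have et : t = τ₁ * Q ^ x₂ := by rw [hτ₁]; field_simp
  have es : s = τ₂ * Q ^ x₂ / Q ^ N₂ := by rw [hτ₂]; field_simp
  have eA : -ζ * (Q ^ x₂ / Q ^ N₂) * t = -(τ₁ / θ) := by rw [hτ₁, hθ]; field_simp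
  have eB : -ζ * s = -(τ₂ / (θ * Q ^ x₂)) := by rw [hτ₂, hθ]; field_simp
  set G₁ := qPoch (-(τ₁ / θ)) Q x₁ * qPoch τ₁ Q (N₁ - x₁) with hG₁
  set G₂ := qPoch (-(τ₂ / (θ * Q ^ x₂))) Q x₂ * qPoch (τ₂ * Q ^ x₂ / Q ^ N₂) Q (N₂ - x₂) with hG₂
  have n1 : θ + τ₁ ≠ 0 := by positivity
  have n2 : 1 - τ₁ ≠ 0 := by linarith
  have n3 : Q * θ + τ₂ ≠ 0 := by positivity
  have n4 : Q - τ₂ ≠ 0 := by linarith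
  have n5 : 1 + θ ≠ 0 := by positivity
  have n6 : Q + θ ≠ 0 := by positivity
  have n7 : 1 + θ * Q ≠ 0 := by positivity
  have pN₁ : Q ^ (N₁ - x₁) * Q ^ x₁ = Q ^ N₁ := by rw [← pow_add]; congr 1; omega
  have pN₂ : Q ^ (N₂ - x₂) * Q ^ x₂ = Q ^ N₂ := by rw [← pow_add]; congr 1; omega
  obtain ⟨P₁, hP₁⟩ : ∃ P, P = (θ + τ₁ * Q ^ x₁) * (1 - τ₁ * Q ^ N₁ / Q ^ x₁)
    / ((θ + τ₁) * (1 - τ₁)) := ⟨_, rfl⟩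
  obtain ⟨P₂, hP₂⟩ : ∃ P, P = (Q * θ + τ₂ / Q ^ x₂) * (Q - τ₂ * Q ^ x₂ / Q ^ N₂)
    / ((Q * θ + τ₂) * (Q - τ₂)) := ⟨_, rfl⟩
  have hP₁' : P₁ * ((θ + τ₁) * (1 - τ₁)) = (θ + τ₁ * Q ^ x₁) * (1 - τ₁ * Q ^ N₁ / Q ^ x₁) := by
    rw [hP₁]; field_simp
  have hP₂' : P₂ * ((Q * θ + τ₂) * (Q - τ₂))
      = (Q * θ + τ₂ / Q ^ x₂) * (Q - τ₂ * Q ^ x₂ / Q ^ N₂) := by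
    rw [hP₂]; field_simp
  have g1 : qPoch (-ζ * (Q ^ x₂ / Q ^ N₂) * t) Q x₁ * qPoch (t / Q ^ x₂) Q (N₁ - x₁) = G₁ := by
    rw [eA, ← hτ₁]
  have g2 : qPoch (-ζ * s) Q x₂ * qPoch s Q (N₂ - x₂) = G₂ := by
    rw [eB, hG₂, ← es]
  have g1' : qPoch (-ζ * (Q ^ x₂ / Q ^ N₂) * (Q * t)) Q x₁ * qPoch (Q * t / Q ^ x₂) Q (N₁ - x₁)
      = P₁ * G₁ := by
    have e1 : -ζ * (Q ^ x₂ / Q ^ N₂) * (Q * t) = -(τ₁ / θ) * Q := by rw [← eA]; ring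
    have e2 : Q * t / Q ^ x₂ = τ₁ * Q := by rw [hτ₁]; ring
    have f1 := qPoch_mul_left (Q := Q) (-(τ₁ / θ)) x₁
    have f2 := qPoch_mul_left (Q := Q) τ₁ (N₁ - x₁)
    have m1 : 1 - -(τ₁ / θ) = (θ + τ₁) / θ := by field_simp; ring
    rw [m1] at f1
    rw [e1, e2]
    have key : ((θ + τ₁) * (1 - τ₁)) ≠ 0 := mul_ne_zero n1 n2
    apply mul_right_cancel₀ key
    rw [mul_right_comm P₁, hP₁', hG₁]
    calc _ = θ * (qPoch (-(τ₁ / θ) * Q) Q x₁ * ((θ + τ₁) / θ))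
          * (qPoch (τ₁ * Q) Q (N₁ - x₁) * (1 - τ₁)) := by field_simp
      _ = _ := by rw [f1, f2, ← pN₁]; field_simp; ring
  have g2' : qPoch (-ζ * (s / Q)) Q x₂ * qPoch (s / Q) Q (N₂ - x₂) = P₂ * G₂ := by
    have f1 := qPoch_mul_left (Q := Q) (-(τ₂ / (θ * Q ^ x₂)) / Q) x₂
    have f2 := qPoch_mul_left (Q := Q) (s / Q) (N₂ - x₂)
    rw [div_mul_cancel₀ _ hq] at f1 f2
    have e1 : -ζ * (s / Q) = -(τ₂ / (θ * Q ^ x₂)) / Q := by rw [← eB]; ring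
    rw [e1]
    have m1 : 1 - -(τ₂ / (θ * Q ^ x₂)) / Q * Q ^ x₂ = (Q * θ + τ₂) / (Q * θ) := by
      field_simp; ring
    have m2 : 1 - s / Q * Q ^ (N₂ - x₂) = (Q - τ₂) / Q := by
      rw [es, ← pN₂]; field_simp
    have m3 : 1 - -(τ₂ / (θ * Q ^ x₂)) / Q = (Q * θ + τ₂ / Q ^ x₂) / (Q * θ) := by
      field_simp; ring
    have m4 : 1 - s / Q = (Q - s) / Q := by field_simp
    rw [m1, m3] at f1
    rw [m2, m4] at f2
    have key : ((Q * θ + τ₂) * (Q - τ₂)) ≠ 0 := mul_ne_zero n3 n4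
    apply mul_right_cancel₀ key
    rw [mul_right_comm P₂, hP₂', hG₂, ← es]
    calc _ = (Q * θ) * Q * (qPoch (-(τ₂ / (θ * Q ^ x₂)) / Q) Q x₂ * ((Q * θ + τ₂) / (Q * θ)))
          * (qPoch (s / Q) Q (N₂ - x₂) * ((Q - τ₂) / Q)) := by field_simp
      _ = (Q * θ) * Q * (qPoch (-(τ₂ / (θ * Q ^ x₂))) Q x₂ * ((Q * θ + τ₂ / Q ^ x₂) / (Q * θ)))
          * (qPoch s Q (N₂ - x₂) * ((Q - s) / Q)) := by rw [← f1, ← f2]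
      _ = _ := by field_simp
  have gR : c * (∑ i ∈ Finset.range (N₁ + 1), ∑ j ∈ Finset.range (N₂ + 1), krawtWeight Q N₁ i
        * krawtWeight Q N₂ j * krawtPair Q ζ N₁ N₂ i j (x₁ - 1) (x₂ + 1) * (t ^ i * s ^ j))
      = c * (G₁ * G₂ * ((Q - τ₁) * (θ + τ₂) / ((θ + τ₁) * (Q - τ₂)))) := by
    rcases Nat.eq_zero_or_pos x₁ with h0 | hpos
    · have : c = 0 := by rw [hc, h0]; simp
      rw [this, zero_mul, zero_mul]
    rcases h₂.eq_or_lt with h0 | hlt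
    · have : c = 0 := by rw [hc, h0, div_self (pow_ne_zero _ hq)]; simp
      rw [this, zero_mul, zero_mul]
    obtain ⟨x, rfl⟩ : ∃ x, x₁ = x + 1 := ⟨x₁ - 1, by omega⟩
    obtain ⟨k, hk⟩ : ∃ k, N₂ - x₂ = k + 1 := ⟨N₂ - x₂ - 1, by omega⟩
    have k1 : N₁ - x = N₁ - (x + 1) + 1 := by omega
    have k2 : N₂ - (x₂ + 1) = k := by omega
    have p2 : Q ^ k * Q * Q ^ x₂ = Q ^ N₂ := by rw [← pN₂, hk, pow_succ]
    have e1 : -ζ * (Q ^ (x₂ + 1) / Q ^ N₂) * t = -(τ₁ / θ) * Q := by rw [← eA]; ring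
    have e2 : t / Q ^ (x₂ + 1) = τ₁ / Q := by rw [hτ₁, pow_succ]; field_simp
    have m1 : 1 - -(τ₁ / θ) = (θ + τ₁) / θ := by field_simp; ring
    have m2 : 1 - -(τ₂ / (θ * Q ^ x₂)) * Q ^ x₂ = (θ + τ₂) / θ := by field_simp; ring
    have m3 : 1 - τ₂ * Q ^ x₂ / Q ^ N₂ * Q ^ k = (Q - τ₂) / Q := by rw [← p2]; field_simp
    have m4 : 1 - τ₁ / Q = (Q - τ₁) / Q := by field_simp
    rw [add_tsub_cancel_right, sum_krawtPair hQ0 hQ1 ζ (by omega) (by omega), e1, e2, eB, es, hG₁,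
      hG₂, k1, k2, hk, qPoch_succ' (τ₁ / Q), div_mul_cancel₀ _ hq, qPoch_succ' (-(τ₁ / θ)),
      qPoch_succ _ _ x₂, qPoch_succ _ _ k, m1, m2, m3, m4]
    field_simp
  have gL : d * (∑ i ∈ Finset.range (N₁ + 1), ∑ j ∈ Finset.range (N₂ + 1), krawtWeight Q N₁ i
        * krawtWeight Q N₂ j * krawtPair Q ζ N₁ N₂ i j (x₁ + 1) (x₂ - 1) * (t ^ i * s ^ j))
      = d * (G₁ * G₂ * ((θ * Q + τ₁) * (1 - τ₂) / ((1 - τ₁) * (Q * θ + τ₂)))) := by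
    rcases Nat.eq_zero_or_pos x₂ with h0 | hpos
    · have : d = 0 := by rw [hd, h0]; simp
      rw [this, zero_mul, zero_mul]
    rcases h₁.eq_or_lt with h0 | hlt
    · have : d = 0 := by rw [hd, h0, div_self (pow_ne_zero _ hq)]; simp
      rw [this, zero_mul, zero_mul]
    obtain ⟨x, rfl⟩ : ∃ x, x₂ = x + 1 := ⟨x₂ - 1, by omega⟩
    obtain ⟨k, hk⟩ : ∃ k, N₁ - x₁ = k + 1 := ⟨N₁ - x₁ - 1, by omega⟩
    have k1 : N₁ - (x₁ + 1) = k := by omega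
    have k2 : N₂ - x = N₂ - (x + 1) + 1 := by omega
    have e1 : -ζ * (Q ^ x / Q ^ N₂) * t = -(τ₁ / θ) / Q := by rw [← eA, pow_succ]; field_simp
    have e2 : t / Q ^ x = τ₁ * Q := by rw [hτ₁, pow_succ]; field_simp
    have m1 : 1 - -(τ₁ / θ) / Q = (θ * Q + τ₁) / (θ * Q) := by field_simp; ring
    have m2 : 1 - -(τ₂ / (θ * Q ^ (x + 1))) * Q ^ x = (Q * θ + τ₂) / (Q * θ) := by
      rw [pow_succ]; field_simp; ring
    have m3 : 1 - τ₂ * Q ^ (x + 1) / Q ^ N₂ * Q ^ (N₂ - (x + 1)) = 1 - τ₂ := by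
      rw [← pN₂]; field_simp
    rw [add_tsub_cancel_right, sum_krawtPair hQ0 hQ1 ζ (by omega) (by omega), e1, e2, eB, es, hG₁,
      hG₂, k1, k2, hk, qPoch_succ' (-(τ₁ / θ) / Q), div_mul_cancel₀ _ hq, qPoch_succ' τ₁,
      qPoch_succ _ _ x, qPoch_succ _ _ (N₂ - (x + 1)), m1, m2, m3]
    field_simp
  have core := krawtSum_core_identity (Q := Q) (pow_ne_zero x₁ hq) (pow_ne_zero x₂ hq)
    (pow_ne_zero N₁ hq) (pow_ne_zero N₂ hq) hτ₁0.ne' hτ₂0.ne' n5 n1 n2 n3 n4 hP₁' hP₂'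
  rw [krawtBalance]
  simp only [genSum_krawtPair_left hQ0 hQ1 ζ h₁, genSum_krawtPair_right hQ0 hQ1 ζ h₂]
  rw [mul_sub c, mul_sub d, gR, gL, g1, g2, g1', g2', hc, hd, et, es]
  clear gR gL g1 g2 g1' g2' hG₁ hG₂ hP₁ hP₂ hP₁' hP₂' eA eB et es hτ₁ hτ₂ hX₂ pN₁ pN₂ hc hd hθ
  have hX₁ := pow_ne_zero x₁ hq
  have hX₂ := pow_ne_zero x₂ hq
  have hM₁ := pow_ne_zero N₁ hq
  have hM₂ := pow_ne_zero N₂ hq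
  clear_value G₁ G₂
  generalize Q ^ x₁ = X₁ at *
  generalize Q ^ x₂ = X₂ at *
  generalize Q ^ N₁ = M₁ at *
  generalize Q ^ N₂ = M₂ at *
  have r1 := krawtBalance_diag (P₁ := P₁) (P₂ := P₂) hX₂ hM₁ hM₂ hτ₁0.ne' hτ₂0.ne' hq
  have r2 := krawtBalance_right (M₁ := M₁) (M₂ := M₂) hX₁ hX₂ hq n1 n4 n5 n6
  have r3 := krawtBalance_left hX₁ hX₂ hM₁ hM₂ n2 n3 n5 n7
  linear_combination (κ * G₁ * G₂) * (r1 - r2 - r3 + (τ₁ - τ₂) * core)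

/-- The two-site duality between ASEP and dynamic ASEP. -/
theorem krawtPair_twoSiteDual {q : ℝ} (hq0 : 0 < q) (hq1 : q < 1) (N₁ N₂ : ℕ) (r : ℝ) :
    TwoSiteDual N₁ N₂ (asepRight q N₁ N₂) (asepLeft q N₁ N₂) (dynRight q N₁ N₂ r)
      (dynLeft q N₁ N₂ r) (krawtPair (q ^ 2) (q ^ (2 * r)) N₁ N₂) := by
  intro n₁ n₂ x₁ x₂ hn₁ hn₂ hx₁ hx₂
  have hQ0 : 0 < q ^ 2 := by positivity
  have hQ1 : q ^ 2 < 1 := pow_lt_one₀ hq0.le hq1 two_ne_zero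
  have hζ : 0 < q ^ (2 * r) := Real.rpow_pos_of_pos hq0 _
  rw [← sub_eq_zero]
  have hw₁ := krawtWeight_ne_zero hQ0 hQ1 hn₁
  have hw₂ := krawtWeight_ne_zero hQ0 hQ1 hn₂
  refine (mul_eq_zero.1 ?_).resolve_left (mul_ne_zero hw₁ hw₂)
  set θ := (q ^ 2) ^ N₂ / (q ^ (2 * r) * ((q ^ 2) ^ x₂) ^ 2) with hθ
  have dR := dynRight_eq hq0 N₁ N₂ r x₁ x₂ hθ
  have dL := dynLeft_eq hq0 N₁ N₂ r x₁ x₂ hθ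
  have hθ0 : 0 < θ := by positivity
  set T := krawtPair (q ^ 2) (q ^ (2 * r)) N₁ N₂ with hT
  set c' := dynRight q N₁ N₂ r x₁ x₂
  set d' := dynLeft q N₁ N₂ r x₁ x₂
  let a : ℕ → ℕ → ℝ := fun n₁ n₂ => krawtWeight (q ^ 2) N₁ n₁ * krawtWeight (q ^ 2) N₂ n₂
    * (asepRight q N₁ N₂ n₁ n₂ * (T (n₁ - 1) (n₂ + 1) x₁ x₂ - T n₁ n₂ x₁ x₂)
      + asepLeft q N₁ N₂ n₁ n₂ * (T (n₁ + 1) (n₂ - 1) x₁ x₂ - T n₁ n₂ x₁ x₂)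
      - (c' * (T n₁ n₂ (x₁ - 1) (x₂ + 1) - T n₁ n₂ x₁ x₂)
        + d' * (T n₁ n₂ (x₁ + 1) (x₂ - 1) - T n₁ n₂ x₁ x₂)))
  change a n₁ n₂ = 0
  refine coeff_eq_zero_of_sum_sum_eq_zero (pow_pos hQ0 (N₂ + 1)) (I := N₁ + 1) (J := N₂ + 1)
    (fun t s ht ht' hs hs' => ?_) (Nat.lt_succ_of_le hn₁) (Nat.lt_succ_of_le hn₂)
  set α := ((q - q⁻¹) ^ 2)⁻¹ with hα
  set κ := α * (q * q ^ N₁ * q ^ N₂)⁻¹ with hκ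
  have hκ' : α * (q * q ^ N₁ * q ^ N₂) = κ * (q ^ 2 * (q ^ 2) ^ N₁ * (q ^ 2) ^ N₂) := by
    rw [hκ, ← pow_mul, ← pow_mul, mul_comm 2, mul_comm 2, pow_mul, pow_mul]
    field_simp
  have cR : ∀ i j, asepRight q N₁ N₂ i j = κ * (1 - (q ^ 2) ^ i) * (1 - (q ^ 2) ^ N₂ / (q ^ 2) ^ j) :=
    fun i j => asepRight_eq hq0 hq1.ne N₁ N₂ i j
  have cL : ∀ i j, asepLeft q N₁ N₂ i j = κ * (q ^ 2 * (q ^ 2) ^ N₁ * (q ^ 2) ^ N₂)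
      * (1 - 1 / (q ^ 2) ^ j) * (1 - (q ^ 2) ^ i / (q ^ 2) ^ N₁) := by
    intro i j
    rw [← hκ']; exact asepLeft_eq hq0 hq1.ne N₁ N₂ i j
  set ζ := q ^ (2 * r)
  set Q := q ^ 2 with hQ
  rw [cR] at dR
  rw [cL] at dL
  clear_value c' d' κ α ζ Q
  have hsum : ∑ i ∈ Finset.range (N₁ + 1), ∑ j ∈ Finset.range (N₂ + 1), a i j * (t ^ i * s ^ j)
      = krawtBalance Q κ c' d' N₁ N₂ x₁ x₂ ζ t s := by
    set Y₁ : ℕ → ℝ := fun n => (Q ^ x₂)⁻¹ ^ n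
      * krawtSum Q N₁ x₁ (-ζ * (Q ^ x₂) ^ 2 * Q ^ x₁ / (Q ^ N₂ * Q ^ N₁)) n with hY₁
    set Y₂ : ℕ → ℝ := fun n => 1 ^ n * krawtSum Q N₂ x₂ (-ζ * Q ^ x₂ / Q ^ N₂) n with hY₂
    have hTY : ∀ i j, T i j x₁ x₂ = Y₁ i * Y₂ j := fun i j => by rw [hT]; rfl
    rw [krawtBalance, ← hY₁, ← hY₂, ← hT]
    rw [← genSum_lower hQ0 hQ1, ← genSum_upper hQ0 hQ1 _ _ hs.ne', ← genSum_lower' hQ0 hQ1,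
      ← genSum_upper' hQ0 hQ1 _ _ ht.ne', ← genSum_diag, ← genSum_diag', ← genSum_diag',
      ← genSum_diag'', genSum, genSum]
    rw [Finset.sum_mul_sum, Finset.sum_mul_sum, Finset.sum_mul_sum, Finset.sum_mul_sum,
      Finset.sum_mul_sum]
    simp only [Finset.mul_sum, ← Finset.sum_sub_distrib, ← Finset.sum_add_distrib]
    refine Finset.sum_congr rfl fun i _ => Finset.sum_congr rfl fun j _ => ?_
    simp only [a, hTY, cR, cL, ← hQ]
    ring
  rw [hsum]
  exact krawtBalance_eq_zero hQ0 hQ1 κ hx₁ hx₂ hζ hθ dR dL ht ht' hs hs'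

end

end QASEP

namespace QASEP

noncomputable section

open Filter Topology

theorem qHyp_eq_sum {as bs : List ℝ} {Q z : ℝ} (hQ : Q ≠ 0) {x : ℕ} (h : (Q ^ x)⁻¹ ∈ as) :
    qHyp as bs Q z = ∑ n ∈ Finset.range (x + 1),
      (as.map fun a => qPoch a Q n).prod / (bs.map fun b => qPoch b Q n).prod
        * (z ^ n / qPoch Q Q n) := by
  refine tsum_eq_sum fun n hn => ?_
  have h0 : (as.map fun a => qPoch a Q n).prod = 0 := by
    refine List.prod_eq_zero (List.mem_map.2 ⟨_, h, qPoch_inv_pow_eq_zero hQ ?_⟩)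
    simpa [Nat.lt_succ_iff] using hn
  rw [h0, zero_div, zero_mul]

theorem rpow_neg_natCast' {Q : ℝ} (hQ : 0 < Q) (n : ℕ) : Q ^ (-(n : ℝ)) = (Q ^ n)⁻¹ := by
  rw [Real.rpow_neg hQ.le, Real.rpow_natCast]

theorem krawtchouk_eq {Q : ℝ} (hQ : 0 < Q) (n x : ℕ) (c : ℝ) (N : ℕ) :
    krawtchouk n x c N Q = krawtSum Q N x (-c * Q ^ x / Q ^ N) n := by
  simp only [krawtchouk, rpow_neg_natCast' hQ]
  rw [qHyp_eq_sum hQ.ne' (x := x) (by simp), Real.rpow_sub hQ, Real.rpow_natCast,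
    Real.rpow_natCast, krawtSum]
  refine Finset.sum_congr rfl fun j _ => ?_
  simp only [List.map_cons, List.map_nil, List.prod_cons, List.prod_nil, qPoch_zero_left, hahnTerm]
  rw [mul_div_assoc (-c)]
  ring

theorem qHahn_eq {Q : ℝ} (hQ : 0 < Q) (x n : ℕ) (α β : ℝ) (N : ℕ) :
    qHahn x n α β N Q = ∑ j ∈ Finset.range (x + 1),
      hahnTerm Q N x (α * β * Q * Q ^ x) j * qPoch (Q ^ n)⁻¹ Q j / qPoch (α * Q) Q j := by
  simp only [qHahn, rpow_neg_natCast' hQ]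
  rw [qHyp_eq_sum hQ.ne' (x := x) (by simp), Real.rpow_add hQ, Real.rpow_natCast, Real.rpow_one]
  refine Finset.sum_congr rfl fun j _ => ?_
  simp only [List.map_cons, List.map_nil, List.prod_cons, List.prod_nil, hahnTerm]
  rw [mul_comm (Q ^ x) Q, mul_assoc _ Q]
  ring

theorem quantumKrawtchouk_eq {Q : ℝ} (hQ : 0 < Q) (x n : ℕ) (p : ℝ) (N : ℕ) :
    quantumKrawtchouk x n p N Q = ∑ j ∈ Finset.range (x + 1),
      qPoch (Q ^ x)⁻¹ Q j * qPoch (Q ^ n)⁻¹ Q j / (qPoch (Q ^ N)⁻¹ Q j * qPoch Q Q j)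
        * (p * Q * Q ^ x) ^ j := by
  simp only [quantumKrawtchouk, rpow_neg_natCast' hQ]
  rw [qHyp_eq_sum hQ.ne' (x := x) (by simp), Real.rpow_add hQ, Real.rpow_natCast, Real.rpow_one]
  refine Finset.sum_congr rfl fun j _ => ?_
  simp only [List.map_cons, List.map_nil, List.prod_cons, List.prod_nil]
  rw [mul_comm (Q ^ x) Q, mul_assoc _ Q]
  ring

theorem affineKrawtchouk_eq {Q : ℝ} (hQ : 0 < Q) (x n : ℕ) (p : ℝ) (N : ℕ) :
    affineKrawtchouk x n p N Q = ∑ j ∈ Finset.range (x + 1),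
      hahnTerm Q N x 0 j * qPoch (Q ^ n)⁻¹ Q j / qPoch (p * Q) Q j := by
  simp only [affineKrawtchouk, rpow_neg_natCast' hQ]
  rw [qHyp_eq_sum hQ.ne' (x := x) (by simp)]
  refine Finset.sum_congr rfl fun j _ => ?_
  simp only [List.map_cons, List.map_nil, List.prod_cons, List.prod_nil, qPoch_zero_left, hahnTerm]
  ring

theorem siteKrawtchouk_eq {q : ℝ} (hq : 0 < q) (n x : ℕ) (r : ℝ) (N : ℕ) :
    siteKrawtchouk n x r N q = (-1) ^ n * q ^ ((n : ℝ) * (((N : ℝ) - 1) / 2 - r))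
      * krawtSum (q ^ 2) N x (-q ^ (2 * r) * (q ^ 2) ^ x / (q ^ 2) ^ N) n := by
  rw [siteKrawtchouk, krawtchouk_eq (by positivity), mul_assoc ((-1) ^ n), ← Real.rpow_add hq]
  congr 3
  ring

section Weight

variable {m : ℕ} (N : Fin (m + 1) → ℕ)

/-- The coefficient of `η_k` in `u(η)`. -/
def siteExp (k : Fin (m + 1)) : ℝ := N k - 2 * ∑ j ∈ Finset.Iic k, (N j : ℝ)

theorem siteExp_succ (k : Fin m) :
    siteExp N k.succ = siteExp N k.castSucc - (N k.castSucc + N k.succ) := by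
  have h : Finset.Iic k.succ = insert k.succ (Finset.Iic k.castSucc) := by
    ext j
    simp only [Finset.mem_Iic, Finset.mem_insert, Fin.le_def, Fin.ext_iff, Fin.val_succ,
      Fin.val_castSucc]
    omega
  have hn : k.succ ∉ Finset.Iic k.castSucc := by
    simp [Fin.le_def]
  rw [siteExp, siteExp, h, Finset.sum_insert hn]
  ring

theorem rpow_uExp_mul {q : ℝ} (hq : 0 < q) (s : ℝ) (η : Config N) :
    q ^ (uExp N η * s) = ∏ k, q ^ ((η k : ℕ) * siteExp N k * s) := by
  rw [← Real.rpow_sum_of_pos hq, uExp, Finset.sum_mul]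
  congr 1
  refine Finset.sum_congr rfl fun k _ => ?_
  rw [siteExp, occ]
  ring

/-- The one-site factor of `dualKR`. -/
def siteKR (q : ℝ) (k : Fin (m + 1)) (n x : ℕ) (_l r : ℝ) : ℝ :=
  q ^ ((n : ℝ) * siteExp N k * (-1 / 2)) * siteKrawtchouk n x r (N k) q

theorem dualKR_eq {q : ℝ} (hq : 0 < q) (ρ : ℝ) : dualKR N q ρ = heightProd (siteKR N q) ρ := by
  funext η ξ
  rw [dualKR, show -(uExp N η) / 2 = uExp N η * (-1 / 2) by ring, rpow_uExp_mul N hq,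
    ← Finset.prod_mul_distrib]
  rfl

theorem twoSite_siteKR {q : ℝ} (hq : 0 < q) (k : Fin m) (l r : ℝ) :
    twoSite N (siteKR N q) k l r = fun n₁ n₂ x₁ x₂ =>
      (-1) ^ (n₁ + n₂) * q ^ (((n₁ + n₂ : ℕ) : ℝ)
          * (-siteExp N k.castSucc / 2 - r - 1 / 2 + N k.castSucc / 2 + N k.succ))
        * krawtPair (q ^ 2) (q ^ (2 * r)) (N k.castSucc) (N k.succ) n₁ n₂ x₁ x₂ := by
  funext n₁ n₂ x₁ x₂
  have n := rpow_two_mul_natCast hq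
  have e1 : q ^ (2 * (r + (2 * (x₂ : ℝ) - N k.succ)))
      = q ^ (2 * r) * ((q ^ 2) ^ x₂) ^ 2 / (q ^ 2) ^ N k.succ := by
    rw [show 2 * (r + (2 * (x₂ : ℝ) - N k.succ)) = 2 * r + (2 * x₂ + 2 * x₂) - 2 * N k.succ by ring,
      Real.rpow_sub hq, Real.rpow_add hq, Real.rpow_add hq, n, n, sq ((q ^ 2) ^ x₂)]
  have e2 : ((q ^ 2) ^ x₂)⁻¹ ^ n₁ = q ^ (-(2 * x₂ * n₁ : ℝ)) := by
    rw [← n, ← Real.rpow_neg hq.le, ← Real.rpow_mul_natCast hq.le]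
    congr 1
    ring
  have e3 : -(q ^ (2 * r) * ((q ^ 2) ^ x₂) ^ 2 / (q ^ 2) ^ N k.succ) * (q ^ 2) ^ x₁
        / (q ^ 2) ^ N k.castSucc
      = -q ^ (2 * r) * ((q ^ 2) ^ x₂) ^ 2 * (q ^ 2) ^ x₁
        / ((q ^ 2) ^ N k.succ * (q ^ 2) ^ N k.castSucc) := by
    field_simp
  have e4 : q ^ ((n₁ : ℝ) * siteExp N k.castSucc * (-1 / 2))
        * q ^ ((n₁ : ℝ) * (((N k.castSucc : ℝ) - 1) / 2 - (r + (2 * x₂ - N k.succ))))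
        * (q ^ ((n₂ : ℝ) * siteExp N k.succ * (-1 / 2))
          * q ^ ((n₂ : ℝ) * (((N k.succ : ℝ) - 1) / 2 - r)))
      = q ^ (((n₁ + n₂ : ℕ) : ℝ)
          * (-siteExp N k.castSucc / 2 - r - 1 / 2 + N k.castSucc / 2 + N k.succ))
        * q ^ (-(2 * x₂ * n₁ : ℝ)) := by
    simp only [← Real.rpow_add hq]
    congr 1
    rw [siteExp_succ]
    push_cast
    ring
  simp only [twoSite, siteKR, siteKrawtchouk_eq hq, krawtPair, e1, e2, e3, one_pow]
  rw [pow_add]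
  linear_combination (krawtSum (q ^ 2) (N k.castSucc) x₁ (-q ^ (2 * r) * ((q ^ 2) ^ x₂) ^ 2
    * (q ^ 2) ^ x₁ / ((q ^ 2) ^ N k.succ * (q ^ 2) ^ N k.castSucc)) n₁
    * krawtSum (q ^ 2) (N k.succ) x₂ (-q ^ (2 * r) * (q ^ 2) ^ x₂ / (q ^ 2) ^ N k.succ) n₂
    * ((-1) ^ n₁ * (-1) ^ n₂)) * e4

/-- `K_R` is a duality function between ASEP and dynamic ASEP. -/
theorem isDuality_dualKR {q : ℝ} (hq0 : 0 < q) (hq1 : q < 1) (ρ : ℝ) :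
    IsDuality (genASEP N q) (genASEPR N q ρ) (dualKR N q ρ) := by
  rw [genASEP_eq N q 0, genASEPR_eq, dualKR_eq N hq0]
  refine isDuality_heightProd (fun k _ => asep_admissible hq0 hq1.ne _ _)
    (fun k r => dyn_admissible hq0 hq1.ne _ _ r) _ _ _ fun k l r r' => ?_
  rw [twoSite_siteKR N hq0]
  exact (krawtPair_twoSiteDual hq0 hq1 _ _ r).conserved (asep_admissible hq0 hq1.ne _ _)
    (dyn_admissible hq0 hq1.ne _ _ r) fun a _ => (-1) ^ a * q ^ ((a : ℝ)
      * (-siteExp N k.castSucc / 2 - r - 1 / 2 + N k.castSucc / 2 + N k.succ))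

/-- The one-site factor of the reversible measure. -/
def siteWeight (q : ℝ) (k : Fin (m + 1)) (n : ℕ) : ℝ :=
  q ^ ((n : ℝ) * siteExp N k) * (q ^ ((n : ℝ) * ((n : ℝ) - N k)) * gauss (q ^ 2) (N k) n)

theorem weight_eq {q : ℝ} (hq : 0 < q) (η : Config N) :
    weight N q η = ∏ k, siteWeight N q k (η k) := by
  have := rpow_uExp_mul N hq 1 η
  simp only [mul_one] at this
  rw [weight, this, ← Finset.prod_mul_distrib]
  refine Finset.prod_congr rfl fun k _ => ?_
  rw [siteWeight, gauss, if_pos (val_le η k), occ]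

theorem siteWeight_succ {q : ℝ} (hq0 : 0 < q) (hq1 : q < 1) (k : Fin (m + 1)) {n : ℕ}
    (h : n ≤ N k) :
    siteWeight N q k (n + 1) * (1 - (q ^ 2) ^ (n + 1))
      = siteWeight N q k n * (q ^ siteExp N k * q ^ (2 * n + 1) / q ^ N k
        * (1 - (q ^ 2) ^ N k / (q ^ 2) ^ n)) := by
  have e : q ^ (((n + 1 : ℕ) : ℝ) * siteExp N k) * q ^ (((n + 1 : ℕ) : ℝ) * (((n + 1 : ℕ) : ℝ) - N k))
      = q ^ ((n : ℝ) * siteExp N k) * q ^ ((n : ℝ) * ((n : ℝ) - N k))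
        * (q ^ siteExp N k * q ^ (2 * n + 1) / q ^ N k) := by
    rw [← Real.rpow_natCast q (2 * n + 1), ← Real.rpow_natCast q (N k)]
    simp only [← Real.rpow_add hq0, ← Real.rpow_sub hq0]
    congr 1
    push_cast
    ring
  have g := gauss_succ_right (Q := q ^ 2) (by positivity) (pow_lt_one₀ hq0.le hq1 two_ne_zero) h
  have p : (q ^ 2) ^ (N k - n) = (q ^ 2) ^ N k / (q ^ 2) ^ n := pow_sub₀ _ (by positivity) h
  rw [p] at g
  rw [siteWeight, siteWeight]
  linear_combination (q ^ ((n : ℝ) * siteExp N k) * q ^ ((n : ℝ) * ((n : ℝ) - N k))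
        * (q ^ siteExp N k * q ^ (2 * n + 1) / q ^ N k)) * g
    + gauss (q ^ 2) (N k) (n + 1) * (1 - (q ^ 2) ^ (n + 1)) * e

/-- Detailed balance on a bond. -/
theorem siteWeight_balance {q : ℝ} (hq0 : 0 < q) (hq1 : q < 1) (k : Fin m) {n₁ n₂ : ℕ}
    (h₁ : n₁ ≤ N k.castSucc) (h₂ : n₂ ≤ N k.succ) :
    siteWeight N q k.castSucc (n₁ + 1) * siteWeight N q k.succ n₂
        * asepRight q (N k.castSucc) (N k.succ) (n₁ + 1) n₂
      = siteWeight N q k.castSucc n₁ * siteWeight N q k.succ (n₂ + 1)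
        * asepLeft q (N k.castSucc) (N k.succ) n₁ (n₂ + 1) := by
  have s₁ := siteWeight_succ N hq0 hq1 k.castSucc h₁
  have s₂ := siteWeight_succ N hq0 hq1 k.succ h₂
  rw [siteExp_succ, Real.rpow_sub hq0, Real.rpow_add hq0, Real.rpow_natCast, Real.rpow_natCast] at s₂
  have r : 1 - 1 / (q ^ 2) ^ (n₂ + 1) = -(1 - (q ^ 2) ^ (n₂ + 1)) / (q ^ 2) ^ (n₂ + 1) := by
    field_simp; ring
  rw [asepRight_eq hq0 hq1.ne, asepLeft_eq hq0 hq1.ne, r]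
  generalize hκ : ((q - q⁻¹) ^ 2)⁻¹ = κ
  calc _ = κ * (q * q ^ N k.castSucc * q ^ N k.succ)⁻¹ * (1 - (q ^ 2) ^ N k.succ / (q ^ 2) ^ n₂)
        * siteWeight N q k.succ n₂
        * (siteWeight N q k.castSucc (n₁ + 1) * (1 - (q ^ 2) ^ (n₁ + 1))) := by ring
    _ = κ * (q * q ^ N k.castSucc * q ^ N k.succ) * (-1 / (q ^ 2) ^ (n₂ + 1))
        * (1 - (q ^ 2) ^ n₁ / (q ^ 2) ^ N k.castSucc) * siteWeight N q k.castSucc n₁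
        * (siteWeight N q k.succ (n₂ + 1) * (1 - (q ^ 2) ^ (n₂ + 1))) := by
      rw [s₁, s₂]
      field_simp
      ring
    _ = _ := by ring

theorem reversible_weight {q : ℝ} (hq0 : 0 < q) (hq1 : q < 1) (ρ : ℝ) :
    Reversible (liftRate (fun k _ => asepRight q (N k.castSucc) (N k.succ)) ρ)
      (liftRate (fun k _ => asepLeft q (N k.castSucc) (N k.succ)) ρ) (weight N q) := by
  intro k η h
  have hne := castSucc_ne_succ k
  have hw : ∀ η' : Config N, weight N q η' = heightProd (fun x n _ _ _ => siteWeight N q x n) 0 η' η :=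
    fun η' => by rw [weight_eq N hq0]; rfl
  rw [hw, hw, heightProd_eq _ _ k, heightProd_eq _ _ k, offBond_jump _ _ _ (.inl ⟨rfl, rfl⟩) h]
  simp only [twoSite, liftRate, jump_source, jump_target hne h]
  obtain ⟨n, hn⟩ : ∃ n, (η k.castSucc : ℕ) = n + 1 := ⟨(η k.castSucc : ℕ) - 1, by have := h.1; omega⟩
  have := siteWeight_balance N hq0 hq1 k (n₁ := n) (n₂ := η k.succ)
    (by have := val_le η k.castSucc; omega) (val_le η k.succ)
  rw [hn, add_tsub_cancel_right, mul_assoc, this]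
  ring

end Weight

end

end QASEP

namespace QASEP

noncomputable section

open Filter Topology

theorem qPoch_inv_pow_div {Q : ℝ} (hQ : Q ≠ 0) (N n z : ℕ) :
    qPoch (Q⁻¹ ^ n)⁻¹ Q⁻¹ z / qPoch (Q⁻¹ ^ N)⁻¹ Q⁻¹ z = falling Q N n z := by
  rw [qPoch, qPoch, ← Finset.prod_div_distrib, falling]
  refine Finset.prod_congr rfl fun i _ => ?_
  have h : ∀ k, 1 - (Q⁻¹ ^ k)⁻¹ * Q⁻¹ ^ i = (Q ^ i)⁻¹ * (Q ^ i - Q ^ k) := by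
    intro k
    rw [inv_pow, inv_inv, inv_pow]
    field_simp
  rw [h, h, mul_div_mul_left _ _ (by positivity)]

theorem qPoch_inv_pow_self {P : ℝ} (hP : P ≠ 0) (z : ℕ) :
    qPoch (P ^ z)⁻¹ P z * (P ^ z * ∏ i ∈ Finset.range z, P ^ i) = (-1) ^ z * qPoch P P z := by
  induction z with
  | zero => simp [qPoch_zero]
  | succ z ih =>
    have e : (P ^ (z + 1))⁻¹ * P = (P ^ z)⁻¹ := by rw [pow_succ]; field_simp
    rw [qPoch_succ', e, Finset.prod_range_succ, qPoch_succ P P z]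
    calc _ = (P ^ (z + 1) - 1) * (qPoch (P ^ z)⁻¹ P z * (P ^ z * ∏ i ∈ Finset.range z, P ^ i)) := by
          field_simp
      _ = _ := by rw [ih]; ring

theorem pow_mul_qPoch_div {y : ℝ} (hy : y ≠ 0) (c P : ℝ) (j : ℕ) :
    y ^ j * qPoch (c / y) P j = ∏ i ∈ Finset.range j, (y - c * P ^ i) := by
  rw [qPoch, Finset.pow_eq_prod_const, ← Finset.prod_mul_distrib]
  refine Finset.prod_congr rfl fun i _ => ?_
  field_simp

theorem tendsto_krawtSum {Q : ℝ} (hQ0 : 0 < Q) (hQ1 : Q < 1) (N z n : ℕ) (c : ℝ) :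
    Tendsto (fun y => y ^ z * krawtSum Q⁻¹ N z (c / y) n) (𝓝[≠] 0)
      (𝓝 (c ^ z * falling Q N n z)) := by
  have hP : Q⁻¹ ≠ 0 := inv_ne_zero hQ0.ne'
  set a : ℕ → ℝ := fun j => qPoch (Q⁻¹ ^ z)⁻¹ Q⁻¹ j * Q⁻¹ ^ j
    / (qPoch (Q⁻¹ ^ N)⁻¹ Q⁻¹ j * qPoch Q⁻¹ Q⁻¹ j) * qPoch (Q⁻¹ ^ n)⁻¹ Q⁻¹ j with ha
  have hc : Continuous fun y : ℝ => ∑ j ∈ Finset.range (z + 1),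
      a j * (y ^ (z - j) * ∏ i ∈ Finset.range j, (y - c * Q⁻¹ ^ i)) := by fun_prop
  have h0 : ∑ j ∈ Finset.range (z + 1),
      a j * ((0 : ℝ) ^ (z - j) * ∏ i ∈ Finset.range j, (0 - c * Q⁻¹ ^ i))
      = c ^ z * falling Q N n z := by
    rw [Finset.sum_range_succ, Finset.sum_eq_zero, zero_add, tsub_self, pow_zero, one_mul]
    · have e : ∏ i ∈ Finset.range z, (0 - c * Q⁻¹ ^ i) = (-c) ^ z * ∏ i ∈ Finset.range z, Q⁻¹ ^ i := by
        simp [← neg_mul, Finset.prod_mul_distrib]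
      have s := qPoch_inv_pow_self hP z
      have p : qPoch Q⁻¹ Q⁻¹ z ≠ 0 := by
        refine qPoch_ne_zero_iff.2 fun i _ h => ?_
        rw [← pow_succ', inv_pow, inv_eq_one] at h
        exact (pow_lt_one₀ hQ0.le hQ1 (Nat.succ_ne_zero i)).ne h
      rw [e, ← qPoch_inv_pow_div hQ0.ne']
      calc _ = (-c) ^ z * (qPoch (Q⁻¹ ^ z)⁻¹ Q⁻¹ z * (Q⁻¹ ^ z * ∏ i ∈ Finset.range z, Q⁻¹ ^ i))
            / qPoch Q⁻¹ Q⁻¹ z * (qPoch (Q⁻¹ ^ n)⁻¹ Q⁻¹ z / qPoch (Q⁻¹ ^ N)⁻¹ Q⁻¹ z) := by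
            simp only [ha]; ring
        _ = _ := by
          rw [s, ← mul_assoc, ← mul_pow, mul_div_assoc, div_self p]
          ring
    · intro j hj
      have : z - j ≠ 0 := by have := Finset.mem_range.1 hj; omega
      rw [zero_pow this, zero_mul, mul_zero]
  refine ((hc.tendsto' 0 _ h0).mono_left nhdsWithin_le_nhds).congr' ?_
  filter_upwards [self_mem_nhdsWithin] with y hy
  rw [krawtSum, Finset.mul_sum]
  refine Finset.sum_congr rfl fun j hj => ?_
  have hz : y ^ z = y ^ (z - j) * y ^ j := by
    rw [← pow_add]; congr 1; have := Finset.mem_range.1 hj; omega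
  rw [← pow_mul_qPoch_div hy, hahnTerm, hz, ha]
  ring

section Triangular

variable {m : ℕ} (N : Fin (m + 1) → ℕ)

/-- The one-site factor of the limit of `dualKL`. -/
def siteTri (q : ℝ) (k : Fin (m + 1)) (z n : ℕ) (l _r : ℝ) : ℝ :=
  q ^ ((n : ℝ) * siteExp N k * (-1 / 2)) * ((-1) ^ n * q ^ ((n : ℝ) * (l - ((N k : ℝ) - 1) / 2))
    * ((-(q ^ (-2 * l) * (q ^ 2) ^ N k / (q ^ 2) ^ z)) ^ z * falling (q ^ 2) (N k) n z))

theorem tendsto_siteTri {q : ℝ} (hq0 : 0 < q) (hq1 : q < 1) (k : Fin (m + 1)) (z n : ℕ) (l r : ℝ) :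
    Tendsto (fun lam : ℝ => q ^ ((n : ℝ) * siteExp N k * (-1 / 2)) * (q ^ (2 * lam * z) * q ^ (-lam * n)
      * siteKrawtchouk n z (lam + l) (N k) q⁻¹)) atTop (𝓝 (siteTri N q k z n l r)) := by
  have ht : Tendsto (fun lam : ℝ => q ^ (2 * lam)) atTop (𝓝[≠] 0) := by
    refine tendsto_nhdsWithin_iff.2 ⟨?_, .of_forall fun lam => (Real.rpow_pos_of_pos hq0 _).ne'⟩
    exact (tendsto_rpow_atTop_of_base_lt_one q (by linarith) hq1).comp
      (tendsto_id.const_mul_atTop two_pos)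
  have h := (tendsto_krawtSum (Q := q ^ 2) (by positivity) (pow_lt_one₀ hq0.le hq1 two_ne_zero)
    (N k) z n (-(q ^ (-2 * l) * (q ^ 2) ^ N k / (q ^ 2) ^ z))).comp ht
  refine (((h.const_mul ((-1) ^ n * q ^ ((n : ℝ) * (l - ((N k : ℝ) - 1) / 2)))).const_mul
    (q ^ ((n : ℝ) * siteExp N k * (-1 / 2)))).congr fun lam => ?_)
  rw [siteKrawtchouk_eq (inv_pos.2 hq0)]
  have i : ∀ s : ℝ, q⁻¹ ^ s = q ^ (-s) := fun s => by rw [Real.inv_rpow hq0.le, Real.rpow_neg hq0.le]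
  have e1 : -q⁻¹ ^ (2 * (lam + l)) * (q⁻¹ ^ 2) ^ z / (q⁻¹ ^ 2) ^ N k
      = -(q ^ (-2 * l) * (q ^ 2) ^ N k / (q ^ 2) ^ z) / q ^ (2 * lam) := by
    rw [i, show -(2 * (lam + l)) = -2 * l - 2 * lam by ring, Real.rpow_sub hq0]
    simp only [inv_pow]
    field_simp
  have e2 : q ^ (2 * lam * z) = (q ^ (2 * lam)) ^ z := Real.rpow_mul_natCast hq0.le _ _
  have e3 : q ^ ((n : ℝ) * (l - ((N k : ℝ) - 1) / 2))
      = q ^ (-lam * n) * q⁻¹ ^ ((n : ℝ) * (((N k : ℝ) - 1) / 2 - (lam + l))) := by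
    rw [i, ← Real.rpow_add hq0]
    congr 1
    ring
  rw [e1, e2, e3, inv_pow]
  simp only [Function.comp]
  ring

theorem TwoSiteDual.symm {N₁ N₂ : ℕ} {c d c' d' : ℕ → ℕ → ℝ} {T : ℕ → ℕ → ℕ → ℕ → ℝ}
    (h : TwoSiteDual N₁ N₂ c d c' d' T) :
    TwoSiteDual N₁ N₂ c' d' c d fun n₁ n₂ x₁ x₂ => T x₁ x₂ n₁ n₂ :=
  fun n₁ n₂ x₁ x₂ h₁ h₂ h₃ h₄ => (h x₁ x₂ n₁ n₂ h₃ h₄ h₁ h₂).symm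

theorem twoSite_siteTri {q : ℝ} (hq : 0 < q) (k : Fin m) (l r : ℝ) :
    twoSite N (siteTri N q) k l r = fun z₁ z₂ n₁ n₂ =>
      ((-1) ^ (n₁ + n₂) * (-1) ^ (z₁ + z₂) * q ^ (((n₁ + n₂ : ℕ) : ℝ)
          * (-siteExp N k.castSucc / 2 - N k.castSucc / 2 + 1 / 2 + l)
        + ((z₁ + z₂ : ℕ) : ℝ) * (2 * N k.castSucc - 2 * l - 2 * ((z₁ + z₂ : ℕ) : ℝ))))
      * (falling (q ^ 2) (N k.castSucc) n₁ z₁ * falling (q ^ 2) (N k.succ) n₂ z₂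
          * (((q ^ 2) ^ n₂) ^ z₁ * ((q ^ 2) ^ N k.succ) ^ z₂)) := by
  funext z₁ z₂ n₁ n₂
  have n := rpow_two_mul_natCast hq
  have c1 : ∀ (l : ℝ) (M z : ℕ), (-(q ^ (-2 * l) * (q ^ 2) ^ M / (q ^ 2) ^ z)) ^ z
      = (-1) ^ z * q ^ ((z : ℝ) * (-2 * l + 2 * M - 2 * z)) := by
    intro l M z
    rw [neg_pow, ← n, ← n, ← Real.rpow_add hq, ← Real.rpow_sub hq, mul_comm (z : ℝ),
      Real.rpow_mul_natCast hq.le]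
  have c2 : ∀ a b : ℕ, ((q ^ 2) ^ a) ^ b = q ^ (2 * (a : ℝ) * b) := by
    intro a b
    rw [Real.rpow_mul_natCast hq.le, n]
  simp only [twoSite, siteTri, c1, c2]
  have e : q ^ ((n₁ : ℝ) * siteExp N k.castSucc * (-1 / 2))
        * q ^ ((n₁ : ℝ) * (l - ((N k.castSucc : ℝ) - 1) / 2))
        * q ^ ((z₁ : ℝ) * (-2 * l + 2 * N k.castSucc - 2 * z₁))
        * (q ^ ((n₂ : ℝ) * siteExp N k.succ * (-1 / 2))
          * q ^ ((n₂ : ℝ) * (l + (2 * z₁ - N k.castSucc) - ((N k.succ : ℝ) - 1) / 2))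
          * q ^ ((z₂ : ℝ) * (-2 * (l + (2 * z₁ - N k.castSucc)) + 2 * N k.succ - 2 * z₂)))
      = q ^ (((n₁ + n₂ : ℕ) : ℝ)
          * (-siteExp N k.castSucc / 2 - N k.castSucc / 2 + 1 / 2 + l)
        + ((z₁ + z₂ : ℕ) : ℝ) * (2 * N k.castSucc - 2 * l - 2 * ((z₁ + z₂ : ℕ) : ℝ)))
        * (q ^ (2 * (n₂ : ℝ) * z₁) * q ^ (2 * (N k.succ : ℝ) * z₂)) := by
    simp only [← Real.rpow_add hq]
    congr 1
    rw [siteExp_succ]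
    push_cast
    ring
  rw [pow_add, pow_add]
  linear_combination ((-1) ^ n₁ * (-1) ^ n₂ * ((-1) ^ z₁ * (-1) ^ z₂)
    * (falling (q ^ 2) (N k.castSucc) n₁ z₁ * falling (q ^ 2) (N k.succ) n₂ z₂)) * e

theorem isDuality_siteTri {q : ℝ} (hq0 : 0 < q) (hq1 : q < 1) :
    IsDuality (genASEP N q) (genASEP N q) (heightProd (siteTri N q) 0) := by
  rw [genASEP_eq N q 0]
  refine isDuality_heightProd (fun k _ => asep_admissible hq0 hq1.ne _ _)
    (fun k _ => asep_admissible hq0 hq1.ne _ _) _ _ _ fun k l r r' => ?_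
  rw [twoSite_siteTri N hq0]
  exact (falling_twoSiteDual hq0 hq1 _ _).symm.conserved (asep_admissible hq0 hq1.ne _ _)
    (asep_admissible hq0 hq1.ne _ _) fun a b => (-1) ^ b * (-1) ^ a * q ^ ((b : ℝ)
          * (-siteExp N k.castSucc / 2 - N k.castSucc / 2 + 1 / 2 + l)
        + (a : ℝ) * (2 * N k.castSucc - 2 * l - 2 * (a : ℝ)))

theorem tendsto_dualRacah {q : ℝ} (hq0 : 0 < q) (hq1 : q < 1) (ρ v : ℝ) (ζ ξ : Config N) :
    Tendsto (fun lam : ℝ => q ^ (2 * lam * total ζ) * dualRacah N q lam ρ (v * q ^ (-lam)) ζ ξ) atTop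
      (𝓝 (∑ η, heightProd (siteTri N q) 0 ζ η
        * (weight N q η * ((-v) ^ total η * dualKR N q ρ η ξ)))) := by
  have h : ∀ η : Config N, Tendsto (fun lam : ℝ => ∏ k, (q ^ (((η k : ℕ) : ℝ) * siteExp N k * (-1 / 2))
      * (q ^ (2 * lam * (ζ k : ℕ)) * q ^ (-lam * (η k : ℕ))
      * siteKrawtchouk (η k) (ζ k) (lam + heightL 0 ζ k) (N k) q⁻¹))) atTop
      (𝓝 (heightProd (siteTri N q) 0 ζ η)) := fun η =>
    tendsto_finsetProd _ fun k _ => tendsto_siteTri N hq0 hq1 k _ _ _ _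
  refine (tendsto_finsetSum _ fun η _ => (h η).mul_const _).congr fun lam => ?_
  rw [dualRacah, Finset.mul_sum]
  refine Finset.sum_congr rfl fun η _ => ?_
  have e1 : q ^ (2 * lam * total ζ) = ∏ k, q ^ (2 * lam * (ζ k : ℕ)) := by
    rw [← Real.rpow_sum_of_pos hq0, ← Finset.mul_sum, total]
    push_cast
    rfl
  have e2 : (q ^ (-lam)) ^ total η = ∏ k, q ^ (-lam * (η k : ℕ)) := by
    rw [← Real.rpow_mul_natCast hq0.le, ← Real.rpow_sum_of_pos hq0, ← Finset.mul_sum, total]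
    push_cast
    rfl
  have e3 : dualKL N q lam η ζ = (∏ k, q ^ (((η k : ℕ) : ℝ) * siteExp N k * (-1 / 2)))
      * ∏ k, siteKrawtchouk (η k) (ζ k) (lam + heightL 0 ζ (k : ℕ)) (N k) q⁻¹ := by
    rw [dualKL, show -(uExp N η) / 2 = uExp N η * (-1 / 2) by ring, rpow_uExp_mul N hq0]
    congr 1
    exact Finset.prod_congr rfl fun k _ => by rw [heightL_eq_add lam]
  simp only [Finset.prod_mul_distrib]
  rw [← e1, ← e2, e3, ← neg_mul, mul_pow]
  ring

theorem dualHahn_eq {q : ℝ} (hq0 : 0 < q) (hq1 : q < 1) (ρ v : ℝ) (ζ ξ : Config N) :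
    dualHahn N q ρ v ζ ξ = ∑ η, heightProd (siteTri N q) 0 ζ η
        * (weight N q η * ((-v) ^ total η * dualKR N q ρ η ξ)) :=
  (tendsto_dualRacah N hq0 hq1 ρ v ζ ξ).limUnder_eq

theorem isDuality_dualHahn {q : ℝ} (hq0 : 0 < q) (hq1 : q < 1) (ρ v : ℝ) :
    IsDuality (genASEP N q) (genASEPR N q ρ) (dualHahn N q ρ v) := by
  have e : dualHahn N q ρ v = fun ζ ξ => ∑ η, heightProd (siteTri N q) 0 ζ η
        * (weight N q η * ((-v) ^ total η * dualKR N q ρ η ξ)) := by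
    funext ζ ξ
    exact dualHahn_eq N hq0 hq1 ρ v ζ ξ
  have h₁ := isDuality_siteTri N hq0 hq1
  have h₂ := isDuality_dualKR N hq0 hq1 ρ
  rw [e]
  rw [genASEPR_eq] at h₂ ⊢
  rw [genASEP_eq N q 0] at h₁ h₂ ⊢
  exact IsDuality.comp (admissible_liftRate (fun k _ => asep_admissible hq0 hq1.ne _ _) 0)
    (reversible_weight N hq0 hq1 0) h₁ h₂ fun a => (-v) ^ a

end Triangular

end

end QASEP

namespace QASEP

noncomputable section

open Filter Topology

theorem prod_pow_sub_eq (Q : ℝ) {N z : ℕ} (hz : z ≤ N) :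
    ∏ i ∈ Finset.range z, (Q ^ (2 * i) * (1 - Q ^ (N - i)))
      = (∏ i ∈ Finset.range z, Q ^ i) * ∏ i ∈ Finset.range z, (Q ^ i - Q ^ N) := by
  rw [← Finset.prod_mul_distrib]
  refine Finset.prod_congr rfl fun i hi => ?_
  have e : Q ^ i * Q ^ (N - i) = Q ^ N := by
    rw [← pow_add]; congr 1; have := Finset.mem_range.1 hi; omega
  rw [two_mul, pow_add]
  linear_combination (-Q ^ i) * e

theorem falling_mul {Q : ℝ} (hQ0 : 0 < Q) (hQ1 : Q < 1) {N n z : ℕ} (hz : z ≤ N) :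
    falling Q N n z * ∏ i ∈ Finset.range z, (Q ^ i - Q ^ N)
      = (-1) ^ z * ∏ i ∈ Finset.range z, (Q ^ n - Q ^ i) := by
  rw [falling, Finset.prod_div_distrib, div_mul_cancel₀, Finset.pow_eq_prod_const (-1),
    ← Finset.prod_mul_distrib]
  · exact Finset.prod_congr rfl fun i _ => by ring
  · exact Finset.prod_ne_zero_iff.2 fun i hi =>
      pow_sub_pow_ne_zero hQ0 hQ1 ((Finset.mem_range.1 hi).trans_le hz).ne

theorem rpow_natCast_sq (q : ℝ) (n : ℕ) :
    q ^ ((n : ℝ) * n) = (q ^ 2) ^ n.choose 2 * q ^ n := by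
  have : n * n = 2 * n.choose 2 + n := by
    have h := Nat.div_mul_cancel (Nat.even_mul_pred_self n).two_dvd
    rw [Nat.choose_two_right]
    rcases n with _ | n
    · rfl
    · rw [Nat.add_sub_cancel] at h ⊢
      nlinarith
  rw [← pow_mul, ← pow_add, ← this, ← Real.rpow_natCast]
  push_cast
  rfl

section Hahn

variable {m : ℕ} (N : Fin (m + 1) → ℕ)

/-- The one-site factor of `dualHahn`. -/
def hahnSite (q v : ℝ) (k : Fin (m + 1)) (z x : ℕ) (l r : ℝ) : ℝ :=
  ∑ n ∈ Finset.range (N k + 1), siteTri N q k z n l 0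
    * (siteWeight N q k n * ((-v) ^ n * siteKR N q k n x 0 r))

theorem dualHahn_eq_prod {q : ℝ} (hq0 : 0 < q) (hq1 : q < 1) (ρ v : ℝ) :
    dualHahn N q ρ v = heightProd (hahnSite N q v) ρ := by
  funext ζ ξ
  have h : ∀ k : Fin (m + 1), hahnSite N q v k (ζ k) (ξ k) (heightL 0 ζ k) (heightR ρ ξ ((k : ℕ) + 1))
      = ∑ n : Fin (N k + 1), siteTri N q k (ζ k) n (heightL 0 ζ k) 0
    * (siteWeight N q k n * ((-v) ^ (n : ℕ) * siteKR N q k n (ξ k) 0 (heightR ρ ξ ((k : ℕ) + 1)))) :=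
    fun k => by rw [hahnSite, Finset.sum_range]
  rw [dualHahn_eq N hq0 hq1, heightProd, Finset.prod_congr rfl fun k _ => h k, Finset.prod_univ_sum,
    Fintype.piFinset_univ]
  refine Finset.sum_congr rfl fun η _ => ?_
  rw [dualKR_eq N hq0, weight_eq N hq0, total, ← Finset.prod_pow_eq_pow_sum]
  simp only [Finset.prod_mul_distrib]
  rfl

/-- The `q`-Hahn factor without its `v`-dependent `q`-shifted factorials in `v q^(λ-ρ)`. -/
def hahnNum (q v : ℝ) (M z x : ℕ) (l r : ℝ) : ℝ :=
  v ^ z / q ^ (z * (z + r + l - M))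
    * hahnSum (q ^ 2) M x (-q ^ (2 * r) * (q ^ 2) ^ x / (q ^ 2) ^ M) z (-v * q ^ (r + l - M + 1))

theorem hahnSite_mul {q : ℝ} (hq0 : 0 < q) (hq1 : q < 1) (v : ℝ) (k : Fin (m + 1)) {z x : ℕ}
    (hz : z ≤ N k) (hx : x ≤ N k) (l r : ℝ) :
    hahnSite N q v k z x l r * qPoch (v * q ^ (-2 * x - r + l + N k + 1)) (q ^ 2) (x + z)
      = qPoch (v * q ^ (2 * z - r + l - N k + 1)) (q ^ 2) (N k) * hahnNum q v (N k) z x l r := by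
  have hQ0 : 0 < q ^ 2 := by positivity
  have hQ1 : q ^ 2 < 1 := pow_lt_one₀ hq0.le hq1 two_ne_zero
  have nn := rpow_two_mul_natCast hq0
  set B := -q ^ (2 * r) * (q ^ 2) ^ x / (q ^ 2) ^ N k with hB
  have hB0 : B ≠ 0 := by
    have := Real.rpow_pos_of_pos hq0 (2 * r)
    rw [hB]
    simp [hq0.ne', this.ne']
  set s := v * q ^ (l - r - N k + 1) with hs
  have main := sum_krawtSum_mul_prod hQ0 hQ1 hx hB0 hz s
  set R := ∏ i ∈ Finset.range z, ((q ^ 2) ^ i - (q ^ 2) ^ N k) with hR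
  have hR0 : R ≠ 0 := Finset.prod_ne_zero_iff.2 fun i hi =>
    pow_sub_pow_ne_zero hQ0 hQ1 ((Finset.mem_range.1 hi).trans_le hz).ne
  set c := -(q ^ (-2 * l) * (q ^ 2) ^ N k / (q ^ 2) ^ z) with hc
  have hterm : hahnSite N q v k z x l r * R = (-c) ^ z
      * ∑ n ∈ Finset.range (N k + 1), gauss (q ^ 2) (N k) n * ((q ^ 2) ^ n.choose 2 * (-s) ^ n)
        * krawtSum (q ^ 2) (N k) x B n * ∏ i ∈ Finset.range z, ((q ^ 2) ^ n - (q ^ 2) ^ i) := by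
    rw [hahnSite, Finset.sum_mul, Finset.mul_sum]
    refine Finset.sum_congr rfl fun n _ => ?_
    rw [siteTri, siteWeight, siteKR, siteKrawtchouk_eq hq0, ← hB, ← hc, neg_pow c]
    have f := falling_mul hQ0 hQ1 (n := n) hz
    rw [← hR] at f
    have e : q ^ ((n : ℝ) * siteExp N k * (-1 / 2)) * q ^ ((n : ℝ) * (l - ((N k : ℝ) - 1) / 2))
        * (q ^ ((n : ℝ) * siteExp N k) * q ^ ((n : ℝ) * ((n : ℝ) - N k)))
        * (q ^ ((n : ℝ) * siteExp N k * (-1 / 2)) * q ^ ((n : ℝ) * (((N k : ℝ) - 1) / 2 - r)))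
        = (q ^ 2) ^ n.choose 2 * (q ^ (l - r - N k + 1)) ^ n := by
      have h1 := rpow_natCast_sq q n
      have h2 : q ^ ((n : ℝ) * n + n * (l - r - N k)) = (q ^ 2) ^ n.choose 2 * q ^ n
          * (q ^ (l - r - N k)) ^ n := by
        rw [Real.rpow_add hq0, h1, mul_comm (n : ℝ) (l - r - N k), Real.rpow_mul_natCast hq0.le]
      rw [Real.rpow_add hq0 (l - r - N k), Real.rpow_one, mul_pow]
      calc _ = q ^ ((n : ℝ) * n + n * (l - r - N k)) := by
            simp only [← Real.rpow_add hq0]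
            congr 1
            ring
        _ = _ := by rw [h2]; ring
    have e1 : (-1 : ℝ) ^ n * (-1) ^ n = 1 := by rw [← mul_pow]; norm_num
    rw [hs, ← neg_mul, mul_pow (-v)]
    calc _ = (q ^ ((n : ℝ) * siteExp N k * (-1 / 2)) * q ^ ((n : ℝ) * (l - ((N k : ℝ) - 1) / 2))
        * (q ^ ((n : ℝ) * siteExp N k) * q ^ ((n : ℝ) * ((n : ℝ) - N k)))
        * (q ^ ((n : ℝ) * siteExp N k * (-1 / 2)) * q ^ ((n : ℝ) * (((N k : ℝ) - 1) / 2 - r))))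
        * ((-1 : ℝ) ^ n * (-1) ^ n) * c ^ z * (falling (q ^ 2) (N k) n z * R)
        * gauss (q ^ 2) (N k) n * (-v) ^ n * krawtSum (q ^ 2) (N k) x B n := by ring
      _ = _ := by rw [e, e1, f]; ring
  have d1 : v * q ^ (-2 * x - r + l + N k + 1) = s * (q ^ 2) ^ (N k - x) := by
    rw [hs, ← nn, mul_assoc, ← Real.rpow_add hq0, Nat.cast_sub hx]
    ring_nf
  have d2 : v * q ^ (2 * z - r + l - N k + 1) = s * (q ^ 2) ^ z := by
    rw [hs, ← nn, mul_assoc, ← Real.rpow_add hq0]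
    ring_nf
  have d3 : -v * q ^ (r + l - N k + 1) = B * (s * (q ^ 2) ^ (N k - x)) := by
    rw [pow_sub₀ _ hQ0.ne' hx, hB, hs]
    have : q ^ (r + l - N k + 1) = q ^ (2 * r) * q ^ (l - r - N k + 1) := by
      rw [← Real.rpow_add hq0]; ring_nf
    rw [this]
    field_simp
  have d4 : (-c) ^ z * ((∏ i ∈ Finset.range z, (q ^ 2) ^ i) * s ^ z)
      = v ^ z / q ^ (z * (z + r + l - N k)) := by
    have h1 := rpow_natCast_sq q z
    have h2 : ∏ i ∈ Finset.range z, (q ^ 2) ^ i = (q ^ 2) ^ z.choose 2 := by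
      rw [Finset.prod_pow_eq_pow_sum, Finset.sum_range_id, Nat.choose_two_right]
    have h3 : (-c) ^ z = q ^ ((z : ℝ) * (-2 * l + 2 * N k - 2 * z)) := by
      rw [hc, neg_neg, ← nn, ← nn, ← Real.rpow_add hq0, ← Real.rpow_sub hq0, mul_comm (z : ℝ),
        Real.rpow_mul_natCast hq0.le]
    have h4 : s ^ z = v ^ z * (q ^ ((z : ℝ) * (l - r - N k)) * q ^ z) := by
      rw [hs, Real.rpow_add hq0, Real.rpow_one, mul_pow, mul_pow, mul_comm (z : ℝ),
        Real.rpow_mul_natCast hq0.le]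
    rw [h2, h3, h4]
    calc _ = v ^ z * (q ^ ((z : ℝ) * (-2 * l + 2 * N k - 2 * z)) * q ^ ((z : ℝ) * (l - r - N k))
          * ((q ^ 2) ^ z.choose 2 * q ^ z)) := by ring
      _ = v ^ z * q ^ (-(z * (z + r + l - N k)) : ℝ) := by
        rw [← h1, ← Real.rpow_add hq0, ← Real.rpow_add hq0]
        congr 2
        ring
      _ = _ := by rw [Real.rpow_neg hq0.le, div_eq_mul_inv]
  rw [hahnNum, ← hB, d1, d2, d3, ← d4]
  apply mul_right_cancel₀ hR0
  rw [mul_right_comm, hterm, mul_assoc, main, prod_pow_sub_eq _ hz, ← hR]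
  ring

theorem qPoch_mul_sum_hahnTerm {Q : ℝ} (hQ : Q ≠ 0) (N x n : ℕ) (B : ℝ) {w : ℝ}
    (h : qPoch w Q (min x n) ≠ 0) :
    qPoch w Q x * ∑ j ∈ Finset.range (x + 1),
        hahnTerm Q N x B j * qPoch (Q ^ n)⁻¹ Q j / qPoch w Q j
      = hahnSum Q N x B n w := by
  rw [hahnSum, Finset.mul_sum]
  refine Finset.sum_congr rfl fun j hj => ?_
  rcases lt_or_ge n j with hn | hn
  · simp [qPoch_inv_pow_eq_zero hQ hn]
  · have hjx : j ≤ x := Nat.lt_succ_iff.1 (Finset.mem_range.1 hj)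
    have h0 : qPoch w Q j ≠ 0 := qPoch_ne_zero_iff.2 fun i hi =>
      qPoch_ne_zero_iff.1 h i (hi.trans_le (le_min hjx hn))
    have e := qPoch_add w Q j (x - j)
    rw [Nat.add_sub_cancel' hjx] at e
    rw [e]
    field_simp

theorem hahnSite_eq {q : ℝ} (hq0 : 0 < q) (hq1 : q < 1) {v : ℝ} (hv : v ≠ 0) (k : Fin (m + 1))
    {z x : ℕ} (hz : z ≤ N k) (hx : x ≤ N k) {l r : ℝ}
    (h : qPoch (v * q ^ (-2 * x - r + l + N k + 1)) (q ^ 2) (x + z) ≠ 0)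
    (h' : qPoch (-v * q ^ (r + l - N k + 1)) (q ^ 2) (min x z) ≠ 0) :
    hahnSite N q v k z x l r = siteHahn z x l r v (N k) q := by
  have hQ0 : 0 < q ^ 2 := by positivity
  apply mul_right_cancel₀ h
  have e1 : -v * q ^ (r + l - N k - 1) * (v⁻¹ * q ^ (r - l - N k - 1)) * q ^ 2 * (q ^ 2) ^ x
      = -q ^ (2 * r) * (q ^ 2) ^ x / (q ^ 2) ^ N k := by
    have : q ^ (2 * r) = q ^ (r + l - N k - 1) * q ^ (r - l - N k - 1) * (q ^ 2 * (q ^ 2) ^ N k) := by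
      rw [← rpow_two_mul_natCast hq0, ← Real.rpow_two, ← Real.rpow_add hq0, ← Real.rpow_add hq0,
        ← Real.rpow_add hq0]
      ring_nf
    rw [this]
    field_simp
  have e2 : -v * q ^ (r + l - N k - 1) * q ^ 2 = -v * q ^ (r + l - N k + 1) := by
    rw [mul_assoc, ← Real.rpow_two, ← Real.rpow_add hq0]
    ring_nf
  rw [hahnSite_mul N hq0 hq1 v k hz hx, siteHahn, qHahn_eq hQ0, e1, e2, hahnNum,
    ← qPoch_mul_sum_hahnTerm hQ0.ne' _ _ _ _ h']
  generalize qPoch (v * q ^ (-2 * (x : ℝ) - r + l + N k + 1)) (q ^ 2) (x + z) = D at h ⊢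
  field_simp

theorem dualHahn_eq_nestedHahn {q : ℝ} (hq0 : 0 < q) (hq1 : q < 1) {ρ v : ℝ} (hv : v ≠ 0)
    {η ξ : Config N} (h : HahnRegular N q ρ v η ξ) :
    dualHahn N q ρ v η ξ = nestedHahn N q ρ v η ξ := by
  rw [dualHahn_eq_prod N hq0 hq1]
  exact Finset.prod_congr rfl fun k _ =>
    hahnSite_eq N hq0 hq1 hv k (val_le η k) (val_le ξ k) (h k).1 (h k).2

end Hahn

end

end QASEP

namespace QASEP

noncomputable section

open Filter Topology

theorem qPoch_exchange (c Q : ℝ) (hQ : Q ≠ 0) {g g' M d : ℕ} (h : g' + d = g + M) :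
    qPoch (c / Q ^ g') Q M * qPoch (c / Q ^ g) Q g
      = qPoch (c / Q ^ g) Q d * qPoch (c / Q ^ g') Q g' := by
  have e : ∀ a b : ℕ, c / Q ^ (a + b) * Q ^ a = c / Q ^ b := by
    intro a b
    rw [pow_add]
    field_simp
  rcases le_total g' M with hM | hM
  · obtain ⟨t, rfl⟩ := Nat.exists_eq_add_of_le hM
    obtain rfl : d = g + t := by omega
    have e0 : ∀ a : ℕ, c / Q ^ a * Q ^ a = c := fun a => by field_simp
    rw [qPoch_add, qPoch_add, e0, e0]
    ring
  · obtain ⟨t, rfl⟩ := Nat.exists_eq_add_of_le hM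
    obtain rfl : g = d + t := by omega
    rw [qPoch_add _ _ M t, qPoch_add _ _ d t, e, e]
    ring

theorem prod_telescope {f : ℕ → ℝ} {n : ℕ} {M D : Fin n → ℝ} (hD : ∀ k, D k ≠ 0)
    (h : ∀ k, M k * f k = D k * f ((k : ℕ) + 1)) :
    (∏ k, M k / D k) * f 0 = f n := by
  induction n with
  | zero => simp
  | succ n ih =>
    have h0 := h (Fin.last n)
    rw [Fin.prod_univ_castSucc, mul_right_comm,
      ih (M := fun k => M k.castSucc) (D := fun k => D k.castSucc) (fun k => hD _) fun k => h _,
      ← mul_div_assoc, div_eq_iff (hD _), mul_comm, mul_comm (f _)]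
    exact h0

section Count

variable {m : ℕ} {N : Fin (m + 1) → ℕ}

/-- The number of holes of `ζ` to the left of `k` plus the number of particles of `ξ` to the right
of it. -/
def mixedCount (ζ ξ : Config N) (k : ℕ) : ℕ :=
  ∑ j : Fin (m + 1), if (j : ℕ) < k then N j - (ζ j : ℕ) else (ξ j : ℕ)

theorem height_sub (ρ : ℝ) (ζ ξ : Config N) (k : ℕ) :
    heightL 0 ζ k - heightR ρ ξ k = -ρ + cap N - 2 * mixedCount ζ ξ k := by
  rw [heightL, heightR, zero_add, sub_add_eq_sub_sub_swap, ← Finset.sum_sub_distrib, cap, mixedCount]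
  push_cast
  rw [Finset.mul_sum, add_sub_assoc, ← Finset.sum_sub_distrib, sub_eq_add_neg, add_comm]
  congr 1
  refine Finset.sum_congr rfl fun j _ => ?_
  have h := val_le ζ j
  rw [occ, occ]
  by_cases hj : (j : ℕ) < k
  · rw [if_pos hj, if_neg (not_le.2 hj), if_pos hj, Nat.cast_sub h]
    ring
  · rw [if_neg hj, if_pos (not_lt.1 hj), if_neg hj]
    ring

theorem mixedCount_zero (ζ ξ : Config N) : mixedCount ζ ξ 0 = total ξ := by
  simp [mixedCount, total]

theorem total_le_cap (ζ : Config N) : total ζ ≤ cap N :=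
  Finset.sum_le_sum fun j _ => val_le ζ j

theorem mixedCount_last (ζ ξ : Config N) : mixedCount ζ ξ (m + 1) = cap N - total ζ := by
  have h : mixedCount ζ ξ (m + 1) + total ζ = cap N := by
    rw [mixedCount, total, cap, ← Finset.sum_add_distrib]
    refine Finset.sum_congr rfl fun j _ => ?_
    rw [if_pos j.2, Nat.sub_add_cancel (val_le ζ j)]
  omega

theorem mixedCount_succ (ζ ξ : Config N) (k : Fin (m + 1)) :
    mixedCount ζ ξ ((k : ℕ) + 1) + (ξ k + ζ k) = mixedCount ζ ξ k + N k := by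
  have h1 := height_sub 0 ζ ξ k
  have h2 := height_sub 0 ζ ξ ((k : ℕ) + 1)
  rw [heightL_succ, occ] at h2
  rw [heightR_succ, occ] at h1
  have : (mixedCount ζ ξ ((k : ℕ) + 1) : ℝ) + (((ξ k : ℕ) : ℝ) + ((ζ k : ℕ) : ℝ))
      = mixedCount ζ ξ k + N k := by linarith
  exact_mod_cast this

end Count

theorem eventually_mul_ne {c : ℝ} (hc : c ≠ 0) (a v₀ : ℝ) : ∀ᶠ v in 𝓝[≠] v₀, v * c ≠ a := by
  have h : ∀ v, v * c = a ↔ v = a / c := fun v => (eq_div_iff hc).symm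
  simp only [ne_eq, h]
  by_cases e : v₀ = a / c
  · rw [← e]; exact self_mem_nhdsWithin
  · exact mem_nhdsWithin_of_mem_nhds (isOpen_ne.mem_nhds e)

theorem eventually_qPoch_ne_zero {c Q : ℝ} (hc : c ≠ 0) (hQ : Q ≠ 0) (n : ℕ) (v₀ : ℝ) :
    ∀ᶠ v in 𝓝[≠] v₀, qPoch (v * c) Q n ≠ 0 := by
  simp only [qPoch_ne_zero_iff]
  refine (Set.finite_Iio n).eventually_all.2 fun i _ => ?_
  simp only [mul_assoc]
  exact eventually_mul_ne (mul_ne_zero hc (pow_ne_zero _ hQ)) 1 v₀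

theorem continuous_hahnSum (Q : ℝ) (N x : ℕ) (B : ℝ) (n : ℕ) :
    Continuous fun w => hahnSum Q N x B n w := by
  unfold hahnSum
  refine continuous_finsetSum _ fun j _ => continuous_const.mul ?_
  exact (continuous_qPoch Q _).comp (continuous_id.mul continuous_const)

section Global

variable {m : ℕ} (N : Fin (m + 1) → ℕ)

theorem hahnSite_den {q : ℝ} (hq : 0 < q) (ρ v : ℝ) (ζ ξ : Config N) (k : Fin (m + 1)) :
    v * q ^ (-2 * ((ξ k : ℕ) : ℝ) - heightR ρ ξ ((k : ℕ) + 1) + heightL 0 ζ k + N k + 1)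
      = v * q ^ (-ρ + cap N + 1) / (q ^ 2) ^ mixedCount ζ ξ k := by
  have h := height_sub ρ ζ ξ k
  rw [heightR_succ, occ] at h
  rw [← rpow_two_mul_natCast hq, mul_div_assoc, ← Real.rpow_sub hq]
  congr 2
  linarith

theorem hahnSite_num {q : ℝ} (hq : 0 < q) (ρ v : ℝ) (ζ ξ : Config N) (k : Fin (m + 1)) :
    v * q ^ (2 * ((ζ k : ℕ) : ℝ) - heightR ρ ξ ((k : ℕ) + 1) + heightL 0 ζ k - N k + 1)
      = v * q ^ (-ρ + cap N + 1) / (q ^ 2) ^ mixedCount ζ ξ ((k : ℕ) + 1) := by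
  have h := height_sub ρ ζ ξ ((k : ℕ) + 1)
  rw [heightL_succ, occ] at h
  rw [← rpow_two_mul_natCast hq, mul_div_assoc, ← Real.rpow_sub hq]
  congr 2
  linarith

/-- The product of the one-site `q`-Hahn sums. -/
def nestedHahnNum (q ρ v : ℝ) (η ξ : Config N) : ℝ :=
  heightProd (fun k z x l r => hahnNum q v (N k) z x l r) ρ η ξ

theorem continuous_dualHahn {q : ℝ} (hq0 : 0 < q) (hq1 : q < 1) (ρ : ℝ) (η ξ : Config N) :
    Continuous fun v => dualHahn N q ρ v η ξ := by
  simp only [dualHahn_eq N hq0 hq1]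
  exact continuous_finsetSum _ fun _ _ => by fun_prop

theorem continuous_nestedHahnNum (q ρ : ℝ) (η ξ : Config N) :
    Continuous fun v => nestedHahnNum N q ρ v η ξ := by
  simp only [nestedHahnNum, heightProd, hahnNum]
  refine continuous_finsetProd _ fun k _ => ?_
  have := continuous_hahnSum (q ^ 2) (N k) (ξ k)
    (-q ^ (2 * heightR ρ ξ ((k : ℕ) + 1)) * (q ^ 2) ^ (ξ k : ℕ) / (q ^ 2) ^ N k) (η k)
  fun_prop

theorem dualHahn_mul_qPoch {q : ℝ} (hq0 : 0 < q) (hq1 : q < 1) (ρ v : ℝ) (η ξ : Config N) :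
    dualHahn N q ρ v η ξ
        * qPoch (v * q ^ (-ρ + cap N + 1) / (q ^ 2) ^ total ξ) (q ^ 2) (total ξ)
      = qPoch (v * q ^ (-ρ + cap N + 1) / (q ^ 2) ^ (cap N - total η)) (q ^ 2) (cap N - total η)
        * nestedHahnNum N q ρ v η ξ := by
  have hQ : q ^ 2 ≠ 0 := by positivity
  have hE : q ^ (-ρ + cap N + 1) ≠ 0 := (Real.rpow_pos_of_pos hq0 _).ne'
  let Φ : ℝ → ℕ → ℕ → ℝ := fun v g n => qPoch (v * q ^ (-ρ + cap N + 1) / (q ^ 2) ^ g) (q ^ 2) n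
  have hΦc : ∀ g n, Continuous fun v => Φ v g n := fun g n =>
    (continuous_qPoch _ _).comp (by fun_prop)
  have hΦ : ∀ g n, ∀ᶠ v' in 𝓝[≠] v, Φ v' g n ≠ 0 := by
    intro g n
    simp only [Φ, mul_div_assoc]
    exact eventually_qPoch_ne_zero (div_ne_zero hE (pow_ne_zero _ hQ)) hQ n v
  have h1 := ((continuous_dualHahn N hq0 hq1 ρ η ξ).mul (hΦc (total ξ) (total ξ))).tendsto v
  have h2 := ((hΦc (cap N - total η) (cap N - total η)).mul
    (continuous_nestedHahnNum N q ρ η ξ)).tendsto v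
  refine tendsto_nhds_unique_of_eventuallyEq (h1.mono_left nhdsWithin_le_nhds)
    (h2.mono_left (nhdsWithin_le_nhds (s := {v}ᶜ))) ?_
  have hD : ∀ᶠ v' in 𝓝[≠] v, ∀ k : Fin (m + 1), Φ v' (mixedCount η ξ k) (ξ k + η k) ≠ 0 :=
    eventually_all.2 fun k => hΦ _ _
  filter_upwards [hD] with v' hD
  have hsite : ∀ k : Fin (m + 1),
      hahnSite N q v' k (η k) (ξ k) (heightL 0 η k) (heightR ρ ξ ((k : ℕ) + 1))
      = Φ v' (mixedCount η ξ ((k : ℕ) + 1)) (N k) / Φ v' (mixedCount η ξ k) (ξ k + η k)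
        * hahnNum q v' (N k) (η k) (ξ k) (heightL 0 η k) (heightR ρ ξ ((k : ℕ) + 1)) := by
    intro k
    have := hahnSite_mul N hq0 hq1 v' k (val_le η k) (val_le ξ k) (heightL 0 η k)
      (heightR ρ ξ ((k : ℕ) + 1))
    rw [hahnSite_den N hq0, hahnSite_num N hq0] at this
    rw [div_mul_eq_mul_div, eq_div_iff (hD k)]
    exact this
  have tel := prod_telescope (f := fun k => Φ v' (mixedCount η ξ k) (mixedCount η ξ k))
    (M := fun k => Φ v' (mixedCount η ξ ((k : ℕ) + 1)) (N k)) hD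
    fun k => qPoch_exchange _ _ hQ (mixedCount_succ η ξ k)
  simp only [mixedCount_zero, mixedCount_last] at tel
  rw [Pi.mul_apply, Pi.mul_apply, ← tel, dualHahn_eq_prod N hq0 hq1, heightProd,
    Finset.prod_congr rfl fun k _ => hsite k, Finset.prod_mul_distrib, nestedHahnNum, heightProd]
  ring

/-- Away from the zeros of the conserved factor, dividing by it leaves the product of one-site
sums. -/
theorem dualHahn_div_cFactor {q : ℝ} (hq0 : 0 < q) (hq1 : q < 1) {ρ v lam' ρ' v' : ℝ}
    (hv : v' * q ^ (lam' - ρ') = v * q ^ (-ρ)) {η ξ : Config N}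
    (h₁ : qPoch (v' * q ^ (lam' - ρ' + 2 * total η - cap N + 1)) (q ^ 2) (cap N - total η) ≠ 0) :
    dualHahn N q ρ v η ξ / cFactor N q lam' ρ' v' (total η) (total ξ)
      = nestedHahnNum N q ρ v η ξ := by
  have e1 : v' * q ^ (lam' - ρ' + 2 * total η - cap N + 1)
      = v * q ^ (-ρ + cap N + 1) / (q ^ 2) ^ (cap N - total η) := by
    rw [← rpow_two_mul_natCast hq0, mul_div_assoc, ← Real.rpow_sub hq0,
      Nat.cast_sub (total_le_cap η),
      show lam' - ρ' + 2 * total η - cap N + 1 = lam' - ρ' + (2 * total η - cap N + 1) by ring,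
      Real.rpow_add hq0, ← mul_assoc, hv, mul_assoc, ← Real.rpow_add hq0]
    ring_nf
  have e2 : v' * q ^ (lam' - ρ' - 2 * total ξ + cap N + 1)
      = v * q ^ (-ρ + cap N + 1) / (q ^ 2) ^ total ξ := by
    rw [← rpow_two_mul_natCast hq0, mul_div_assoc, ← Real.rpow_sub hq0,
      show lam' - ρ' - 2 * total ξ + cap N + 1 = lam' - ρ' + (-(2 * total ξ) + cap N + 1) by ring,
      Real.rpow_add hq0, ← mul_assoc, hv, mul_assoc, ← Real.rpow_add hq0]
    ring_nf
  have h := dualHahn_mul_qPoch N hq0 hq1 ρ v η ξ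
  rw [← e1, ← e2] at h
  rw [cFactor, div_div_eq_mul_div, h, mul_div_cancel_left₀ _ h₁]

end Global

end

end QASEP

namespace QASEP

noncomputable section

open Filter Topology

theorem tendsto_bondGen {m : ℕ} {N : Fin (m + 1) → ℕ} {ι : Type*} {F : Filter ι}
    {c d : ι → Fin m → Config N → ℝ} {c₀ d₀ : Fin m → Config N → ℝ} {f : ι → Config N → ℝ}
    {f₀ : Config N → ℝ} (hf : ∀ η, Tendsto (fun i => f i η) F (𝓝 (f₀ η))) (η : Config N)
    (hc : ∀ k, Tendsto (fun i => c i k η) F (𝓝 (c₀ k η)))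
    (hd : ∀ k, Tendsto (fun i => d i k η) F (𝓝 (d₀ k η))) :
    Tendsto (fun i => bondGen (c i) (d i) (f i) η) F (𝓝 (bondGen c₀ d₀ f₀ η)) :=
  tendsto_finsetSum _ fun k _ => ((hc k).mul ((hf _).sub (hf _))).add ((hd k).mul ((hf _).sub (hf _)))

theorem tendsto_rpow_two_mul {q : ℝ} (hq0 : 0 < q) (hq1 : q < 1) :
    Tendsto (fun ρ : ℝ => q ^ (2 * ρ)) atTop (𝓝 0) :=
  (tendsto_rpow_atTop_of_base_lt_one q (by linarith) hq1).comp (tendsto_id.const_mul_atTop two_pos)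

theorem dynRight_eq_inv {q : ℝ} (hq : 0 < q) (N₁ N₂ : ℕ) (r : ℝ) (x₁ x₂ : ℕ) {y : ℝ}
    (hy : y = q ^ (2 * r) * ((q ^ 2) ^ x₂) ^ 2 / (q ^ 2) ^ N₂) :
    dynRight q N₁ N₂ r x₁ x₂ = asepRight q N₁ N₂ x₁ x₂
      * ((y + (q ^ 2) ^ N₁ / (q ^ 2) ^ x₁) * (y + (q ^ 2) ^ x₂) / ((y + 1) * (y + 1 / q ^ 2))) := by
  have hy0 : 0 < y := by rw [hy]; positivity
  rw [dynRight_eq hq N₁ N₂ r x₁ x₂ (θ := y⁻¹) (by rw [hy, inv_div]), mul_div_assoc]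
  congr 1
  have h1 : y + 1 ≠ 0 := by positivity
  have h2 : y * q ^ 2 + 1 ≠ 0 := by positivity
  field_simp

theorem dynLeft_eq_inv {q : ℝ} (hq : 0 < q) (N₁ N₂ : ℕ) (r : ℝ) (x₁ x₂ : ℕ) {y : ℝ}
    (hy : y = q ^ (2 * r) * ((q ^ 2) ^ x₂) ^ 2 / (q ^ 2) ^ N₂) :
    dynLeft q N₁ N₂ r x₁ x₂ = asepLeft q N₁ N₂ x₁ x₂
      * ((y + 1 / (q ^ 2) ^ x₁) * (y + (q ^ 2) ^ x₂ / (q ^ 2) ^ N₂) / ((y + 1) * (y + q ^ 2))) := by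
  have hy0 : 0 < y := by rw [hy]; positivity
  rw [dynLeft_eq hq N₁ N₂ r x₁ x₂ (θ := y⁻¹) (by rw [hy, inv_div]), mul_div_assoc]
  congr 1
  have h1 : y + 1 ≠ 0 := by positivity
  have h2 : y + q ^ 2 ≠ 0 := by positivity
  field_simp

theorem tendsto_dynRight {q : ℝ} (hq0 : 0 < q) (hq1 : q < 1) (N₁ N₂ : ℕ) (r : ℝ) (x₁ x₂ : ℕ) :
    Tendsto (fun ρ => dynRight q N₁ N₂ (ρ + r) x₁ x₂) atTop (𝓝 (asepRight q⁻¹ N₁ N₂ x₁ x₂)) := by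
  have hy : Tendsto (fun ρ => q ^ (2 * (ρ + r)) * ((q ^ 2) ^ x₂) ^ 2 / (q ^ 2) ^ N₂) atTop (𝓝 0) := by
    have := (tendsto_rpow_two_mul hq0 hq1).mul_const (q ^ (2 * r) * ((q ^ 2) ^ x₂) ^ 2 / (q ^ 2) ^ N₂)
    rw [zero_mul] at this
    refine this.congr fun ρ => ?_
    rw [mul_add, Real.rpow_add hq0]
    ring
  have hc : ContinuousAt (fun y : ℝ => asepRight q N₁ N₂ x₁ x₂
      * ((y + (q ^ 2) ^ N₁ / (q ^ 2) ^ x₁) * (y + (q ^ 2) ^ x₂) / ((y + 1) * (y + 1 / q ^ 2)))) 0 := by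
    refine continuousAt_const.mul (ContinuousAt.div (by fun_prop) (by fun_prop) ?_)
    simp [hq0.ne']
  have h := (hc.tendsto.comp hy).congr fun ρ => (dynRight_eq_inv hq0 N₁ N₂ (ρ + r) x₁ x₂ rfl).symm
  convert h using 2
  rw [asepRight_eq hq0 hq1.ne, asepRight_eq (inv_pos.2 hq0) (by simpa using hq1.ne)]
  have e : (q⁻¹ - q⁻¹⁻¹) ^ 2 = (q - q⁻¹) ^ 2 := by rw [inv_inv]; ring
  rw [e]
  generalize ((q - q⁻¹) ^ 2)⁻¹ = κ
  have e1 : ∀ n : ℕ, (q ^ 2) ^ n = (q ^ n) ^ 2 := fun n => by rw [← pow_mul, ← pow_mul, mul_comm]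
  simp only [inv_pow, e1]
  field_simp
  ring

theorem tendsto_dynLeft {q : ℝ} (hq0 : 0 < q) (hq1 : q < 1) (N₁ N₂ : ℕ) (r : ℝ) (x₁ x₂ : ℕ) :
    Tendsto (fun ρ => dynLeft q N₁ N₂ (ρ + r) x₁ x₂) atTop (𝓝 (asepLeft q⁻¹ N₁ N₂ x₁ x₂)) := by
  have hy : Tendsto (fun ρ => q ^ (2 * (ρ + r)) * ((q ^ 2) ^ x₂) ^ 2 / (q ^ 2) ^ N₂) atTop (𝓝 0) := by
    have := (tendsto_rpow_two_mul hq0 hq1).mul_const (q ^ (2 * r) * ((q ^ 2) ^ x₂) ^ 2 / (q ^ 2) ^ N₂)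
    rw [zero_mul] at this
    refine this.congr fun ρ => ?_
    rw [mul_add, Real.rpow_add hq0]
    ring
  have hc : ContinuousAt (fun y : ℝ => asepLeft q N₁ N₂ x₁ x₂
      * ((y + 1 / (q ^ 2) ^ x₁) * (y + (q ^ 2) ^ x₂ / (q ^ 2) ^ N₂) / ((y + 1) * (y + q ^ 2)))) 0 := by
    refine continuousAt_const.mul (ContinuousAt.div (by fun_prop) (by fun_prop) ?_)
    simp [hq0.ne']
  have h := (hc.tendsto.comp hy).congr fun ρ => (dynLeft_eq_inv hq0 N₁ N₂ (ρ + r) x₁ x₂ rfl).symm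
  convert h using 2
  rw [asepLeft_eq hq0 hq1.ne, asepLeft_eq (inv_pos.2 hq0) (by simpa using hq1.ne)]
  have e : (q⁻¹ - q⁻¹⁻¹) ^ 2 = (q - q⁻¹) ^ 2 := by rw [inv_inv]; ring
  rw [e]
  generalize ((q - q⁻¹) ^ 2)⁻¹ = κ
  have e1 : ∀ n : ℕ, (q ^ 2) ^ n = (q ^ n) ^ 2 := fun n => by rw [← pow_mul, ← pow_mul, mul_comm]
  simp only [inv_pow, e1]
  field_simp
  ring

theorem continuous_hahnSum_left (Q : ℝ) (N x n : ℕ) (w : ℝ) :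
    Continuous fun B => hahnSum Q N x B n w := by
  unfold hahnSum hahnTerm
  have := continuous_qPoch Q
  fun_prop

section Affine

variable {m : ℕ} (N : Fin (m + 1) → ℕ)

/-- The affine `q`-Krawtchouk factor with cleared denominators. -/
def affNum (q v : ℝ) (k : Fin (m + 1)) (z x : ℕ) (l r : ℝ) : ℝ :=
  (-v) ^ z / q ^ (z * (z + r + l - N k))
    * hahnSum (q ^ 2) (N k) x 0 z (v * q ^ (r + l - N k + 1))

theorem tendsto_hahnNum_aff {q : ℝ} (hq0 : 0 < q) (hq1 : q < 1) (v : ℝ) (k : Fin (m + 1)) (z x : ℕ)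
    (l r : ℝ) :
    Tendsto (fun ρ : ℝ => q ^ (2 * ρ * z) * hahnNum q (-v * q ^ (-ρ)) (N k) z x l (ρ + r)) atTop
      (𝓝 (affNum N q v k z x l r)) := by
  have hB : Tendsto (fun ρ : ℝ => q ^ (2 * ρ) * (-q ^ (2 * r) * (q ^ 2) ^ x / (q ^ 2) ^ N k)) atTop
      (𝓝 0) := by
    have := (tendsto_rpow_two_mul hq0 hq1).mul_const (-q ^ (2 * r) * (q ^ 2) ^ x / (q ^ 2) ^ N k)
    rwa [zero_mul] at this
  have h := (((continuous_hahnSum_left (q ^ 2) (N k) x z (v * q ^ (r + l - N k + 1))).tendsto 0).comp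
    hB).const_mul ((-v) ^ z / q ^ (z * (z + r + l - N k)))
  refine h.congr fun ρ => ?_
  have e1 : -(-v * q ^ (-ρ)) * q ^ (ρ + r + l - N k + 1) = v * q ^ (r + l - N k + 1) := by
    rw [← neg_mul, neg_neg, mul_assoc, ← Real.rpow_add hq0]
    ring_nf
  have e2 : -q ^ (2 * (ρ + r)) * (q ^ 2) ^ x / (q ^ 2) ^ N k
      = q ^ (2 * ρ) * (-q ^ (2 * r) * (q ^ 2) ^ x / (q ^ 2) ^ N k) := by
    rw [mul_add, Real.rpow_add hq0]
    ring
  have e3 : q ^ (2 * ρ * z) * ((-v * q ^ (-ρ)) ^ z / q ^ (z * (z + (ρ + r) + l - N k)))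
      = (-v) ^ z / q ^ (z * (z + r + l - N k)) := by
    rw [mul_pow, ← Real.rpow_mul_natCast hq0.le, div_eq_mul_inv, div_eq_mul_inv,
      ← Real.rpow_neg hq0.le, ← Real.rpow_neg hq0.le]
    calc _ = (-v) ^ z * (q ^ (2 * ρ * z) * q ^ (-ρ * z) * q ^ (-(z * (z + (ρ + r) + l - N k)))) := by
          ring
      _ = _ := by
        rw [← Real.rpow_add hq0, ← Real.rpow_add hq0]
        ring_nf
  rw [hahnNum, e1, e2, ← mul_assoc, e3]
  rfl

/-- The normalization in the definition of `dualAff`. -/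
theorem tendsto_dualAff {q : ℝ} (hq0 : 0 < q) (hq1 : q < 1) {v : ℝ} (hv : v ≠ 0) (η ξ : Config N) :
    Tendsto (fun ρ : ℝ => q ^ (2 * ρ * total η)
            / cFactor N q 0 (2 * ρ) (-v) (total η) (total ξ)
            * dualHahn N q ρ (-v * q ^ (-ρ)) η ξ)
          atTop (𝓝 (heightProd (affNum N q v) 0 η ξ)) := by
  have h : Tendsto (fun ρ : ℝ => ∏ k, (q ^ (2 * ρ * (η k : ℕ))
      * hahnNum q (-v * q ^ (-ρ)) (N k) (η k) (ξ k) (heightL 0 η k)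
        (ρ + heightR 0 ξ ((k : ℕ) + 1)))) atTop (𝓝 (heightProd (affNum N q v) 0 η ξ)) :=
    tendsto_finsetProd _ fun k _ => tendsto_hahnNum_aff N hq0 hq1 v k _ _ _ _
  have hne : ∀ᶠ ρ : ℝ in atTop,
      qPoch (-v * q ^ (0 - 2 * ρ + 2 * total η - cap N + 1)) (q ^ 2) (cap N - total η) ≠ 0 := by
    simp only [qPoch_ne_zero_iff]
    refine (Set.finite_Iio (cap N - total η)).eventually_all.2 fun i _ => ?_
    have hd : -v * q ^ (2 * (total η : ℝ) - cap N + 1) * (q ^ 2) ^ i ≠ 0 := by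
      have := (Real.rpow_pos_of_pos hq0 (2 * (total η : ℝ) - cap N + 1)).ne'
      simp [hv, hq0.ne', this]
    filter_upwards [(tendsto_rpow_two_mul hq0 hq1).eventually_ne hd.symm] with ρ hρ he
    apply hρ
    have e : q ^ (0 - 2 * ρ + 2 * total η - cap N + 1)
        = (q ^ (2 * ρ))⁻¹ * q ^ (2 * (total η : ℝ) - cap N + 1) := by
      rw [← Real.rpow_neg hq0.le, ← Real.rpow_add hq0]
      ring_nf
    have p := (Real.rpow_pos_of_pos hq0 (2 * ρ)).ne'
    rw [e] at he
    field_simp at he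
    linear_combination -he
  refine h.congr' ?_
  filter_upwards [hne] with ρ hρ
  have hvv : -v * q ^ (0 - 2 * ρ) = -v * q ^ (-ρ) * q ^ (-ρ) := by
    rw [mul_assoc, ← Real.rpow_add hq0]
    ring_nf
  rw [div_mul_eq_mul_div, mul_div_assoc, dualHahn_div_cFactor N hq0 hq1 hvv hρ,
    Finset.prod_mul_distrib, nestedHahnNum, heightProd]
  congr 1
  · rw [← Real.rpow_sum_of_pos hq0, ← Finset.mul_sum, total]
    push_cast
    rfl
  · exact Finset.prod_congr rfl fun k _ => by rw [← heightR_eq_add]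

theorem dualAff_eq {q : ℝ} (hq0 : 0 < q) (hq1 : q < 1) {v : ℝ} (hv : v ≠ 0) (η ξ : Config N) :
    dualAff N q v η ξ = heightProd (affNum N q v) 0 η ξ :=
  (tendsto_dualAff N hq0 hq1 hv η ξ).limUnder_eq

theorem dualAff_eq_nestedAff {q : ℝ} (hq0 : 0 < q) (hq1 : q < 1) {v : ℝ} (hv : v ≠ 0)
    {η ξ : Config N} (h : AffRegular N q v η ξ) :
    dualAff N q v η ξ = nestedAff N q v η ξ := by
  rw [dualAff_eq N hq0 hq1 hv]
  refine Finset.prod_congr rfl fun k _ => ?_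
  have hQ : q ^ 2 ≠ 0 := by positivity
  have e : v * q ^ (heightR 0 ξ ((k : ℕ) + 1) + heightL 0 η k - N k - 1) * q ^ 2
      = v * q ^ (heightR 0 ξ ((k : ℕ) + 1) + heightL 0 η k - N k + 1) := by
    rw [mul_assoc, ← Real.rpow_two, ← Real.rpow_add hq0]
    ring_nf
  rw [affNum, siteAff, affineKrawtchouk_eq (by positivity), e,
    ← qPoch_mul_sum_hahnTerm hQ _ _ _ _ (h k)]
  ring

theorem isDuality_dualAff {q : ℝ} (hq0 : 0 < q) (hq1 : q < 1) {v : ℝ} (hv : v ≠ 0) :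
    IsDuality (genASEP N q) (genASEP N q⁻¹) (dualAff N q v) := by
  intro η ξ
  have hlim : ∀ η ξ : Config N, Tendsto (fun ρ : ℝ => q ^ (2 * ρ * total η)
            / cFactor N q 0 (2 * ρ) (-v) (total η) (total ξ)
            * dualHahn N q ρ (-v * q ^ (-ρ)) η ξ) atTop (𝓝 (dualAff N q v η ξ)) := by
    intro η ξ
    rw [dualAff_eq N hq0 hq1 hv]
    exact tendsto_dualAff N hq0 hq1 hv η ξ
  have hdual : ∀ ρ : ℝ, IsDuality (genASEP N q) (genASEPR N q ρ)
      fun η ξ => q ^ (2 * ρ * total η) / cFactor N q 0 (2 * ρ) (-v) (total η) (total ξ)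
        * dualHahn N q ρ (-v * q ^ (-ρ)) η ξ := by
    intro ρ
    have h := isDuality_dualHahn N hq0 hq1 ρ (-v * q ^ (-ρ))
    rw [genASEPR_eq, genASEP_eq N q 0] at h ⊢
    exact IsDuality.conserved (admissible_liftRate (fun k _ => asep_admissible hq0 hq1.ne _ _) 0)
      (admissible_liftRate (fun k r => dyn_admissible hq0 hq1.ne _ _ r) ρ) h
      fun a b => q ^ (2 * ρ * a) / cFactor N q 0 (2 * ρ) (-v) a b
  have hL := tendsto_bondGen (F := (atTop : Filter ℝ)) (fun η' => hlim η' ξ) η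
    (fun k => tendsto_const_nhds (x := liftRate (fun k _ => asepRight q (N k.castSucc) (N k.succ)) 0 k η))
    (fun k => tendsto_const_nhds (x := liftRate (fun k _ => asepLeft q (N k.castSucc) (N k.succ)) 0 k η))
  have hR := tendsto_bondGen (F := (atTop : Filter ℝ)) (fun ξ' => hlim η ξ') ξ
    (c := fun ρ => liftRate (fun k => dynRight q (N k.castSucc) (N k.succ)) ρ)
    (d := fun ρ => liftRate (fun k => dynLeft q (N k.castSucc) (N k.succ)) ρ)
    (c₀ := liftRate (fun k _ => asepRight q⁻¹ (N k.castSucc) (N k.succ)) 0)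
    (d₀ := liftRate (fun k _ => asepLeft q⁻¹ (N k.castSucc) (N k.succ)) 0)
    (fun k => (tendsto_dynRight hq0 hq1 _ _ (heightR 0 ξ ((k.succ : ℕ) + 1)) _ _).congr
      fun ρ => by rw [← heightR_eq_add]; rfl)
    (fun k => (tendsto_dynLeft hq0 hq1 _ _ (heightR 0 ξ ((k.succ : ℕ) + 1)) _ _).congr
      fun ρ => by rw [← heightR_eq_add]; rfl)
  rw [genASEP_eq N q 0, genASEP_eq N q⁻¹ 0]
  refine tendsto_nhds_unique_of_eventuallyEq hL hR (.of_forall fun ρ => ?_)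
  have h := hdual ρ η ξ
  rw [genASEPR_eq, genASEP_eq N q 0] at h
  exact h

end Affine

end

end QASEP

namespace QASEP

noncomputable section

open Filter Topology

theorem quantumKrawtchouk_coeff {Q : ℝ} (hQ0 : 0 < Q) (hQ1 : Q < 1) (n x : ℕ) {N j : ℕ}
    (hj : j ≤ N) :
    qPoch (Q ^ x)⁻¹ Q j * qPoch (Q ^ n)⁻¹ Q j / (qPoch (Q ^ N)⁻¹ Q j * qPoch Q Q j)
      = falling Q N n j * falling Q N x j * gauss Q N j
        * ((-1) ^ j * Q ^ j.choose 2 * (Q ^ N / (Q ^ n * Q ^ x)) ^ j) := by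
  induction j with
  | zero => simp [qPoch_zero, falling_zero_right, gauss_zero_right hQ0 hQ1]
  | succ j ih =>
    have ih := ih (by omega)
    have g := gauss_succ_right hQ0 hQ1 (Nat.le_of_succ_le hj)
    have h1 : Q ^ j - Q ^ N ≠ 0 := pow_sub_pow_ne_zero hQ0 hQ1 (by omega)
    have h2 : 1 - Q ^ (j + 1) ≠ 0 := (one_sub_pow_pos hQ0 hQ1 (Nat.succ_ne_zero j)).ne'
    have h3 := qPoch_inv_pow_ne_zero hQ0 hQ1 (Nat.le_of_succ_le hj)
    have h4 := (qPoch_self_pos hQ0 hQ1 j).ne'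
    have g' : gauss Q N (j + 1) = gauss Q N j * ((Q ^ j - Q ^ N) / Q ^ j) / (1 - Q ^ (j + 1)) := by
      rw [eq_div_iff h2, g, pow_sub₀ _ hQ0.ne' (Nat.le_of_succ_le hj)]
      field_simp
    have e : ∀ k, 1 - (Q ^ k)⁻¹ * Q ^ j = (Q ^ k)⁻¹ * (Q ^ k - Q ^ j) := fun k => by field_simp
    have hch : (j + 1).choose 2 = j + j.choose 2 := by
      rw [Nat.choose_succ_succ, Nat.choose_one_right]
    have e' : Q ^ N - Q ^ j = -(Q ^ j - Q ^ N) := by ring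
    rw [qPoch_succ, qPoch_succ, qPoch_succ, qPoch_succ, falling_succ, falling_succ, g',
      hch, e, e, e, ← pow_succ' Q j, e']
    have key : qPoch (Q ^ x)⁻¹ Q j * ((Q ^ x)⁻¹ * (Q ^ x - Q ^ j))
          * (qPoch (Q ^ n)⁻¹ Q j * ((Q ^ n)⁻¹ * (Q ^ n - Q ^ j)))
          / (qPoch (Q ^ N)⁻¹ Q j * ((Q ^ N)⁻¹ * -(Q ^ j - Q ^ N))
            * (qPoch Q Q j * (1 - Q ^ (j + 1))))
        = qPoch (Q ^ x)⁻¹ Q j * qPoch (Q ^ n)⁻¹ Q j / (qPoch (Q ^ N)⁻¹ Q j * qPoch Q Q j)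
          * (((Q ^ x)⁻¹ * (Q ^ x - Q ^ j)) * ((Q ^ n)⁻¹ * (Q ^ n - Q ^ j))
            / (((Q ^ N)⁻¹ * -(Q ^ j - Q ^ N)) * (1 - Q ^ (j + 1)))) := by
      rw [div_mul_div_comm]
      ring
    rw [key, ih]
    rw [pow_add Q j (j.choose 2), pow_succ (-1), pow_succ (Q ^ N / _)]
    generalize (Q ^ N / (Q ^ n * Q ^ x)) ^ j = R
    generalize Q ^ (j + 1) = Y at *
    have p1 := pow_ne_zero j hQ0.ne'
    have p2 := pow_ne_zero n hQ0.ne'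
    have p3 := pow_ne_zero x hQ0.ne'
    have p4 := pow_ne_zero N hQ0.ne'
    clear ih key g g' e e' h3 h4
    generalize Q ^ j = J at *
    generalize Q ^ n = a at *
    generalize Q ^ x = b at *
    generalize Q ^ N = c at *
    field_simp
    ring

section Quantum

variable {m : ℕ} (N : Fin (m + 1) → ℕ)

/-- The one-site factor of the first triangular duality function in the factorization of
`nestedQtm`. -/
def siteQtmLeft (q : ℝ) (k : Fin (m + 1)) (n j : ℕ) (l _r : ℝ) : ℝ :=
  falling (q ^ 2) (N k) n j * q ^ ((j : ℝ) * (-2 * n - l + (3 * N k - siteExp N k) / 2))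

/-- The one-site factor of the second triangular duality function in the factorization of
`nestedQtm`. -/
def siteQtmRight (q : ℝ) (k : Fin (m + 1)) (j x : ℕ) (_l r : ℝ) : ℝ :=
  falling (q ^ 2) (N k) x j * q ^ ((j : ℝ) * (r + (N k - siteExp N k) / 2))

theorem isDuality_siteQtmLeft {q : ℝ} (hq0 : 0 < q) (hq1 : q < 1) :
    IsDuality (genASEP N q) (genASEP N q) (heightProd (siteQtmLeft N q) 0) := by
  rw [genASEP_eq N q 0]
  refine isDuality_heightProd (fun k _ => asep_admissible hq0 hq1.ne _ _)
    (fun k _ => asep_admissible hq0 hq1.ne _ _) _ _ _ fun k l r r' => ?_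
  have h := (falling_twoSiteDual hq0 hq1 (N k.castSucc) (N k.succ)).conserved
    (asep_admissible hq0 hq1.ne _ _) (asep_admissible hq0 hq1.ne _ _)
    fun a b => q ^ ((b : ℝ) * (-2 * a - l + (3 * N k.castSucc - siteExp N k.castSucc) / 2))
  convert h using 1
  funext n₁ n₂ j₁ j₂
  have c2 : ∀ a b : ℕ, ((q ^ 2) ^ a) ^ b = q ^ (2 * (a : ℝ) * b) := by
    intro a b
    rw [Real.rpow_mul_natCast hq0.le, rpow_two_mul_natCast hq0]
  have e : q ^ ((j₁ : ℝ) * (-2 * n₁ - l + (3 * N k.castSucc - siteExp N k.castSucc) / 2))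
      * q ^ ((j₂ : ℝ) * (-2 * n₂ - (l + (2 * n₁ - N k.castSucc))
        + (3 * N k.succ - siteExp N k.succ) / 2))
      = q ^ (((j₁ + j₂ : ℕ) : ℝ) * (-2 * ((n₁ + n₂ : ℕ) : ℝ) - l
        + (3 * N k.castSucc - siteExp N k.castSucc) / 2))
        * (q ^ (2 * (n₂ : ℝ) * j₁) * q ^ (2 * (N k.succ : ℝ) * j₂)) := by
    simp only [← Real.rpow_add hq0]
    congr 1
    rw [siteExp_succ]
    push_cast
    ring
  simp only [twoSite, siteQtmLeft, c2]
  linear_combination (falling (q ^ 2) (N k.castSucc) n₁ j₁ * falling (q ^ 2) (N k.succ) n₂ j₂) * e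

theorem isDuality_siteQtmRight {q : ℝ} (hq0 : 0 < q) (hq1 : q < 1) :
    IsDuality (genASEP N q) (genASEP N q) (heightProd (siteQtmRight N q) 0) := by
  rw [genASEP_eq N q 0]
  refine isDuality_heightProd (fun k _ => asep_admissible hq0 hq1.ne _ _)
    (fun k _ => asep_admissible hq0 hq1.ne _ _) _ _ _ fun k l r r' => ?_
  have h := (falling_twoSiteDual hq0 hq1 (N k.castSucc) (N k.succ)).symm.conserved
    (asep_admissible hq0 hq1.ne _ _) (asep_admissible hq0 hq1.ne _ _)
    fun a _ => q ^ ((a : ℝ) * (r - N k.succ + (N k.castSucc - siteExp N k.castSucc) / 2))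
  convert h using 1
  funext j₁ j₂ x₁ x₂
  have c2 : ∀ a b : ℕ, ((q ^ 2) ^ a) ^ b = q ^ (2 * (a : ℝ) * b) := by
    intro a b
    rw [Real.rpow_mul_natCast hq0.le, rpow_two_mul_natCast hq0]
  have e : q ^ ((j₁ : ℝ) * (r + (2 * x₂ - N k.succ) + (N k.castSucc - siteExp N k.castSucc) / 2))
      * q ^ ((j₂ : ℝ) * (r + (N k.succ - siteExp N k.succ) / 2))
      = q ^ (((j₁ + j₂ : ℕ) : ℝ) * (r - N k.succ + (N k.castSucc - siteExp N k.castSucc) / 2))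
        * (q ^ (2 * (x₂ : ℝ) * j₁) * q ^ (2 * (N k.succ : ℝ) * j₂)) := by
    simp only [← Real.rpow_add hq0]
    congr 1
    rw [siteExp_succ]
    push_cast
    ring
  simp only [twoSite, siteQtmRight, c2]
  linear_combination (falling (q ^ 2) (N k.castSucc) x₁ j₁ * falling (q ^ 2) (N k.succ) x₂ j₂) * e

theorem siteQtm_eq_sum {q : ℝ} (hq0 : 0 < q) (n x : ℕ) (l r v : ℝ) (M : ℕ) :
    siteQtm n x l r v M q = ∑ j ∈ Finset.range (x + 1),
      qPoch ((q ^ 2) ^ x)⁻¹ (q ^ 2) j * qPoch ((q ^ 2) ^ n)⁻¹ (q ^ 2) j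
        / (qPoch ((q ^ 2) ^ M)⁻¹ (q ^ 2) j * qPoch (q ^ 2) (q ^ 2) j)
        * (v⁻¹ * q ^ (r - l - M + 1) * (q ^ 2) ^ x) ^ j := by
  have e : v⁻¹ * q ^ (r - l - M - 1) * q ^ 2 = v⁻¹ * q ^ (r - l - M + 1) := by
    rw [mul_assoc, ← Real.rpow_two, ← Real.rpow_add hq0]
    ring_nf
  rw [siteQtm, quantumKrawtchouk_eq (by positivity), e]

theorem siteQtm_eq {q : ℝ} (hq0 : 0 < q) (hq1 : q < 1) (k : Fin (m + 1)) (n : ℕ) {x : ℕ}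
    (hx : x ≤ N k) (l r v : ℝ) :
    siteQtm n x l r v (N k) q = ∑ j ∈ Finset.range (N k + 1), siteQtmLeft N q k n j l 0
      * (siteWeight N q k j * ((-v⁻¹) ^ j * siteQtmRight N q k j x 0 r)) := by
  have hQ0 : 0 < q ^ 2 := by positivity
  have hQ1 : q ^ 2 < 1 := pow_lt_one₀ hq0.le hq1 two_ne_zero
  rw [siteQtm_eq_sum hq0, Finset.sum_subset (Finset.range_mono (Nat.succ_le_succ hx))]
  · refine Finset.sum_congr rfl fun j hj => ?_
    have c2 : ∀ a b : ℕ, ((q ^ 2) ^ a) ^ b = q ^ (2 * (a : ℝ) * b) := by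
      intro a b
      rw [Real.rpow_mul_natCast hq0.le, rpow_two_mul_natCast hq0]
    have e : (q ^ 2) ^ j.choose 2 * ((q ^ 2) ^ N k / ((q ^ 2) ^ n * (q ^ 2) ^ x)) ^ j
        * (q ^ (r - l - N k + 1) * (q ^ 2) ^ x) ^ j
        = q ^ ((j : ℝ) * (-2 * n - l + (3 * N k - siteExp N k) / 2))
          * (q ^ ((j : ℝ) * siteExp N k) * q ^ ((j : ℝ) * ((j : ℝ) - N k)))
          * q ^ ((j : ℝ) * (r + (N k - siteExp N k) / 2)) := by
      calc _ = ((q ^ 2) ^ j.choose 2 * q ^ j) * (((q ^ 2) ^ N k / (q ^ 2) ^ n) ^ j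
            * (q ^ (r - l - N k)) ^ j) := by
            have h : (q ^ 2) ^ N k / ((q ^ 2) ^ n * (q ^ 2) ^ x)
                * (q ^ (r - l - N k + 1) * (q ^ 2) ^ x)
                = q * ((q ^ 2) ^ N k / (q ^ 2) ^ n * q ^ (r - l - N k)) := by
              rw [Real.rpow_add hq0 (r - l - N k), Real.rpow_one]
              field_simp
            rw [mul_assoc, ← mul_pow, h, mul_pow, mul_pow]
            ring
        _ = _ := by
          rw [← rpow_natCast_sq, div_pow, c2, c2, ← Real.rpow_mul_natCast hq0.le]
          simp only [← Real.rpow_add hq0, ← Real.rpow_sub hq0]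
          congr 1
          ring
    rw [quantumKrawtchouk_coeff hQ0 hQ1 _ _ (Nat.lt_succ_iff.1 (Finset.mem_range.1 hj)), siteQtmLeft,
      siteQtmRight, siteWeight, neg_pow v⁻¹, mul_assoc v⁻¹, mul_pow v⁻¹]
    linear_combination (falling (q ^ 2) (N k) n j * falling (q ^ 2) (N k) x j
      * gauss (q ^ 2) (N k) j * (-1) ^ j * v⁻¹ ^ j) * e
  · intro j _ hj
    rw [qPoch_inv_pow_eq_zero hQ0.ne' (n := x) (by simpa [Nat.lt_succ_iff] using hj)]
    simp

theorem nestedQtm_eq {q : ℝ} (hq0 : 0 < q) (hq1 : q < 1) (v : ℝ) (η ξ : Config N) :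
    nestedQtm N q v η ξ = ∑ j : Config N, heightProd (siteQtmLeft N q) 0 η j
      * (weight N q j * ((-v⁻¹) ^ total j * heightProd (siteQtmRight N q) 0 j ξ)) := by
  have h : ∀ k : Fin (m + 1), siteQtm (η k) (ξ k) (heightL 0 η k) (heightR 0 ξ ((k : ℕ) + 1)) v (N k) q
      = ∑ j : Fin (N k + 1), siteQtmLeft N q k (η k) j (heightL 0 η k) 0 * (siteWeight N q k j
        * ((-v⁻¹) ^ (j : ℕ) * siteQtmRight N q k j (ξ k) 0 (heightR 0 ξ ((k : ℕ) + 1)))) :=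
    fun k => by rw [siteQtm_eq N hq0 hq1 k _ (val_le ξ k), Finset.sum_range]
  rw [nestedQtm, Finset.prod_congr rfl fun k _ => h k, Finset.prod_univ_sum, Fintype.piFinset_univ]
  refine Finset.sum_congr rfl fun j _ => ?_
  rw [weight_eq N hq0, total, ← Finset.prod_pow_eq_pow_sum]
  simp only [Finset.prod_mul_distrib]
  rfl

theorem isDuality_nestedQtm {q : ℝ} (hq0 : 0 < q) (hq1 : q < 1) (v : ℝ) :
    IsDuality (genASEP N q) (genASEP N q) (nestedQtm N q v) := by
  have e : nestedQtm N q v = fun η ξ => ∑ j : Config N, heightProd (siteQtmLeft N q) 0 η j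
      * (weight N q j * ((-v⁻¹) ^ total j * heightProd (siteQtmRight N q) 0 j ξ)) := by
    funext η ξ
    exact nestedQtm_eq N hq0 hq1 v η ξ
  have h₁ := isDuality_siteQtmLeft N hq0 hq1
  have h₂ := isDuality_siteQtmRight N hq0 hq1
  rw [e]
  rw [genASEP_eq N q 0] at h₁ h₂ ⊢
  exact IsDuality.comp (admissible_liftRate (fun k _ => asep_admissible hq0 hq1.ne _ _) 0)
    (reversible_weight N hq0 hq1 0) h₁ h₂ fun a => (-v⁻¹) ^ a

end Quantum

end

end QASEP

namespace QASEP

noncomputable section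

open Filter Topology

/-- The leading coefficient of `hahnSum` when both `B` and `w` tend to infinity. -/
theorem tendsto_hahnSum {Q : ℝ} (N x n : ℕ) (β ω : ℝ) (hω : ω ≠ 0) :
    Tendsto (fun y => y ^ x * hahnSum Q N x (β / y) n (ω / y)) (𝓝[≠] 0)
      (𝓝 ((∏ i ∈ Finset.range x, (0 - ω * Q ^ i))
        * ∑ j ∈ Finset.range (x + 1), qPoch (Q ^ x)⁻¹ Q j * qPoch (Q ^ n)⁻¹ Q j
          / (qPoch (Q ^ N)⁻¹ Q j * qPoch Q Q j) * (β / ω * Q) ^ j)) := by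
  set a : ℕ → ℝ := fun j => qPoch (Q ^ x)⁻¹ Q j * qPoch (Q ^ n)⁻¹ Q j
    / (qPoch (Q ^ N)⁻¹ Q j * qPoch Q Q j) with ha
  have hc : Continuous fun y : ℝ => ∑ j ∈ Finset.range (x + 1), a j * Q ^ j
      * ((∏ i ∈ Finset.range j, (y - β * Q ^ i))
        * ∏ i ∈ Finset.range (x - j), (y - ω * Q ^ j * Q ^ i)) := by fun_prop
  refine ((hc.tendsto' 0 _ ?_).mono_left nhdsWithin_le_nhds).congr' ?_
  · rw [Finset.mul_sum]
    refine Finset.sum_congr rfl fun j hj => ?_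
    have hjx : j ≤ x := Nat.lt_succ_iff.1 (Finset.mem_range.1 hj)
    have e1 : ∏ i ∈ Finset.range j, (0 - β * Q ^ i)
        = (β / ω) ^ j * ∏ i ∈ Finset.range j, (0 - ω * Q ^ i) := by
      rw [Finset.pow_eq_prod_const, ← Finset.prod_mul_distrib]
      exact Finset.prod_congr rfl fun i _ => by field_simp; ring
    have e2 : ∏ i ∈ Finset.range x, (0 - ω * Q ^ i) = (∏ i ∈ Finset.range j, (0 - ω * Q ^ i))
        * ∏ i ∈ Finset.range (x - j), (0 - ω * Q ^ j * Q ^ i) := by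
      rw [← Nat.add_sub_cancel' hjx, Finset.prod_range_add, Nat.add_sub_cancel' hjx]
      congr 1
      exact Finset.prod_congr rfl fun i _ => by rw [pow_add, mul_assoc]
    rw [e1, e2, mul_pow]
    ring
  · filter_upwards [self_mem_nhdsWithin] with y hy
    rw [hahnSum, Finset.mul_sum]
    refine Finset.sum_congr rfl fun j hj => ?_
    have hjx : j ≤ x := Nat.lt_succ_iff.1 (Finset.mem_range.1 hj)
    have hz : y ^ x = y ^ j * y ^ (x - j) := by
      rw [← pow_add, Nat.add_sub_cancel' hjx]
    rw [← pow_mul_qPoch_div hy, ← pow_mul_qPoch_div hy, hahnTerm, hz, ha,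
      div_mul_eq_mul_div ω]
    ring

theorem prod_zero_sub {q : ℝ} (hq : 0 < q) (v c : ℝ) (a : ℕ) :
    ∏ i ∈ Finset.range a, (0 - -v * q ^ (c + 1) * (q ^ 2) ^ i)
      = v ^ a * q ^ ((a : ℝ) * (c + a)) := by
  have h : ∏ i ∈ Finset.range a, (0 - -v * q ^ (c + 1) * (q ^ 2) ^ i)
      = (v * q ^ (c + 1)) ^ a * ∏ i ∈ Finset.range a, (q ^ 2) ^ i := by
    rw [Finset.pow_eq_prod_const (v * q ^ (c + 1)), ← Finset.prod_mul_distrib]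
    exact Finset.prod_congr rfl fun i _ => by ring
  have h2 : ∏ i ∈ Finset.range a, (q ^ 2) ^ i = (q ^ 2) ^ a.choose 2 := by
    rw [Finset.prod_pow_eq_pow_sum, Finset.sum_range_id, Nat.choose_two_right]
  have h3 := rpow_natCast_sq q a
  rw [h, h2, mul_pow, Real.rpow_add hq c, Real.rpow_one, mul_pow]
  calc _ = v ^ a * ((q ^ c) ^ a * ((q ^ 2) ^ a.choose 2 * q ^ a)) := by ring
    _ = _ := by
      rw [← h3, ← Real.rpow_mul_natCast hq.le, ← Real.rpow_add hq]
      congr 2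
      ring

section Quantum

variable {m : ℕ} {N : Fin (m + 1) → ℕ}

theorem heightL_zero (lam : ℝ) (η : Config N) : heightL lam η 0 = lam := by
  simp [heightL]

theorem heightR_last (ρ : ℝ) (ξ : Config N) : heightR ρ ξ (m + 1) = ρ := by
  rw [heightR, Finset.sum_eq_zero, add_zero]
  intro j _
  rw [if_neg (by omega)]

theorem heightR_zero (ρ : ℝ) (ξ : Config N) : heightR ρ ξ 0 = ρ + (2 * total ξ - cap N) := by
  simp [heightR, total, cap, occ, Finset.sum_sub_distrib, Finset.mul_sum]

theorem heightL_last (lam : ℝ) (η : Config N) :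
    heightL lam η (m + 1) = lam + (2 * total η - cap N) := by
  rw [heightL, Finset.sum_congr rfl fun j _ => if_pos j.2]
  simp [ total, cap, occ, Finset.sum_sub_distrib, Finset.mul_sum]

theorem sum_height_telescope (η ξ : Config N) :
    ∑ k : Fin (m + 1), (((ξ k : ℕ) : ℝ) * (heightR 0 ξ ((k : ℕ) + 1) + heightL 0 η k - N k + (ξ k : ℕ))
        - ((η k : ℕ) : ℝ) * ((η k : ℕ) + heightR 0 ξ ((k : ℕ) + 1) + heightL 0 η k - N k))
      = (total ξ : ℝ) * (total ξ - cap N) - (total η : ℝ) * (total η - cap N) := by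
  let f : ℕ → ℝ := fun k => -(heightL 0 η k + heightR 0 ξ k) ^ 2 / 4
  have h : ∀ k : Fin (m + 1),
      ((ξ k : ℕ) : ℝ) * (heightR 0 ξ ((k : ℕ) + 1) + heightL 0 η k - N k + (ξ k : ℕ))
        - ((η k : ℕ) : ℝ) * ((η k : ℕ) + heightR 0 ξ ((k : ℕ) + 1) + heightL 0 η k - N k)
      = f ((k : ℕ) + 1) - f k := by
    intro k
    simp only [f, heightL_succ, heightR_succ 0 ξ k, occ]
    ring
  rw [Finset.sum_congr rfl fun k _ => h k, Fin.sum_univ_eq_sum_range (fun k => f (k + 1) - f k),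
    Finset.sum_range_sub]
  simp only [f, heightL_zero, heightR_last, heightR_zero, heightL_last]
  ring

variable (N)

theorem tendsto_hahnNum_qtm {q : ℝ} (hq0 : 0 < q) (hq1 : q < 1) {v : ℝ} (hv : v ≠ 0) (M n x : ℕ)
    (l r : ℝ) :
    Tendsto (fun ρ : ℝ => (q ^ (-2 * ρ)) ^ x * hahnNum q (v * q ^ ρ) M n x l (ρ + r)) atBot
      (𝓝 (v ^ n * v ^ x * q ^ ((x : ℝ) * (r + l - M + x) - n * (n + r + l - M))
        * siteQtm n x l r v M q)) := by
  have hy : Tendsto (fun ρ : ℝ => q ^ (-2 * ρ)) atBot (𝓝[≠] 0) := by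
    refine tendsto_nhdsWithin_iff.2 ⟨?_, .of_forall fun ρ => (Real.rpow_pos_of_pos hq0 _).ne'⟩
    refine ((tendsto_rpow_two_mul hq0 hq1).comp tendsto_neg_atBot_atTop).congr fun ρ => ?_
    simp
  have hω : -v * q ^ (r + l - M + 1) ≠ 0 :=
    mul_ne_zero (neg_ne_zero.2 hv) (Real.rpow_pos_of_pos hq0 _).ne'
  have h := ((tendsto_hahnSum (Q := q ^ 2) M x n (-q ^ (2 * r) * (q ^ 2) ^ x / (q ^ 2) ^ M) _
    hω).comp hy).const_mul (v ^ n / q ^ (n * (n + r + l - M)))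
  have e0 : -q ^ (2 * r) * (q ^ 2) ^ x / (q ^ 2) ^ M / (-v * q ^ (r + l - M + 1)) * q ^ 2
      = v⁻¹ * q ^ (r - l - M + 1) * (q ^ 2) ^ x := by
    have : q ^ (2 * r) * q ^ 2 = q ^ (r - l - M + 1) * q ^ (r + l - M + 1) * (q ^ 2) ^ M := by
      rw [← rpow_two_mul_natCast hq0, ← Real.rpow_two, ← Real.rpow_add hq0, ← Real.rpow_add hq0,
        ← Real.rpow_add hq0]
      ring_nf
    have p := (Real.rpow_pos_of_pos hq0 (r + l - M + 1)).ne'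
    field_simp
    linear_combination this
  rw [e0, prod_zero_sub hq0 v (r + l - M) x, ← siteQtm_eq_sum hq0] at h
  have e1 : v ^ n / q ^ (n * (n + r + l - M)) * (v ^ x * q ^ ((x : ℝ) * (r + l - M + x))
        * siteQtm n x l r v M q)
      = v ^ n * v ^ x * q ^ ((x : ℝ) * (r + l - M + x) - n * (n + r + l - M))
        * siteQtm n x l r v M q := by
    rw [Real.rpow_sub hq0]
    ring
  rw [e1] at h
  refine h.congr fun ρ => ?_
  have i1 : -q ^ (2 * (ρ + r)) * (q ^ 2) ^ x / (q ^ 2) ^ M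
      = -q ^ (2 * r) * (q ^ 2) ^ x / (q ^ 2) ^ M / q ^ (-2 * ρ) := by
    rw [show 2 * (ρ + r) = 2 * r - -2 * ρ by ring, Real.rpow_sub hq0]
    ring
  have i2 : -(v * q ^ ρ) * q ^ (ρ + r + l - M + 1) = -v * q ^ (r + l - M + 1) / q ^ (-2 * ρ) := by
    rw [mul_div_assoc, ← Real.rpow_sub hq0, ← neg_mul, mul_assoc, ← Real.rpow_add hq0]
    ring_nf
  have i3 : (v * q ^ ρ) ^ n / q ^ (n * (n + (ρ + r) + l - M)) = v ^ n / q ^ (n * (n + r + l - M)) := by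
    rw [mul_pow, ← Real.rpow_mul_natCast hq0.le, mul_div_assoc, ← Real.rpow_sub hq0, div_eq_mul_inv,
      ← Real.rpow_neg hq0.le]
    ring_nf
  rw [hahnNum, i1, i2, i3]
  simp only [Function.comp]
  ring

theorem tendsto_dualQtm {q : ℝ} (hq0 : 0 < q) (hq1 : q < 1) {v : ℝ} (hv : v ≠ 0)
    (hcap : qPoch (v * q ^ (1 - (cap N : ℝ))) (q ^ 2) (cap N) ≠ 0) (η ξ : Config N) :
    Tendsto (fun ρ : ℝ => (v ^ (-2 : ℤ) * q ^ (-2 * ρ)) ^ total η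
              / (cFactor N q 0 0 v (total η) (total ξ)
                * CFactor N q 0 (2 * ρ) v (total η) (total ξ))
              * dualHahn N q ρ (v * q ^ ρ) η ξ)
            atBot (𝓝 (nestedQtm N q v η ξ)) := by
  have hy : Tendsto (fun ρ : ℝ => q ^ (-2 * ρ)) atBot (𝓝 0) := by
    refine ((tendsto_rpow_two_mul hq0 hq1).comp tendsto_neg_atBot_atTop).congr fun ρ => ?_
    simp
  have h := tendsto_finsetProd Finset.univ fun (k : Fin (m + 1)) _ =>
    tendsto_hahnNum_qtm hq0 hq1 hv (N k) (η k) (ξ k) (heightL 0 η k) (heightR 0 ξ ((k : ℕ) + 1))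
  have hpoly : ∀ a : ℕ, Tendsto (fun ρ : ℝ =>
      ∏ i ∈ Finset.range a, (q ^ (-2 * ρ) - -v * q ^ (-(cap N : ℝ) + 1) * (q ^ 2) ^ i)) atBot
      (𝓝 (v ^ a * q ^ ((a : ℝ) * (-(cap N : ℝ) + a)))) := by
    intro a
    rw [← prod_zero_sub hq0]
    exact tendsto_finsetProd _ fun i _ => hy.sub_const _
  have hne : v ^ total ξ * q ^ ((total ξ : ℝ) * (-(cap N : ℝ) + total ξ)) ≠ 0 :=
    mul_ne_zero (pow_ne_zero _ hv) (Real.rpow_pos_of_pos hq0 _).ne'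
  have h' := (((hpoly (total η)).div (hpoly (total ξ)) hne).const_mul
    ((v ^ (-2 : ℤ)) ^ total η)).mul h
  have hlim : (v ^ (-2 : ℤ)) ^ total η * (v ^ total η * q ^ ((total η : ℝ) * (-(cap N : ℝ) + total η))
        / (v ^ total ξ * q ^ ((total ξ : ℝ) * (-(cap N : ℝ) + total ξ))))
      * ∏ k, (v ^ (η k : ℕ) * v ^ (ξ k : ℕ) * q ^ (((ξ k : ℕ) : ℝ) * (heightR 0 ξ ((k : ℕ) + 1)
          + heightL 0 η k - N k + (ξ k : ℕ))
        - ((η k : ℕ) : ℝ) * ((η k : ℕ) + heightR 0 ξ ((k : ℕ) + 1) + heightL 0 η k - N k))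
        * siteQtm (η k) (ξ k) (heightL 0 η k) (heightR 0 ξ ((k : ℕ) + 1)) v (N k) q)
      = nestedQtm N q v η ξ := by
    rw [Finset.prod_mul_distrib, Finset.prod_mul_distrib, Finset.prod_mul_distrib,
      Finset.prod_pow_eq_pow_sum, Finset.prod_pow_eq_pow_sum, ← Real.rpow_sum_of_pos hq0,
      sum_height_telescope, Real.rpow_sub hq0]
    change _ * ((v ^ total η * v ^ total ξ) * _ * nestedQtm N q v η ξ) = _
    have e1 : ∀ a : ℝ, a * (a - cap N) = a * (-(cap N : ℝ) + a) := fun a => by ring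
    have e2 : (v ^ (-2 : ℤ)) ^ total η = (v ^ total η)⁻¹ * (v ^ total η)⁻¹ := by
      rw [zpow_neg, inv_pow, ← mul_inv, ← mul_pow]
      congr 2
      rw [zpow_ofNat, sq]
    rw [e1, e1, e2]
    have p1 := (Real.rpow_pos_of_pos hq0 ((total η : ℝ) * (-(cap N : ℝ) + total η))).ne'
    have p2 := (Real.rpow_pos_of_pos hq0 ((total ξ : ℝ) * (-(cap N : ℝ) + total ξ))).ne'
    generalize q ^ ((total η : ℝ) * (-(cap N : ℝ) + total η)) = X at *
    generalize q ^ ((total ξ : ℝ) * (-(cap N : ℝ) + total ξ)) = Y at *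
    field_simp
  rw [← hlim]
  refine h'.congr fun ρ => ?_
  have hρ : v * q ^ ((0 : ℝ) - 0) = v * q ^ ρ * q ^ (-ρ) := by
    rw [mul_assoc, ← Real.rpow_add hq0]
    ring_nf
  have hnum : qPoch (v * q ^ ((0 : ℝ) - 0 + 2 * total η - cap N + 1)) (q ^ 2) (cap N - total η) ≠ 0 := by
    refine qPoch_ne_zero_iff.2 fun i hi he => qPoch_ne_zero_iff.1 hcap (total η + i) (by omega) ?_
    have e : q ^ ((0 : ℝ) - 0 + 2 * total η - cap N + 1)
        = q ^ (1 - (cap N : ℝ)) * (q ^ 2) ^ total η := by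
      rw [← rpow_two_mul_natCast hq0, ← Real.rpow_add hq0]
      ring_nf
    rw [e] at he
    rw [pow_add]
    linear_combination he
  have hdiv := dualHahn_div_cFactor N hq0 hq1 hρ (ξ := ξ) hnum
  have hy0 : q ^ (-2 * ρ) ≠ 0 := (Real.rpow_pos_of_pos hq0 _).ne'
  have hκ : -v * q ^ (0 + 2 * ρ - cap N + 1) = -v * q ^ (-(cap N : ℝ) + 1) / q ^ (-2 * ρ) := by
    rw [mul_div_assoc, ← Real.rpow_sub hq0]
    ring_nf
  have hy : ∏ k, (q ^ (-2 * ρ)) ^ (ξ k : ℕ) = (q ^ (-2 * ρ)) ^ total ξ :=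
    Finset.prod_pow_eq_pow_sum _ _ _
  have hnest : nestedHahnNum N q ρ (v * q ^ ρ) η ξ = ∏ k, hahnNum q (v * q ^ ρ) (N k) (η k) (ξ k)
      (heightL 0 η k) (ρ + heightR 0 ξ ((k : ℕ) + 1)) := by
    rw [nestedHahnNum, heightProd]
    exact Finset.prod_congr rfl fun k _ => by rw [heightR_eq_add ρ]
  rw [Pi.div_apply, Finset.prod_mul_distrib, hy, ← hnest, ← hdiv, CFactor, hκ, ← pow_mul_qPoch_div hy0,
    ← pow_mul_qPoch_div hy0, mul_pow (v ^ (-2 : ℤ))]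
  generalize q ^ (-2 * ρ) = y at hy0
  rw [mul_div_mul_comm]
  simp only [div_eq_mul_inv, mul_inv, inv_inv]
  field_simp

end Quantum

end

end QASEP

theorem proposition4p1 {m : ℕ} (N : Fin (m + 1) → ℕ) (hN : ∀ k, 1 ≤ N k)
    (q : ℝ) (hq0 : 0 < q) (hq1 : q < 1) :
    -- (i) `q`-Hahn: duality between `ASEP(q,N)` and `ASEP_R(q,N,ρ)`
    (∀ ρ v : ℝ, v ≠ 0 →
      (∀ η ξ : Config N,
        Tendsto (fun lam : ℝ => q ^ (2 * lam * total η) * dualRacah N q lam ρ (v * q ^ (-lam)) η ξ)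
          atTop (𝓝 (dualHahn N q ρ v η ξ))) ∧
      IsDuality (genASEP N q) (genASEPR N q ρ) (dualHahn N q ρ v) ∧
      (∀ η ξ : Config N, HahnRegular N q ρ v η ξ →
        dualHahn N q ρ v η ξ = nestedHahn N q ρ v η ξ)) ∧
    -- (ii) quantum `q`-Krawtchouk: self-duality of `ASEP(q,N)`
    (∀ v : ℝ, v ≠ 0 →
      IsDuality (genASEP N q) (genASEP N q) (nestedQtm N q v) ∧
      (qPoch (v * q ^ (1 - (cap N : ℝ))) (q ^ 2) (cap N) ≠ 0 →
        (∀ η ξ : Config N,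
          Tendsto (fun ρ : ℝ => (v ^ (-2 : ℤ) * q ^ (-2 * ρ)) ^ total η
              / (cFactor N q 0 0 v (total η) (total ξ)
                * CFactor N q 0 (2 * ρ) v (total η) (total ξ))
              * dualHahn N q ρ (v * q ^ ρ) η ξ)
            atBot (𝓝 (dualQtm N q v η ξ))) ∧
        IsDuality (genASEP N q) (genASEP N q) (dualQtm N q v) ∧
        (∀ η ξ : Config N, dualQtm N q v η ξ = nestedQtm N q v η ξ))) ∧
    -- (iii) affine `q`-Krawtchouk: duality between `ASEP(q,N)` and `ASEP(q⁻¹,N)`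
    (∀ v : ℝ, v ≠ 0 →
      (∀ η ξ : Config N,
        Tendsto (fun ρ : ℝ => q ^ (2 * ρ * total η)
            / cFactor N q 0 (2 * ρ) (-v) (total η) (total ξ)
            * dualHahn N q ρ (-v * q ^ (-ρ)) η ξ)
          atTop (𝓝 (dualAff N q v η ξ))) ∧
      IsDuality (genASEP N q) (genASEP N q⁻¹) (dualAff N q v) ∧
      (∀ η ξ : Config N, AffRegular N q v η ξ →
        dualAff N q v η ξ = nestedAff N q v η ξ)) := by
  refine ⟨fun ρ v hv => ⟨fun η ξ => ?_, isDuality_dualHahn N hq0 hq1 ρ v, fun η ξ h =>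
    dualHahn_eq_nestedHahn N hq0 hq1 hv h⟩, fun v hv => ⟨isDuality_nestedQtm N hq0 hq1 v,
    fun hcap => ?_⟩, fun v hv => ⟨fun η ξ => ?_, isDuality_dualAff N hq0 hq1 hv, fun η ξ h =>
    dualAff_eq_nestedAff N hq0 hq1 hv h⟩⟩
  · rw [dualHahn_eq N hq0 hq1]
    exact tendsto_dualRacah N hq0 hq1 ρ v η ξ
  · have h := tendsto_dualQtm N hq0 hq1 hv hcap
    have e : dualQtm N q v = nestedQtm N q v := by
      funext η ξ
      exact (h η ξ).limUnder_eq
    rw [e]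
    exact ⟨h, isDuality_nestedQtm N hq0 hq1 v, fun _ _ => rfl⟩
  · rw [dualAff_eq N hq0 hq1 hv]
    exact tendsto_dualAff N hq0 hq1 hv η ξ
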